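/- Conventions. Trees grow downward, so the nodes strictly above a node $t$ are well-ordered by $>$, and the level of $t$ is the order type of that set. An Aronszajn tree is a tree of height $\omega_1$ with countable levels and no uncountable chain; as usual for $\omega_1$-trees, every node is assumed to have extensions at all higher levels below $\omega_1$. A Souslin tree $S$ is an infinitely branching tree of height $\omega_1$, all of whose nodes have extensions at all higher levels, with countable levels and no uncountable chain or antichain, consisting of functions from countable ordinals to $\omega$, closed under restriction to smaller ordinals and ordered by reverse inclusion. It is free if for every finite set $F$ of distinct nodes on one level of $S$ the product $\prod_{s\in F}S\restriction s$ is c.c.c., where $S\restriction s=\{t\in S: t\le s\}$. A tree $S$ is special if there is a function $f:S\to\omega$ with $f(s)\neq f(t)$ whenever $s\ne t$ are comparable. $\mathbb C_{\aleph_1}$ is the forcing adding $\aleph_1$ Cohen reals (finite partial functions from $\omega_1$ to $\{0,1\}$, ordered by reverse inclusion). Lemma 4.8. For every Aronszajn tree $T$, $$\mathbb C_{\aleph_1}\Vdash\text{``there is a free Souslin tree } S \text{ such that } T\Vdash \check S\text{ is special''}.$$ -/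

import Mathlib

open scoped Ordinal

universe u

/-! ### Trees in the ground model -/

/-- Trees grow downward: the nodes above a given node are well-ordered by `>`. -/
class DownwardTree (T : Type u) [PartialOrder T] : Prop where
  wo (t : T) : IsWellOrder (Set.Ioi t) (· > ·)

/-- The level of a node: the order type of the set of its strict predecessors. -/
noncomputable def DownwardTree.lev {T : Type u} [PartialOrder T] [DownwardTree T] (t : T) :
    Ordinal.{u} :=
  haveI := DownwardTree.wo t
  Ordinal.type (fun a b : Set.Ioi t => a > b)

/-- Aronszajn trees: trees of height `ω₁` with countable levels and without uncountable chains.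
As usual for `ω₁`-trees, every node is required to have extensions at all higher levels. -/
structure IsAronszajn (T : Type u) [PartialOrder T] [DownwardTree T] : Prop where
  lev_lt (t : T) : DownwardTree.lev t < ω₁
  level_nonempty (α : Ordinal.{u}) : α < ω₁ → {t : T | DownwardTree.lev t = α}.Nonempty
  level_countable (α : Ordinal.{u}) : α < ω₁ → {t : T | DownwardTree.lev t = α}.Countable
  chain_countable (c : Set T) : IsChain (· ≤ ·) c → c.Countable
  extend (t : T) (α : Ordinal.{u}) : DownwardTree.lev t ≤ α → α < ω₁ →
    ∃ s ≤ t, DownwardTree.lev s = α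

/-! ### Cohen forcing -/

/-- Finite partial functions from `I` to `{0, 1}`, given by their graphs. -/
@[ext]
structure CohenPoset (I : Type u) where
  graph : Finset (I × Bool)
  functional : ∀ i v w, (i, v) ∈ graph → (i, w) ∈ graph → v = w

/-- Cohen conditions are ordered by reverse inclusion. -/
instance (I : Type u) : PartialOrder (CohenPoset I) where
  le p q := q.graph ⊆ p.graph
  le_refl p := Finset.Subset.refl p.graph
  le_trans _ _ _ h h' := Finset.Subset.trans h' h
  le_antisymm _ _ h h' := CohenPoset.ext (Finset.Subset.antisymm h' h)

/-- The forcing adding `ℵ₁` Cohen reals. -/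
abbrev CohenAlephOne : Type u := CohenPoset (ω₁ : Ordinal.{u}).ToType

namespace Forcing

/-! ### Names and the forcing relation

The ground model consists of the (hereditarily `Type u`-sized) sets. -/

/-- A `P`-name is a set of pairs `(x i, c i)`, each consisting of a `P`-name and a condition. -/
inductive PName (P : Type u) : Type (u + 1)
  | mk (ι : Type u) (x : ι → PName P) (c : ι → P) : PName P

/-- A formula of the forcing language (with names substituted for its free variables), identified
with the set of conditions forcing it. The formulas used below are all built from the atomic
formulas by the connectives and quantifiers that follow; `φ p` is read `p ⊩ φ`. -/
abbrev Form (P : Type u) : Type u := P → Prop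

section
variable {P : Type u} [Preorder P]

/-- `p ⊩ x = y`: every element of one name is forced, below `p` and below its own condition, to
equal an element of the other name. -/
def eq : PName P → PName P → Form P
  | .mk _ x c, .mk _ y d => fun p =>
    (∀ i, ∀ q ≤ p, q ≤ c i → ∃ r ≤ q, ∃ j, r ≤ d j ∧ eq (x i) (y j) r) ∧
    (∀ j, ∀ q ≤ p, q ≤ d j → ∃ r ≤ q, ∃ i, r ≤ c i ∧ eq (x i) (y j) r)

/-- `p ⊩ z ∈ y`. -/
def mem (z : PName P) : PName P → Form P
  | .mk κ y d => fun p => ∀ q ≤ p, ∃ r ≤ q, ∃ j : κ, r ≤ d j ∧ eq z (y j) r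

def neg (φ : Form P) : Form P := fun p => ∀ q ≤ p, ¬ φ q

def and (φ ψ : Form P) : Form P := fun p => φ p ∧ ψ p

def or (φ ψ : Form P) : Form P := fun p => ∀ q ≤ p, ∃ r ≤ q, φ r ∨ ψ r

def imp (φ ψ : Form P) : Form P := fun p => ∀ q ≤ p, φ q → ψ q

def all (φ : PName P → Form P) : Form P := fun p => ∀ x, φ x p

def ex (φ : PName P → Form P) : Form P := fun p => ∀ q ≤ p, ∃ r ≤ q, ∃ x, φ x r

infix:50 " ≐ " => eq
infix:50 " ∈ᶠ " => mem
infixr:35 " ∧ᶠ " => and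
infixr:30 " ∨ᶠ " => or
infixr:25 " →ᶠ " => imp

def iff (φ ψ : Form P) : Form P := (φ →ᶠ ψ) ∧ᶠ (ψ →ᶠ φ)

infix:20 " ↔ᶠ " => iff

/-! ### Formulas of set theory -/

/-- `x ⊆ y` -/
def sub (x y : PName P) : Form P := all fun z => z ∈ᶠ x →ᶠ z ∈ᶠ y

infix:50 " ⊆ᶠ " => sub

/-- `w = {x, y}` -/
def isUnorderedPair (w x y : PName P) : Form P :=
  all fun v => v ∈ᶠ w ↔ᶠ v ≐ x ∨ᶠ v ≐ y

/-- `z = ⟨x, y⟩ = {{x}, {x, y}}` -/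
def isPair (z x y : PName P) : Form P :=
  all fun w => w ∈ᶠ z ↔ᶠ isUnorderedPair w x x ∨ᶠ isUnorderedPair w x y

/-- `⟨x, y⟩ ∈ f` -/
def pairMem (x y f : PName P) : Form P := ex fun z => isPair z x y ∧ᶠ z ∈ᶠ f

/-- `f` is a function from `X` to `Y`. -/
def isFunction (f X Y : PName P) : Form P :=
  (all fun z => z ∈ᶠ f →ᶠ ex fun x => ex fun y => x ∈ᶠ X ∧ᶠ y ∈ᶠ Y ∧ᶠ isPair z x y) ∧ᶠ
  (all fun x => x ∈ᶠ X →ᶠ ex fun y => pairMem x y f) ∧ᶠ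
  (all fun x => all fun y => all fun y' => pairMem x y f →ᶠ pairMem x y' f →ᶠ y ≐ y')

/-- The function `f` is injective. -/
def isInjective (f : PName P) : Form P :=
  all fun x => all fun x' => all fun y => pairMem x y f →ᶠ pairMem x' y f →ᶠ x ≐ x'

/-- `I` contains the empty set and is closed under `x ↦ x ∪ {x}`. -/
def isInductive (I : PName P) : Form P :=
  (ex fun e => e ∈ᶠ I ∧ᶠ all fun y => neg (y ∈ᶠ e)) ∧ᶠ
  (all fun x => x ∈ᶠ I →ᶠ ex fun y => y ∈ᶠ I ∧ᶠ all fun z => z ∈ᶠ y ↔ᶠ z ∈ᶠ x ∨ᶠ z ≐ x)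

/-- `n` is a natural number: it belongs to every inductive set. -/
def isNat (n : PName P) : Form P := all fun I => isInductive I →ᶠ n ∈ᶠ I

/-- `w = ω` -/
def isOmega (w : PName P) : Form P := all fun n => n ∈ᶠ w ↔ᶠ isNat n

/-- `X` is countable (possibly finite). -/
def isCountable (X : PName P) : Form P :=
  ex fun w => ex fun f => isOmega w ∧ᶠ isFunction f X w ∧ᶠ isInjective f

/-- `X` is finite. -/
def isFinite (X : PName P) : Form P :=
  ex fun n => ex fun f => isNat n ∧ᶠ isFunction f X n ∧ᶠ isInjective f

/-- `x` is transitive. -/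
def isTransitive (x : PName P) : Form P := all fun y => y ∈ᶠ x →ᶠ y ⊆ᶠ x

/-- `a` is a countable ordinal, that is, a countable transitive set of transitive sets. -/
def isCountableOrdinal (a : PName P) : Form P :=
  isTransitive a ∧ᶠ (all fun x => x ∈ᶠ a →ᶠ isTransitive x) ∧ᶠ isCountable a

/-- `s` is a function from the countable ordinal `a` to `ω`. -/
def isSequence (s a : PName P) : Form P :=
  isCountableOrdinal a ∧ᶠ ex fun w => isOmega w ∧ᶠ isFunction s a w

/-! ### Free Souslin trees

A tree is a set of functions from countable ordinals to `ω`, ordered by reverse inclusion; the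
level of a node is its domain. -/

/-- `s` is a node of `S` at level `a`. -/
def isNode (S s a : PName P) : Form P := s ∈ᶠ S ∧ᶠ isSequence s a

/-- `S` is an (infinitely branching) `ω₁`-tree. -/
def isOmegaOneTree (S : PName P) : Form P :=
  -- `S` is a nonempty set of functions from countable ordinals to `ω`
  (ex fun s => s ∈ᶠ S) ∧ᶠ
  (all fun s => s ∈ᶠ S →ᶠ ex fun a => isSequence s a) ∧ᶠ
  -- `S` is closed under restriction to smaller ordinals
  (all fun s => all fun r => all fun b =>
    s ∈ᶠ S →ᶠ isSequence r b →ᶠ r ⊆ᶠ s →ᶠ r ∈ᶠ S) ∧ᶠ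
  -- levels are countable
  (all fun a => isCountableOrdinal a →ᶠ
    ex fun L => (all fun s => s ∈ᶠ L ↔ᶠ isNode S s a) ∧ᶠ isCountable L) ∧ᶠ
  -- every node has extensions at all higher levels below `ω₁`
  (all fun s => all fun a => all fun b =>
    isNode S s a →ᶠ isCountableOrdinal b →ᶠ a ⊆ᶠ b →ᶠ
      ex fun t => isNode S t b ∧ᶠ s ⊆ᶠ t) ∧ᶠ
  -- every node `s` has an immediate successor `s ⌢ m` for infinitely many `m`
  (all fun s => all fun a => all fun n =>
    isNode S s a →ᶠ isNat n →ᶠ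
      ex fun m => ex fun t =>
        isNat m ∧ᶠ n ∈ᶠ m ∧ᶠ t ∈ᶠ S ∧ᶠ s ⊆ᶠ t ∧ᶠ pairMem a m t)

/-- `S` is a Souslin tree: an `ω₁`-tree without uncountable chains and antichains. -/
def isSouslin (S : PName P) : Form P :=
  isOmegaOneTree S ∧ᶠ
  (all fun A => A ⊆ᶠ S →ᶠ
    (all fun s => all fun t => s ∈ᶠ A →ᶠ t ∈ᶠ A →ᶠ s ⊆ᶠ t ∨ᶠ t ⊆ᶠ s) →ᶠ isCountable A) ∧ᶠ
  (all fun A => A ⊆ᶠ S →ᶠ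
    (all fun s => all fun t => s ∈ᶠ A →ᶠ t ∈ᶠ A →ᶠ s ⊆ᶠ t →ᶠ s ≐ t) →ᶠ isCountable A)

/-- `g` belongs to the product of the trees `S ↾ s = {t ∈ S : s ⊆ t}` over all `s ∈ F`. -/
def inProduct (S F g : PName P) : Form P :=
  isFunction g F S ∧ᶠ all fun s => all fun t => pairMem s t g →ᶠ s ⊆ᶠ t

/-- `k` is below `g` in the coordinatewise ordering of the product. -/
def productLE (k g : PName P) : Form P :=
  all fun s => all fun t => all fun t' => pairMem s t g →ᶠ pairMem s t' k →ᶠ t ⊆ᶠ t'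

/-- The product of the trees `S ↾ s` over all `s ∈ F` is c.c.c. -/
def productCCC (S F : PName P) : Form P :=
  all fun A => (all fun g => g ∈ᶠ A →ᶠ inProduct S F g) →ᶠ
    (all fun g => all fun h => g ∈ᶠ A →ᶠ h ∈ᶠ A →ᶠ
      (ex fun k => inProduct S F k ∧ᶠ productLE k g ∧ᶠ productLE k h) →ᶠ g ≐ h) →ᶠ
    isCountable A

/-- `S` is a free Souslin tree. -/
def isFree (S : PName P) : Form P :=
  isSouslin S ∧ᶠ
  all fun F => F ⊆ᶠ S →ᶠ isFinite F →ᶠ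
    (ex fun a => all fun s => s ∈ᶠ F →ᶠ isNode S s a) →ᶠ productCCC S F

/-- `S` is special: some `f : S → ω` takes distinct values at distinct comparable nodes, so that
`S` is a union of countably many antichains. -/
def isSpecial (S : PName P) : Form P :=
  ex fun w => ex fun f => isOmega w ∧ᶠ isFunction f S w ∧ᶠ
    all fun s => all fun t => all fun n =>
      pairMem s n f →ᶠ pairMem t n f →ᶠ s ⊆ᶠ t →ᶠ s ≐ t

end

/-! ### Forcing with a ground model poset after forcing with `P` -/

/-- A `P`-name regarded as a `P × Q`-name for the same set: a condition `p` is replaced by the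
set of all `(p, q)`, `q ∈ Q`. -/
def lift {P : Type u} (Q : Type u) : PName P → PName (P × Q)
  | .mk ι x c => .mk (ι × Q) (fun i => lift Q (x i.1)) (fun i => (c i.1, i.2))

/-- The statement, over the extension by `P`, that every condition of the ground model poset `Q`
forces `φ`. The extension by `P` followed by `Q` is the extension by the product `P × Q`, so here
`φ` is a formula of the forcing language of `P × Q`, and `p` forces "`q ⊩ φ`" when
`(p, q) ⊩ φ`. -/
def afterForcing {P Q : Type u} (φ : Form (P × Q)) : Form P := fun p => ∀ q : Q, φ (p, q)

end Forcing

/-! The Cohen reals are read as one generic function `c : W × ℕ × ℕ → ℕ`, where `W` has order type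
`ω₁`. From any such `c` a tree on `W × ℕ` is computed by recursion on levels, together with rational
values `value t x` for a tree node `x` and a node `t` of `T` whose level is at least that of `x`;
the value depends only on the restriction of `t` to the level of `x`. For fixed `t` the values
strictly increase along chains of the new tree. A generic branch of `T` therefore gives a strictly
increasing map from the new tree to `ℚ`, and composing with an injection of `ℚ` into `ℕ` specializes
it (`isSpecial_treeName`).

A node of level `α` is built in `ω` steps. After finitely many steps its state consists of one node
above it and finitely many promises `(t, q)`, with `t` of level `α` and `q` the final value at `t`;
a state is valid if the value at the node reached so far is below each promised one. At step `k` the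
number `c (α, n, k)` may request a larger valid state, and bookkeeping then makes sure that every
lower level is reached and every `t` of level `α` receives a value. This never gets stuck because
any node can be extended to any higher level while finitely many values stay below prescribed bounds
(`levelProps_aux`). Every stage depends on finitely many coordinates of `c`
(`eventually_state_aux`), so that Cohen conditions decide all relevant facts.

Countability of chains and antichains, freeness, and the chain condition of Cohen forcing all follow
from `exists_common_extension`: among uncountably many conditions with finite tuples of nodes below
a fixed injective tuple on one level, two are compatible and some common extension forces the two
tuples to have a common lower bound in every coordinate. To see this, each condition is enlarged to
a finite closed system of nodes and steps which depends on no coordinates from outside. The systems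
are thinned out until their levels split into a part below a fixed `δ` and a part tending to
infinity, and until their data below `δ` coincide. As `T` is Aronszajn, two systems can be chosen so
that no node of `T` promised in the later one is below a node promised in the earlier one
(`LevelTree.exists_incomparable`). New promises then keep the values in the earlier system, at the
nodes of `T` that matter to the later one, within a small `ε` of the values at the common roots
(`exists_small_values`), so the nodes of the later system may be requested to lie below those of the
earlier one (`exists_amalgamation`).

In the extension a node becomes the sequence of the indices of its predecessors at successor levels.
Distinct nodes of a limit level have distinct sequences by genericity (`exists_separation`), and by
the chain condition every countable ordinal of the extension is densely equal to a canonical name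
`ord α` (`CCC.dense_eq_ord`). -/

namespace Forcing

section
variable {P : Type u} [Preorder P]

/-! ### Monotonicity, density, equality -/

/-- `φ` is forced by every extension of a condition forcing it. -/
def Mono (φ : Form P) : Prop := ∀ ⦃p q⦄, q ≤ p → φ p → φ q

/-- The conditions forcing `φ` are dense below `p`. -/
def Dense (φ : Form P) (p : P) : Prop := ∀ q ≤ p, ∃ r ≤ q, φ r

/-- A monotone formula that is forced as soon as it is densely forced. -/
structure Regular (φ : Form P) : Prop where
  mono : Mono φ
  of_dense : ∀ ⦃p⦄, Dense φ p → φ p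

theorem Mono.dense {φ : Form P} (h : Mono φ) {p : P} (hp : φ p) : Dense φ p :=
  fun q hq => ⟨q, le_rfl, h hq hp⟩

theorem Dense.mono {φ : Form P} : Mono (Dense φ) := fun _ _ h hp r hr => hp r (hr.trans h)

theorem Dense.bind {φ ψ : Form P} {p : P} (h : Dense φ p)
    (hψ : ∀ q ≤ p, φ q → Dense ψ q) : Dense ψ p := fun q hq => by
  obtain ⟨r, hr, h1⟩ := h q hq
  obtain ⟨s, hs, h2⟩ := hψ r (hr.trans hq) h1 r le_rfl
  exact ⟨s, hs.trans hr, h2⟩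

/-- This is how witnesses are unpacked throughout: memberships, disjunctions and existential
formulas supply witnesses only densely, and a regular goal may be proved at each of those
extensions. -/
theorem Regular.bind {φ ψ : Form P} {p : P} (hreg : Regular ψ) (h : Dense φ p)
    (hψ : ∀ q ≤ p, φ q → ψ q) : ψ p :=
  hreg.of_dense (h.bind fun q hq hφ => hreg.mono.dense (hψ q hq hφ))

theorem mono_eq : ∀ x y : PName P, Mono (eq x y)
  | .mk _ _ _, .mk _ _ _ => fun _ _ h hp =>
    ⟨fun i r hr => hp.1 i r (hr.trans h), fun i r hr => hp.2 i r (hr.trans h)⟩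

theorem regular_eq : ∀ x y : PName P, Regular (eq x y)
  | .mk _ x c, .mk _ y d => ⟨mono_eq _ _, fun p hp => by
    constructor
    · intro i q hq hc
      obtain ⟨r, hr, h⟩ := hp q hq
      obtain ⟨s, hs, h'⟩ := h.1 i r le_rfl (hr.trans hc)
      exact ⟨s, hs.trans hr, h'⟩
    · intro i q hq hc
      obtain ⟨r, hr, h⟩ := hp q hq
      obtain ⟨s, hs, h'⟩ := h.2 i r le_rfl (hr.trans hc)
      exact ⟨s, hs.trans hr, h'⟩⟩

theorem regular_mem (z : PName P) : ∀ y : PName P, Regular (mem z y)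
  | .mk _ _ _ => ⟨fun _ _ h hp => Dense.mono h hp, fun _ hp q hq => by
    obtain ⟨r, hr, h⟩ := hp q hq
    obtain ⟨s, hs, h'⟩ := h r le_rfl
    exact ⟨s, hs.trans hr, h'⟩⟩

theorem mono_ex (φ : PName P → Form P) : Mono (ex φ) := fun _ _ h hp => Dense.mono h hp

theorem regular_ex (φ : PName P → Form P) : Regular (ex φ) :=
  ⟨mono_ex φ, fun _ hp => Dense.bind hp fun _ _ h => h⟩

theorem regular_or (φ ψ : Form P) : Regular (or φ ψ) :=
  ⟨fun _ _ h hp => Dense.mono h hp, fun _ hp =>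
    Dense.bind (ψ := fun r => φ r ∨ ψ r) hp fun _ _ h => h⟩

theorem mono_imp (φ ψ : Form P) : Mono (imp φ ψ) := fun _ _ h hp r hr => hp r (hr.trans h)

theorem Regular.imp (φ : Form P) {ψ : Form P} (hφ : Mono φ) (h : Regular ψ) :
    Regular (imp φ ψ) :=
  ⟨mono_imp _ _, fun _ hp q hq hφq => h.of_dense fun r hr => by
    obtain ⟨s, hs, h'⟩ := hp r (hr.trans hq)
    exact ⟨s, hs, h' s le_rfl (hφ (hs.trans hr) hφq)⟩⟩

theorem Regular.and {φ ψ : Form P} (hφ : Regular φ) (hψ : Regular ψ) : Regular (and φ ψ) :=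
  ⟨fun _ _ h hp => ⟨hφ.mono h hp.1, hψ.mono h hp.2⟩, fun _ hp =>
    ⟨hφ.bind hp fun _ _ h => h.1, hψ.bind hp fun _ _ h => h.2⟩⟩

theorem Mono.and {φ ψ : Form P} (hφ : Mono φ) (hψ : Mono ψ) : Mono (and φ ψ) :=
  fun _ _ h hp => ⟨hφ h hp.1, hψ h hp.2⟩

theorem Regular.all {φ : PName P → Form P} (h : ∀ x, Regular (φ x)) : Regular (all φ) :=
  ⟨fun _ _ h' hp x => (h x).mono h' (hp x), fun _ hp x => (h x).bind hp fun _ _ h => h x⟩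

theorem Mono.all {φ : PName P → Form P} (h : ∀ x, Mono (φ x)) : Mono (all φ) :=
  fun _ _ h' hp x => h x h' (hp x)

theorem Regular.iff {φ ψ : Form P} (hφ : Regular φ) (hψ : Regular ψ) : Regular (iff φ ψ) :=
  (hψ.imp _ hφ.mono).and (hφ.imp _ hψ.mono)

theorem regular_neg {φ : Form P} (hφ : Mono φ) : Regular (neg φ) :=
  ⟨fun _ _ h hp r hr => hp r (hr.trans h), fun _ hp q hq hn => by
    obtain ⟨r, hr, h'⟩ := hp q hq
    exact h' r le_rfl (hφ hr hn)⟩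

/-- Either `φ` or its negation is forced by some extension. -/
theorem exists_decide (φ : Form P) (p : P) : ∃ q ≤ p, φ q ∨ neg φ q := by
  by_cases h : ∃ q ≤ p, φ q
  · obtain ⟨q, hq, h⟩ := h
    exact ⟨q, hq, .inl h⟩
  · push Not at h
    exact ⟨p, le_rfl, .inr h⟩

theorem Regular.by_contra {φ : Form P} (hφ : Regular φ) {p : P} (h : ∀ q ≤ p, ¬ neg φ q) :
    φ p := hφ.of_dense fun q hq => by
  obtain ⟨r, hr, h' | h'⟩ := exists_decide φ q
  · exact ⟨r, hr, h'⟩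
  · exact absurd h' (h r (hr.trans hq))

theorem eq_refl (x : PName P) (p : P) : eq x x p := by
  induction x generalizing p with
  | mk ι x c ih =>
    exact ⟨fun i q _ hc => ⟨q, le_rfl, i, hc, ih i q⟩, fun i q _ hc => ⟨q, le_rfl, i, hc, ih i q⟩⟩

theorem eq_symm {x y : PName P} {p : P} (h : eq x y p) : eq y x p := by
  induction x generalizing y p with
  | mk ι x c ih =>
    cases y with
    | mk κ y d =>
      constructor
      · intro j q hq hd
        obtain ⟨r, hr, i, hi, h'⟩ := h.2 j q hq hd
        exact ⟨r, hr, i, hi, ih i h'⟩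
      · intro i q hq hc
        obtain ⟨r, hr, j, hj, h'⟩ := h.1 i q hq hc
        exact ⟨r, hr, j, hj, ih i h'⟩

theorem eq_trans {x y z : PName P} {p : P} (h : eq x y p) (h' : eq y z p) : eq x z p := by
  induction x generalizing y z p with
  | mk ι x c ih =>
    cases y with
    | mk κ y d =>
      cases z with
      | mk μ z e =>
        constructor
        · intro i q hq hc
          obtain ⟨r, hr, j, hj, h1⟩ := h.1 i q hq hc
          obtain ⟨s, hs, k, hk, h2⟩ := h'.1 j r (hr.trans hq) hj
          exact ⟨s, hs.trans hr, k, hk, ih i (mono_eq _ _ hs h1) h2⟩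
        · intro k q hq hc
          obtain ⟨r, hr, j, hj, h1⟩ := h'.2 k q hq hc
          obtain ⟨s, hs, i, hi, h2⟩ := h.2 j r (hr.trans hq) hj
          exact ⟨s, hs.trans hr, i, hi, ih i h2 (mono_eq _ _ hs h1)⟩

theorem mem_congr_left {z z' y : PName P} {p : P} (h : eq z z' p) (hm : mem z y p) :
    mem z' y p := by
  cases y with
  | mk κ y d =>
    intro q hq
    obtain ⟨r, hr, j, hj, h'⟩ := hm q hq
    exact ⟨r, hr, j, hj, eq_trans (eq_symm (mono_eq _ _ (hr.trans hq) h)) h'⟩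

theorem mem_congr_right {z y y' : PName P} {p : P} (h : eq y y' p) (hm : mem z y p) :
    mem z y' p := by
  cases y with
  | mk κ y d =>
    cases y' with
    | mk μ y' e =>
      intro q hq
      obtain ⟨r, hr, j, hj, h'⟩ := hm q hq
      obtain ⟨s, hs, k, hk, h2⟩ := h.1 j r (hr.trans hq) hj
      exact ⟨s, hs.trans hr, k, hk, eq_trans (mono_eq _ _ hs h') h2⟩

theorem eq_of_sub {x y : PName P} {p : P} (h : sub x y p) (h' : sub y x p) : eq x y p := by
  cases x with
  | mk ι x c =>
    cases y with
    | mk κ y d =>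
      constructor
      · intro i q hq hc
        exact h (x i) q hq (fun r hr => ⟨r, le_rfl, i, hr.trans hc, eq_refl _ _⟩) q le_rfl
      · intro j q hq hc
        obtain ⟨r, hr, i, hi, h1⟩ :=
          h' (y j) q hq (fun r hr => ⟨r, le_rfl, j, hr.trans hc, eq_refl _ _⟩) q le_rfl
        exact ⟨r, hr, i, hi, eq_symm h1⟩

theorem sub_of_eq {x y : PName P} {p : P} (h : eq x y p) : sub x y p :=
  fun _ _ hq hz => mem_congr_right (mono_eq _ _ hq h) hz

theorem regular_sub (x y : PName P) : Regular (sub x y) :=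
  .all fun _ => .imp _ (regular_mem _ _).mono (regular_mem _ _)

theorem sub_trans {x y z : PName P} {p : P} (h : sub x y p) (h' : sub y z p) : sub x z p :=
  fun w q hq hw => h' w q hq (h w q hq hw)

/-! ### Congruence -/

/-- `φ` and `ψ` are forced by the same conditions below `p`. -/
def Cong (p : P) (φ ψ : Form P) : Prop := ∀ q ≤ p, φ q ↔ ψ q

namespace Cong
variable {p : P} {φ φ' ψ ψ' : Form P} {x x' y y' : PName P}

theorem refl : Cong p φ φ := fun _ _ => Iff.rfl

theorem mp (h : Cong p φ ψ) (hp : φ p) : ψ p := (h p le_rfl).1 hp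

theorem and (h : Cong p φ φ') (h' : Cong p ψ ψ') : Cong p (and φ ψ) (and φ' ψ') :=
  fun q hq => and_congr (h q hq) (h' q hq)

theorem or (h : Cong p φ φ') (h' : Cong p ψ ψ') : Cong p (or φ ψ) (or φ' ψ') :=
  fun _ hq => forall_congr' fun _ => forall_congr' fun h1 => exists_congr fun r =>
    and_congr_right fun hr => or_congr (h r (hr.trans (h1.trans hq))) (h' r (hr.trans (h1.trans hq)))

theorem imp (h : Cong p φ φ') (h' : Cong p ψ ψ') : Cong p (imp φ ψ) (imp φ' ψ') :=
  fun _ hq => forall_congr' fun r => forall_congr' fun h1 =>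
    imp_congr (h r (h1.trans hq)) (h' r (h1.trans hq))

theorem iff (h : Cong p φ φ') (h' : Cong p ψ ψ') : Cong p (iff φ ψ) (iff φ' ψ') :=
  and (imp h h') (imp h' h)

theorem all {φ φ' : PName P → Form P} (h : ∀ z, Cong p (φ z) (φ' z)) : Cong p (all φ) (all φ') :=
  fun q hq => forall_congr' fun z => h z q hq

theorem ex {φ φ' : PName P → Form P} (h : ∀ z, Cong p (φ z) (φ' z)) : Cong p (ex φ) (ex φ') :=
  fun _ hq => forall_congr' fun _ => forall_congr' fun h1 => exists_congr fun r =>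
    and_congr_right fun hr => exists_congr fun z => h z r (hr.trans (h1.trans hq))

theorem mem (hx : eq x x' p) (hy : eq y y' p) : Cong p (mem x y) (mem x' y') := fun _ hq =>
  ⟨fun h => mem_congr_left (mono_eq _ _ hq hx) (mem_congr_right (mono_eq _ _ hq hy) h),
   fun h => mem_congr_left (eq_symm (mono_eq _ _ hq hx))
    (mem_congr_right (eq_symm (mono_eq _ _ hq hy)) h)⟩

theorem eq (hx : eq x x' p) (hy : Forcing.eq y y' p) : Cong p (eq x y) (Forcing.eq x' y') :=
  fun _ hq =>
  ⟨fun h => eq_trans (eq_symm (mono_eq _ _ hq hx)) (eq_trans h (mono_eq _ _ hq hy)),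
   fun h => eq_trans (mono_eq _ _ hq hx) (eq_trans h (eq_symm (mono_eq _ _ hq hy)))⟩

theorem sub (hx : Forcing.eq x x' p) (hy : Forcing.eq y y' p) :
    Cong p (sub x y) (Forcing.sub x' y') :=
  .all fun _ => .imp (.mem (eq_refl _ _) hx) (.mem (eq_refl _ _) hy)

theorem isUnorderedPair {w w' : PName P} (hw : Forcing.eq w w' p) (hx : Forcing.eq x x' p)
    (hy : Forcing.eq y y' p) : Cong p (isUnorderedPair w x y) (Forcing.isUnorderedPair w' x' y') :=
  .all fun _ => .iff (.mem (eq_refl _ _) hw) (.or (.eq (eq_refl _ _) hx) (.eq (eq_refl _ _) hy))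

theorem isPair {w w' : PName P} (hw : Forcing.eq w w' p) (hx : Forcing.eq x x' p)
    (hy : Forcing.eq y y' p) : Cong p (isPair w x y) (Forcing.isPair w' x' y') :=
  .all fun _ => .iff (.mem (eq_refl _ _) hw)
    (.or (.isUnorderedPair (eq_refl _ _) hx hx) (.isUnorderedPair (eq_refl _ _) hx hy))

theorem pairMem {w w' : PName P} (hx : Forcing.eq x x' p) (hy : Forcing.eq y y' p)
    (hw : Forcing.eq w w' p) : Cong p (pairMem x y w) (Forcing.pairMem x' y' w') :=
  .ex fun _ => .and (.isPair (eq_refl _ _) hx hy) (.mem (eq_refl _ _) hw)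

theorem isFunction {f f' : PName P} (hf : Forcing.eq f f' p) (hx : Forcing.eq x x' p)
    (hy : Forcing.eq y y' p) : Cong p (isFunction f x y) (Forcing.isFunction f' x' y') :=
  .and (.all fun _ => .imp (.mem (eq_refl _ _) hf) (.ex fun _ => .ex fun _ =>
    .and (.mem (eq_refl _ _) hx) (.and (.mem (eq_refl _ _) hy) .refl)))
  (.and (.all fun _ => .imp (.mem (eq_refl _ _) hx)
    (.ex fun _ => .pairMem (eq_refl _ _) (eq_refl _ _) hf))
  (.all fun _ => .all fun _ => .all fun _ => .imp (.pairMem (eq_refl _ _) (eq_refl _ _) hf)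
    (.imp (.pairMem (eq_refl _ _) (eq_refl _ _) hf) .refl)))

theorem isCountable (hx : Forcing.eq x x' p) : Cong p (isCountable x) (Forcing.isCountable x') :=
  .ex fun _ => .ex fun _ => .and .refl (.and (.isFunction (eq_refl _ _) hx (eq_refl _ _)) .refl)

theorem isTransitive (hx : Forcing.eq x x' p) :
    Cong p (isTransitive x) (Forcing.isTransitive x') :=
  .all fun _ => .imp (.mem (eq_refl _ _) hx) (.sub (eq_refl _ _) hx)

theorem isCountableOrdinal (hx : Forcing.eq x x' p) :
    Cong p (isCountableOrdinal x) (Forcing.isCountableOrdinal x') :=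
  .and (.isTransitive hx) (.and (.all fun _ => .imp (.mem (eq_refl _ _) hx) .refl)
    (.isCountable hx))

theorem isSequence (hx : Forcing.eq x x' p) (hy : Forcing.eq y y' p) :
    Cong p (isSequence x y) (Forcing.isSequence x' y') :=
  .and (.isCountableOrdinal hy) (.ex fun _ => .and .refl (.isFunction hx hy (eq_refl _ _)))

theorem isNode {S : PName P} (hx : Forcing.eq x x' p) (hy : Forcing.eq y y' p) :
    Cong p (isNode S x y) (Forcing.isNode S x' y') :=
  .and (.mem hx (eq_refl _ _)) (.isSequence hx hy)

theorem isNat (hx : Forcing.eq x x' p) : Cong p (isNat x) (Forcing.isNat x') :=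
  .all fun _ => .imp .refl (.mem hx (eq_refl _ _))

end Cong

/-! ### Names given by indexed families -/

/-- The name for the set of all `x i` such that `φ i` holds. -/
def ofForm {ι : Type u} (x : ι → PName P) (φ : ι → Form P) : PName P :=
  .mk {i : ι × P // φ i.1 i.2} (fun i => x i.1.1) (fun i => i.1.2)

section
variable {ι : Type u} {x : ι → PName P} {φ : ι → Form P}

theorem mem_ofForm (hφ : ∀ i, Mono (φ i)) {z : PName P} {p : P} :
    mem z (ofForm x φ) p ↔ Dense (fun r => ∃ i, φ i r ∧ eq z (x i) r) p := by
  constructor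
  · intro h q hq
    obtain ⟨r, hr, ⟨⟨i, s⟩, hi⟩, hj, h'⟩ := h q hq
    exact ⟨r, hr, i, hφ i hj hi, h'⟩
  · intro h q hq
    obtain ⟨r, hr, i, hj, h'⟩ := h q hq
    exact ⟨r, hr, ⟨(i, r), hj⟩, le_rfl, h'⟩

theorem mem_ofForm_self (hφ : ∀ i, Mono (φ i)) {i : ι} {p : P} (h : φ i p) :
    mem (x i) (ofForm x φ) p :=
  (mem_ofForm hφ).2 fun q hq => ⟨q, le_rfl, i, hφ i hq h, eq_refl _ _⟩

end

theorem eq_iff_forall_mem {x y : PName P} {p : P} :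
    eq x y p ↔ ∀ z, ∀ q ≤ p, mem z x q ↔ mem z y q :=
  ⟨fun h z _ hq => ⟨sub_of_eq h z _ hq, sub_of_eq (eq_symm h) z _ hq⟩, fun h =>
    eq_of_sub (fun z q hq => (h z q hq).1) (fun z q hq => (h z q hq).2)⟩

theorem forall_mem_ofForm {ι : Type u} {x : ι → PName P} {φ : ι → Form P} (hφ : ∀ i, Mono (φ i))
    {z : PName P} {p : P} (h : mem z (ofForm x φ) p) {ψ : Form P} (hψ : Regular ψ)
    (H : ∀ q ≤ p, ∀ i, φ i q → eq z (x i) q → ψ q) : ψ p :=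
  hψ.bind ((mem_ofForm hφ).1 h) fun q hq ⟨i, h1, h2⟩ => H q hq i h1 h2

/-- The name for the set of all `x i`. -/
def setOf {ι : Type u} (x : ι → PName P) : PName P := ofForm x fun _ _ => True

theorem mem_setOf {ι : Type u} {x : ι → PName P} {z : PName P} {p : P} :
    mem z (setOf x) p ↔ Dense (fun r => ∃ i, eq z (x i) r) p :=
  (mem_ofForm fun _ _ _ _ h => h).trans <| by simp [Dense]

theorem mem_setOf_self {ι : Type u} {x : ι → PName P} (i : ι) (p : P) : mem (x i) (setOf x) p :=
  mem_ofForm_self (fun _ _ _ _ h => h) trivial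

/-! ### Pairs -/

/-- The unordered pair `{x, y}`. -/
def upair (x y : PName P) : PName P := setOf fun b : ULift.{u} Bool => cond b.down x y

theorem mem_upair {x y z : PName P} {p : P} : mem z (upair x y) p ↔ or (eq z x) (eq z y) p := by
  rw [upair, mem_setOf]
  constructor
  · intro h q hq
    obtain ⟨r, hr, ⟨b⟩, h'⟩ := h q hq
    cases b
    · exact ⟨r, hr, .inr h'⟩
    · exact ⟨r, hr, .inl h'⟩
  · intro h q hq
    obtain ⟨r, hr, h' | h'⟩ := h q hq
    · exact ⟨r, hr, ⟨true⟩, h'⟩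
    · exact ⟨r, hr, ⟨false⟩, h'⟩

theorem mem_upair_left (x y : PName P) (p : P) : mem x (upair x y) p :=
  mem_upair.2 fun q _ => ⟨q, le_rfl, .inl (eq_refl _ _)⟩

theorem mem_upair_right (x y : PName P) (p : P) : mem y (upair x y) p :=
  mem_upair.2 fun q _ => ⟨q, le_rfl, .inr (eq_refl _ _)⟩

theorem isUnorderedPair_iff {w x y : PName P} {p : P} :
    isUnorderedPair w x y p ↔ eq w (upair x y) p := by
  rw [eq_iff_forall_mem]
  constructor
  · intro h z q hq
    rw [mem_upair]
    exact ⟨fun h' => (h z).1 q hq h', fun h' => (h z).2 q hq h'⟩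
  · intro h z
    exact ⟨fun q hq h' => mem_upair.1 ((h z q hq).1 h'),
      fun q hq h' => (h z q hq).2 (mem_upair.2 h')⟩

theorem upair_congr {x y x' y' : PName P} {p : P} (h : eq x x' p) (h' : eq y y' p) :
    eq (upair x y) (upair x' y') p :=
  isUnorderedPair_iff.1 ((Cong.isUnorderedPair (eq_refl _ _) h h').mp
    (isUnorderedPair_iff.2 (eq_refl _ _)))

/-- The ordered pair `⟨x, y⟩`. -/
def pair (x y : PName P) : PName P := upair (upair x x) (upair x y)

theorem pair_congr {x y x' y' : PName P} {p : P} (h : eq x x' p) (h' : eq y y' p) :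
    eq (pair x y) (pair x' y') p := upair_congr (upair_congr h h) (upair_congr h h')

theorem isPair_iff {z x y : PName P} {p : P} : isPair z x y p ↔ eq z (pair x y) p := by
  rw [pair, ← isUnorderedPair_iff]
  refine forall_congr' fun w => ?_
  have : Cong p (isUnorderedPair w x x ∨ᶠ isUnorderedPair w x y)
      (w ≐ upair x x ∨ᶠ w ≐ upair x y) :=
    .or (fun _ _ => isUnorderedPair_iff) (fun _ _ => isUnorderedPair_iff)
  exact Cong.iff .refl this p le_rfl

theorem pairMem_iff {x y f : PName P} {p : P} : pairMem x y f p ↔ mem (pair x y) f p := by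
  constructor
  · intro h
    refine (regular_mem _ _).bind h ?_
    rintro q - ⟨z, h1, h2⟩
    exact mem_congr_left (isPair_iff.1 h1) h2
  · intro h q hq
    exact ⟨q, le_rfl, _, isPair_iff.2 (eq_refl _ _), (regular_mem _ _).mono hq h⟩

theorem eq_of_upair_self_eq {x y y' : PName P} {p : P} (h : eq (upair x x) (upair y y') p) :
    eq x y p ∧ eq x y' p := by
  constructor
  · refine (regular_eq _ _).bind (mem_upair.1 (sub_of_eq (eq_symm h) y p le_rfl
      (mem_upair_left _ _ _))) ?_
    rintro q - (h | h) <;> exact eq_symm h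
  · refine (regular_eq _ _).bind (mem_upair.1 (sub_of_eq (eq_symm h) y' p le_rfl
      (mem_upair_right _ _ _))) ?_
    rintro q - (h | h) <;> exact eq_symm h

theorem eq_of_upair_eq_left {x y y' : PName P} {p : P} (h : eq (upair x y) (upair x y') p) :
    eq y y' p := by
  refine (regular_eq _ _).bind (mem_upair.1 (sub_of_eq h y p le_rfl (mem_upair_right _ _ _))) ?_
  rintro q hq (h1 | h1)
  · have h2 := sub_of_eq (eq_symm h) y' q hq (mem_upair_right _ _ _)
    refine (regular_eq _ _).bind (mem_upair.1 h2) ?_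
    rintro r hr (h3 | h3)
    · exact eq_trans (mono_eq _ _ hr h1) (eq_symm h3)
    · exact eq_symm h3
  · exact h1

theorem pair_inj {x y x' y' : PName P} {p : P} (h : eq (pair x y) (pair x' y') p) :
    eq x x' p ∧ eq y y' p := by
  have h1 : eq x x' p := by
    refine (regular_eq _ _).bind (mem_upair.1 (sub_of_eq h _ p le_rfl (mem_upair_left _ _ _))) ?_
    rintro q - (h1 | h1) <;> exact (eq_of_upair_self_eq h1).1
  refine ⟨h1, ?_⟩
  have h2 : eq (upair (upair x x) (upair x y)) (upair (upair x x) (upair x y')) p :=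
    eq_trans h (pair_congr (eq_symm h1) (eq_refl _ _))
  exact eq_of_upair_eq_left (eq_of_upair_eq_left h2)

/-! ### Functions -/

theorem regular_pairMem (x y f : PName P) : Regular (pairMem x y f) := regular_ex _

theorem regular_isFunction (f x y : PName P) : Regular (isFunction f x y) :=
  .and (.all fun _ => .imp _ (regular_mem _ _).mono (regular_ex _))
    (.and (.all fun _ => .imp _ (regular_mem _ _).mono (regular_ex _))
      (.all fun _ => .all fun _ => .all fun _ => .imp _ (regular_ex _).mono
        (.imp _ (regular_ex _).mono (regular_eq _ _))))

theorem regular_isInjective (f : PName P) : Regular (isInjective f) :=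
  .all fun _ => .all fun _ => .all fun _ => .imp _ (regular_ex _).mono
        (.imp _ (regular_ex _).mono (regular_eq _ _))

theorem regular_isNat (n : PName P) : Regular (isNat n) :=
  .all fun _ => .imp _ (.and (mono_ex _) (.all fun _ => mono_imp _ _)) (regular_mem _ _)

theorem regular_isOmega (n : PName P) : Regular (isOmega n) :=
  .all fun _ => .iff (regular_mem _ _) (regular_isNat _)

theorem regular_isCountable (n : PName P) : Regular (isCountable n) := regular_ex _

theorem regular_isTransitive (n : PName P) : Regular (isTransitive n) :=
  .all fun _ => .imp _ (regular_mem _ _).mono (regular_sub _ _)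

theorem regular_isCountableOrdinal (n : PName P) : Regular (isCountableOrdinal n) :=
  .and (regular_isTransitive _)
    (.and (.all fun _ => .imp _ (regular_mem _ _).mono (regular_isTransitive _))
      (regular_isCountable _))

theorem regular_isSequence (s a : PName P) : Regular (isSequence s a) :=
  .and (regular_isCountableOrdinal _) (regular_ex _)

theorem regular_isNode (S s a : PName P) : Regular (isNode S s a) :=
  .and (regular_mem _ _) (regular_isSequence _ _)

theorem regular_inProduct (S F g : PName P) : Regular (inProduct S F g) :=
  .and (regular_isFunction _ _ _) (.all fun _ => .all fun _ => .imp _ (regular_ex _).mono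
    (regular_sub _ _))

theorem regular_productLE (k g : PName P) : Regular (productLE k g) :=
  .all fun _ => .all fun _ => .all fun _ => .imp _ (regular_ex _).mono
    (.imp _ (regular_ex _).mono (regular_sub _ _))

theorem regular_productCCC (S F : PName P) : Regular (productCCC S F) :=
  .all fun _ => .imp _ (.all fun _ => mono_imp _ _)
    (.imp _ (.all fun _ => .all fun _ => mono_imp _ _) (regular_isCountable _))

theorem isFunction.mem_iff {f X Y z : PName P} {p : P} (h : isFunction f X Y p)
    (hz : mem z f p) :
    Dense (fun q => ∃ x y, mem x X q ∧ mem y Y q ∧ eq z (pair x y) q) p := by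
  refine Dense.bind (h.1 _ p le_rfl hz) ?_
  rintro q hq ⟨x, h1⟩
  refine Dense.bind h1 ?_
  rintro r hr ⟨y, h2, h3, h4⟩ s hs
  exact ⟨s, le_rfl, x, y, (regular_mem _ _).mono hs h2, (regular_mem _ _).mono hs h3,
    mono_eq _ _ hs (isPair_iff.1 h4)⟩

theorem isFunction.mem_of_pair {f X Y x y : PName P} {p : P} (h : isFunction f X Y p)
    (hxy : mem (pair x y) f p) : mem x X p ∧ mem y Y p := by
  refine ((regular_mem x X).and (regular_mem y Y)).bind (h.mem_iff hxy) ?_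
  rintro q hq ⟨x', y', h2, h3, h4⟩
  have := pair_inj h4
  exact ⟨mem_congr_left (eq_symm this.1) h2, mem_congr_left (eq_symm this.2) h3⟩

theorem isFunction.exists_value {f X Y x : PName P} {p : P} (h : isFunction f X Y p)
    (hx : mem x X p) : Dense (fun q => ∃ y, mem y Y q ∧ mem (pair x y) f q) p := by
  refine Dense.bind (h.2.1 x p le_rfl hx) ?_
  rintro q hq ⟨y, hy⟩ r hr
  have hxy := (regular_mem _ _).mono hr (pairMem_iff.1 hy)
  exact ⟨r, le_rfl, y, (((regular_isFunction _ _ _).mono (hr.trans hq) h).mem_of_pair hxy).2, hxy⟩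

theorem isFunction.eq_of_mem {f X Y x y y' : PName P} {p : P} (h : isFunction f X Y p)
    (h1 : mem (pair x y) f p) (h2 : mem (pair x y') f p) : eq y y' p :=
  h.2.2 x y y' p le_rfl (pairMem_iff.2 h1) p le_rfl (pairMem_iff.2 h2)

theorem ex_intro {φ : PName P → Form P} {p : P} (x : PName P) (hx : Mono (φ x)) (h : φ x p) :
    ex φ p := fun q hq => ⟨q, le_rfl, x, hx hq h⟩

section
variable {ι : Type u} {x v : ι → PName P} {φ : ι → Form P}

theorem mem_pair_ofForm (hφ : ∀ i, Mono (φ i)) {a b : PName P} {p : P} :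
    mem (pair a b) (ofForm (fun i => pair (x i) (v i)) φ) p ↔
      Dense (fun r => ∃ i, φ i r ∧ eq a (x i) r ∧ eq b (v i) r) p := by
  rw [mem_ofForm hφ]
  refine forall_congr' fun q => forall_congr' fun _ => exists_congr fun r =>
    and_congr_right fun _ => exists_congr fun i => and_congr_right fun _ =>
    ⟨pair_inj, fun h => pair_congr h.1 h.2⟩

/-- Different indices may compete for the same argument; single-valuedness is needed only at
conditions admitting both of them. -/
theorem isFunction_ofForm (hφ : ∀ i, Mono (φ i)) {X Y : PName P} {p : P}
    (h1 : ∀ q ≤ p, ∀ i, φ i q → mem (x i) X q ∧ mem (v i) Y q)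
    (h2 : ∀ q ≤ p, ∀ a, mem a X q → Dense (fun r => ∃ i, φ i r ∧ eq a (x i) r) q)
    (h3 : ∀ q ≤ p, ∀ i j, φ i q → φ j q → eq (x i) (x j) q → eq (v i) (v j) q) :
    isFunction (ofForm (fun i => pair (x i) (v i)) φ) X Y p := by
  refine ⟨?_, ?_, ?_⟩
  · intro z q hq hz
    refine forall_mem_ofForm hφ hz (regular_ex _) ?_
    intro r hr i hi he
    refine ex_intro (x i) (regular_ex _).mono (ex_intro (v i) ?_ ?_)
    · exact (regular_mem _ _).mono.and ((regular_mem _ _).mono.and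
        fun _ _ h h' => isPair_iff.2 (mono_eq _ _ h (isPair_iff.1 h')))
    · exact ⟨(h1 r (hr.trans hq) i hi).1, (h1 r (hr.trans hq) i hi).2, isPair_iff.2 he⟩
  · intro a q hq ha
    refine (regular_ex _).bind (h2 q hq a ha) ?_
    rintro r hr ⟨i, hi, he⟩
    refine ex_intro (v i) (regular_pairMem _ _ _).mono (pairMem_iff.2 ?_)
    exact (mem_pair_ofForm hφ).2 fun s hs => ⟨s, le_rfl, i, hφ i hs hi, mono_eq _ _ hs he,
      eq_refl _ _⟩
  · intro a b b' q hq h r hr h'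
    have h := (mem_pair_ofForm hφ).1 (pairMem_iff.1 h)
    have h' := (mem_pair_ofForm hφ).1 (pairMem_iff.1 h')
    refine (regular_eq _ _).bind (Dense.mono hr h) ?_
    rintro s hs ⟨i, hi, e1, e2⟩
    refine (regular_eq _ _).bind (Dense.mono hs h') ?_
    rintro t ht ⟨j, hj, e3, e4⟩
    have := h3 t (ht.trans (hs.trans (hr.trans hq))) i j (hφ i ht hi) hj
      (eq_trans (eq_symm (mono_eq _ _ ht e1)) e3)
    exact eq_trans (mono_eq _ _ ht e2) (eq_trans this (eq_symm e4))

end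

/-! ### Natural numbers -/

/-- The name for the natural number `n`. -/
def nat : ℕ → PName P
  | 0 => setOf (fun i : PEmpty.{u + 1} => i.elim)
  | n + 1 => setOf (fun o : Option (ULift.{u} (Fin n)) => nat (o.elim n fun i => i.down))
  termination_by n => n
  decreasing_by
    rcases o with _ | i
    · exact Nat.lt_succ_self _
    · exact i.down.2.trans (Nat.lt_succ_self _)

theorem mem_nat {n : ℕ} {z : PName P} {p : P} :
    mem z (nat n) p ↔ Dense (fun r => ∃ m < n, eq z (nat m) r) p := by
  rcases n with _ | n
  · rw [nat, mem_setOf]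
    simp [Dense]
  · rw [nat, mem_setOf]
    refine forall_congr' fun q => forall_congr' fun _ => exists_congr fun r =>
      and_congr_right fun _ => ⟨?_, ?_⟩
    · rintro ⟨_ | i, h⟩
      · exact ⟨n, Nat.lt_succ_self _, h⟩
      · exact ⟨i.down, i.down.2.trans (Nat.lt_succ_self _), h⟩
    · rintro ⟨m, hm, h⟩
      rcases Nat.lt_succ_iff_lt_or_eq.1 hm with h' | rfl
      · exact ⟨some ⟨⟨m, h'⟩⟩, h⟩
      · exact ⟨none, h⟩

theorem nat_mem_nat {m n : ℕ} (h : m < n) (p : P) : mem (nat m) (nat n) p :=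
  mem_nat.2 fun q _ => ⟨q, le_rfl, m, h, eq_refl _ _⟩

theorem not_nat_mem_self (n : ℕ) (p : P) : ¬ mem (nat n) (nat n) p := by
  induction n using Nat.strong_induction_on generalizing p with
  | _ n ih =>
    intro h
    obtain ⟨q, -, m, hm, he⟩ := mem_nat.1 h p le_rfl
    exact ih m hm q (sub_of_eq he _ q le_rfl (nat_mem_nat hm q))

theorem nat_inj {m n : ℕ} {p : P} (h : eq (nat m) (nat n) p) : m = n := by
  rcases lt_trichotomy m n with h' | h' | h'
  · exact absurd (sub_of_eq (eq_symm h) _ p le_rfl (nat_mem_nat h' p)) (not_nat_mem_self _ _)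
  · exact h'
  · exact absurd (sub_of_eq h _ p le_rfl (nat_mem_nat h' p)) (not_nat_mem_self _ _)

/-- The name for the set of natural numbers. -/
def omega : PName P := setOf fun n : ULift.{u} ℕ => nat n.down

theorem mem_omega {z : PName P} {p : P} :
    mem z omega p ↔ Dense (fun r => ∃ n : ℕ, eq z (nat n) r) p := by
  rw [omega, mem_setOf]
  refine forall_congr' fun q => forall_congr' fun _ => exists_congr fun r =>
      and_congr_right fun _ => ⟨fun ⟨n, h⟩ => ⟨n.down, h⟩, fun ⟨n, h⟩ => ⟨⟨n⟩, h⟩⟩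

theorem nat_mem_omega (n : ℕ) (p : P) : mem (nat n) omega p :=
  mem_omega.2 fun q _ => ⟨q, le_rfl, n, eq_refl _ _⟩

theorem mem_nat_succ {n : ℕ} {z : PName P} {p : P} :
    mem z (nat (n + 1)) p ↔ or (mem z (nat n)) (eq z (nat n)) p := by
  rw [mem_nat]
  constructor
  · intro h q hq
    obtain ⟨r, hr, m, hm, h'⟩ := h q hq
    refine ⟨r, hr, ?_⟩
    rcases Nat.lt_succ_iff_lt_or_eq.1 hm with h1 | rfl
    · exact .inl (mem_congr_left (eq_symm h') (nat_mem_nat h1 _))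
    · exact .inr h'
  · intro h q hq
    obtain ⟨r, hr, h' | h'⟩ := h q hq
    · obtain ⟨s, hs, m, hm, h''⟩ := mem_nat.1 h' r le_rfl
      exact ⟨s, hs.trans hr, m, hm.trans (Nat.lt_succ_self _), h''⟩
    · exact ⟨r, hr, n, Nat.lt_succ_self _, h'⟩

theorem isInductive_omega (p : P) : isInductive omega p := by
  constructor
  · refine ex_intro (nat 0) ?_ ⟨nat_mem_omega _ _, ?_⟩
    · exact (regular_mem _ _).mono.and
        (.all fun _ => (regular_neg (regular_mem _ _).mono).mono)
    · intro y q _ hy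
      obtain ⟨r, -, m, hm, -⟩ := mem_nat.1 hy q le_rfl
      exact absurd hm (Nat.not_lt_zero _)
  · intro x q hq hx
    refine (regular_ex _).bind (mem_omega.1 hx) ?_
    rintro r hr ⟨n, hn⟩
    refine ex_intro (nat (n + 1)) ?_ ⟨nat_mem_omega _ _, fun z => ?_⟩
    · exact (regular_mem _ _).mono.and
        (.all fun _ => (Regular.iff (regular_mem _ _) (regular_or _ _)).mono)
    · have : Cong r (or (mem z (nat n)) (eq z (nat n))) (or (mem z x) (eq z x)) :=
        .or (.mem (eq_refl _ _) (eq_symm hn)) (.eq (eq_refl _ _) (eq_symm hn))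
      exact ⟨fun s hs h => (this s hs).1 (mem_nat_succ.1 h),
        fun s hs h => mem_nat_succ.2 ((this s hs).2 h)⟩

theorem isNat_nat (n : ℕ) (p : P) : isNat (nat n) p := by
  intro I q _ hI
  induction n with
  | zero =>
    refine (regular_mem _ _).bind hI.1 ?_
    rintro r hr ⟨e, he, h⟩
    refine mem_congr_left (eq_iff_forall_mem.2 fun z s hs => ?_) he
    refine ⟨fun hz => absurd hz (h z s hs), fun hz => ?_⟩
    obtain ⟨_, -, m, hm, -⟩ := mem_nat.1 hz s le_rfl
    exact absurd hm (Nat.not_lt_zero _)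
  | succ n ih =>
    refine (regular_mem _ _).bind (hI.2 _ q le_rfl ih) ?_
    rintro r hr ⟨y, hy, h⟩
    refine mem_congr_left (eq_iff_forall_mem.2 fun z s hs => ?_) hy
    exact ⟨fun h' => mem_nat_succ.2 ((h z).1 s hs h'), fun h' => (h z).2 s hs (mem_nat_succ.1 h')⟩

/-- `omega` is itself inductive, and every inductive set contains each `nat k`; hence the natural
numbers of the extension are densely standard. -/
theorem isNat_iff {n : PName P} {p : P} : isNat n p ↔ mem n omega p := by
  constructor
  · intro h
    exact h omega p le_rfl (isInductive_omega p)
  · intro h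
    refine (regular_isNat _).bind (mem_omega.1 h) ?_
    rintro q hq ⟨k, hk⟩
    exact (Cong.isNat (eq_symm hk)).mp (isNat_nat k q)

theorem isNat_iff_dense {n : PName P} {p : P} :
    isNat n p ↔ Dense (fun r => ∃ k : ℕ, eq n (nat k) r) p := isNat_iff.trans mem_omega

theorem isOmega_iff {w : PName P} {p : P} : isOmega w p ↔ eq w omega p := by
  rw [eq_iff_forall_mem]
  exact ⟨fun h z q hq => ⟨fun h' => isNat_iff.1 ((h z).1 q hq h'),
    fun h' => (h z).2 q hq (isNat_iff.2 h')⟩,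
    fun h z => ⟨fun q hq h' => isNat_iff.2 ((h z q hq).1 h'),
      fun q hq h' => (h z q hq).2 (isNat_iff.1 h')⟩⟩

/-- A set all of whose elements belong to a countable family of distinct names is countable. -/
theorem isCountable_of {X : PName P} {p : P} {J : Type u} [Countable J] (x : J → PName P)
    (hX : ∀ q ≤ p, ∀ z, mem z X q → Dense (fun r => ∃ j, eq z (x j) r) q)
    (hx : ∀ q ≤ p, ∀ i j, mem (x i) X q → mem (x j) X q → eq (x i) (x j) q → i = j) :
    isCountable X p := by
  obtain ⟨e, he⟩ := exists_injective_nat J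
  have hφ : ∀ i : J, Mono (mem (x i) X) := fun i => (regular_mem _ _).mono
  -- An index is admitted exactly under the conditions that force its name into `X`, so the domain
  -- is `X` even if the family is larger.
  have hf : isFunction (ofForm (fun i => pair (x i) (nat (e i))) fun i => mem (x i) X) X omega p := by
    refine isFunction_ofForm hφ (fun q _ i hi => ⟨hi, nat_mem_omega _ _⟩) ?_ ?_
    · intro q hq a ha
      refine (hX q hq a ha).bind ?_
      rintro r hr ⟨j, hj⟩ s hs
      exact ⟨s, le_rfl, j, mem_congr_left (mono_eq _ _ hs hj)
        ((regular_mem _ _).mono (hs.trans hr) ha), mono_eq _ _ hs hj⟩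
    · intro q hq i j hi hj h
      rw [hx q hq i j hi hj h]
      exact eq_refl _ _
  refine ex_intro omega (regular_ex _).mono (ex_intro _ ?_
    ⟨isOmega_iff.2 (eq_refl _ _), hf, ?_⟩)
  · exact (regular_isOmega _).mono.and ((regular_isFunction _ _ _).mono.and
      (regular_isInjective _).mono)
  · intro a a' b q hq h r hr h'
    have h := (mem_pair_ofForm hφ).1 (pairMem_iff.1 h)
    have h' := (mem_pair_ofForm hφ).1 (pairMem_iff.1 h')
    refine (regular_eq _ _).bind (Dense.mono hr h) ?_
    rintro s hs ⟨i, hi, e1, e2⟩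
    refine (regular_eq _ _).bind (Dense.mono hs h') ?_
    rintro t ht ⟨j, hj, e3, e4⟩
    obtain rfl : i = j := he (nat_inj (eq_trans (eq_symm (mono_eq _ _ ht e2)) e4))
    exact eq_trans (mono_eq _ _ ht e1) (eq_symm e3)

/-! ### Lifting names to a product -/

section Lift
variable {Q : Type u} [Preorder Q]

/-- In a lifted name every condition of `P` is paired with all elements of `Q`, so whatever second
coordinate occurs can be matched and the atomic clauses never depend on it. -/
theorem eq_lift : ∀ {x y : PName P} {p : P} {t : Q},
    eq (lift Q x) (lift Q y) (p, t) ↔ eq x y p := by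
  intro x
  induction x with
  | mk ι x c ih =>
    rintro ⟨κ, y, d⟩ p t
    constructor
    · intro h
      constructor
      · intro i q hq hc
        obtain ⟨⟨r, t'⟩, hr, ⟨j, u⟩, hj, h'⟩ := h.1 (i, t) (q, t) ⟨hq, le_rfl⟩ ⟨hc, le_rfl⟩
        exact ⟨r, hr.1, j, hj.1, (ih i).1 h'⟩
      · intro j q hq hc
        obtain ⟨⟨r, t'⟩, hr, ⟨i, u⟩, hj, h'⟩ := h.2 (j, t) (q, t) ⟨hq, le_rfl⟩ ⟨hc, le_rfl⟩
        exact ⟨r, hr.1, i, hj.1, (ih i).1 h'⟩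
    · intro h
      constructor
      · rintro ⟨i, u⟩ ⟨q, t'⟩ hq hc
        obtain ⟨r, hr, j, hj, h'⟩ := h.1 i q hq.1 hc.1
        exact ⟨(r, t'), ⟨hr, le_rfl⟩, (j, t'), ⟨hj, le_rfl⟩, (ih i).2 h'⟩
      · rintro ⟨j, u⟩ ⟨q, t'⟩ hq hc
        obtain ⟨r, hr, i, hj, h'⟩ := h.2 j q hq.1 hc.1
        exact ⟨(r, t'), ⟨hr, le_rfl⟩, (i, t'), ⟨hj, le_rfl⟩, (ih i).2 h'⟩

theorem mem_lift {x y : PName P} {p : P} {t : Q} :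
    mem (lift Q x) (lift Q y) (p, t) ↔ mem x y p := by
  obtain ⟨κ, y, d⟩ := y
  constructor
  · intro h q hq
    obtain ⟨⟨r, t'⟩, hr, ⟨j, u⟩, hj, h'⟩ := h (q, t) ⟨hq, le_rfl⟩
    exact ⟨r, hr.1, j, hj.1, eq_lift.1 h'⟩
  · rintro h ⟨q, t'⟩ hq
    obtain ⟨r, hr, j, hj, h'⟩ := h q hq.1
    exact ⟨(r, t'), ⟨hr, le_rfl⟩, (j, t'), ⟨hj, le_rfl⟩, eq_lift.2 h'⟩

/-- Inclusion quantifies over all names, but it is enough to test the lifts of the names that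
constitute `x`. -/
theorem sub_of_sub_lift {x y : PName P} {p : P} {t : Q}
    (h : sub (lift Q x) (lift Q y) (p, t)) : sub x y p := by
  intro z q hq hz
  obtain ⟨ι, x, c⟩ := x
  refine (regular_mem _ _).bind hz ?_
  rintro r hr ⟨i, hi, he⟩
  refine mem_congr_left (eq_symm he) (mem_lift (t := t).1 ?_)
  refine h (lift Q (x i)) (r, t) ⟨hr.trans hq, le_rfl⟩ ?_
  rintro ⟨s, t'⟩ hs
  exact ⟨(s, t'), le_rfl, (i, t'), ⟨hs.1.trans hi, le_rfl⟩, eq_refl _ _⟩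

theorem mem_lift_ofForm {ι : Type u} {x : ι → PName P} {φ : ι → Form P} (hφ : ∀ i, Mono (φ i))
    {z : PName (P × Q)} {p : P × Q} (h : mem z (lift Q (ofForm x φ)) p) :
    Dense (fun r => ∃ i, φ i r.1 ∧ eq z (lift Q (x i)) r) p := by
  intro q hq
  obtain ⟨r, hr, ⟨⟨⟨i, s⟩, hi⟩, t⟩, hj, h'⟩ := h q hq
  exact ⟨r, hr, i, hφ i hj.1 hi, h'⟩

end Lift

end

end Forcing

open Filter Set

/-! ### Order types like `ω₁` -/

/-- Well-orders of type `ω₁`, characterized by their countable initial segments. -/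
class OmegaOne (W : Type u) [LinearOrder W] : Prop where
  wellFoundedLT : WellFoundedLT W
  countable_Iio (a : W) : (Iio a).Countable
  uncountable : Uncountable W

namespace OmegaOne
variable {W : Type u} [LinearOrder W] [OmegaOne W]

instance : WellFoundedLT W := wellFoundedLT
instance : Uncountable W := uncountable

theorem exists_bound {s : Set W} (hs : s.Countable) : ∃ b, ∀ a ∈ s, a < b := by
  by_contra! h
  refine not_countable (α := W) (countable_univ_iff.1 ?_)
  have : (univ : Set W) ⊆ ⋃ a ∈ s, insert a (Iio a) := fun b _ => by
    obtain ⟨a, ha, hb⟩ := h b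
    exact mem_biUnion ha (hb.eq_or_lt.imp id id)
  exact (hs.biUnion fun a _ => (countable_Iio a).insert a).mono this

theorem exists_gt' (a : W) : ∃ b, a < b := by
  obtain ⟨b, hb⟩ := exists_bound (countable_singleton a)
  exact ⟨b, hb a rfl⟩

instance : NoMaxOrder W := ⟨exists_gt'⟩

/-- By recursion: at each stage only countably many values have been used. -/
theorem exists_injective (Y : Type*) [Uncountable Y] : ∃ f : W → Y, Function.Injective f := by
  have h : ∀ (a : W) (g : Iio a → Y), ∃ y, ∀ b, g b ≠ y := fun a g => by
    by_contra! h
    have := (countable_Iio a).to_subtype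
    exact not_countable (α := Y) (Function.Surjective.countable h)
  choose F hF using h
  let f : W → Y := (wellFounded_lt (α := W)).fix fun a ih => F a fun b => ih b.1 b.2
  have hf : ∀ a b, b < a → f b ≠ f a := fun a b hb => by
    have : f a = F a fun b => f b.1 := WellFounded.fix_eq _ _ _
    rw [this]
    exact hF a (fun b => f b.1) ⟨b, hb⟩
  refine ⟨f, fun a b hab => ?_⟩
  rcases lt_trichotomy a b with h | h | h
  · exact absurd hab (hf b a h)
  · exact h
  · exact absurd hab.symm (hf a b h)

instance : CountableInterFilter (atTop : Filter W) where
  countable_sInter_mem S hS h := by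
    choose! f hf using fun s hs => mem_atTop_sets.1 (h s hs)
    obtain ⟨b, hb⟩ := exists_bound (hS.image f)
    exact mem_atTop_sets.2 ⟨b, fun c hc s hs => hf s hs c
      ((hb _ (mem_image_of_mem f hs)).le.trans hc)⟩

end OmegaOne

theorem OmegaOne.of_omegaOne : OmegaOne (ω₁ : Ordinal.{u}).ToType where
  wellFoundedLT := inferInstance
  countable_Iio a := by
    rw [← Cardinal.le_aleph0_iff_set_countable]
    have h := (Cardinal.lt_ord (c := Cardinal.aleph 1)).1
      (by simpa using Ordinal.typein_lt_self a)
    rw [Ordinal.card_typein, ← Cardinal.succ_aleph0] at h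
    exact Order.lt_succ_iff.1 h
  uncountable := by
    rw [← Cardinal.aleph0_lt_mk_iff, Cardinal.mk_toType]
    simp

/-! ### Filters closed under countable intersections -/

section Filters
variable {X : Type*}

/-- Pigeonhole principle for a countably complete filter: if each of the countably many fibres were
null, so would be their union. -/
theorem exists_neBot_inf_fiber {γ : Type*} {l : Filter X} [NeBot l] [CountableInterFilter l]
    {g : X → γ} {s : Set γ} (hs : s.Countable) (h : ∀ᶠ x in l, g x ∈ s) :
    ∃ y ∈ s, NeBot (l ⊓ 𝓟 {x | g x = y}) := by
  by_contra! h'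
  have : ∀ᶠ x in l, ∀ y ∈ s, g x ≠ y := by
    rw [eventually_countable_ball hs]
    intro y hy
    have := h' y hy
    rw [inf_principal_eq_bot] at this
    exact this
  obtain ⟨x, hx, h2⟩ := (h.and this).exists
  exact h2 _ hx rfl

/-- The filter of sets containing eventually all points from some `s i` on. -/
def tailFilter {W : Type*} [LinearOrder W] [Nonempty W] (l : Filter X) (s : W → Set X)
    (hs : Antitone s) : Filter X where
  sets := {A | ∃ i, ∀ᶠ x in l, x ∈ s i → x ∈ A}
  univ_sets := ⟨Classical.arbitrary W, by simp⟩
  sets_of_superset := fun ⟨i, h⟩ h' => ⟨i, h.mono fun _ hx hi => h' (hx hi)⟩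
  inter_sets := fun ⟨i, h⟩ ⟨j, h'⟩ => ⟨max i j, by
    filter_upwards [h, h'] with x hx hx' hs'
    exact ⟨hx (hs (le_max_left _ _) hs'), hx' (hs (le_max_right _ _) hs')⟩⟩

variable {W : Type u} [LinearOrder W] [OmegaOne W]

/-- A family of finite sets of bounded size can be thinned out so that the sets split into a part
bounded by a fixed `δ` and a part tending to infinity. -/
theorem exists_delta (n : ℕ) : ∀ (l : Filter X) [NeBot l] [CountableInterFilter l]
    (F : X → Finset W), (∀ᶠ x in l, (F x).card ≤ n) →
    ∃ (δ : W) (l' : Filter X), l' ≤ l ∧ NeBot l' ∧ CountableInterFilter l' ∧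
      ∀ δ', ∀ᶠ x in l', ∀ w ∈ F x, w < δ ∨ δ' ≤ w := by
  have hW : Nonempty W := inferInstance
  induction n with
  | zero =>
    intro l _ _ F h
    refine ⟨Classical.arbitrary W, l, le_rfl, inferInstance, inferInstance, fun δ' => ?_⟩
    filter_upwards [h] with x hx w hw
    simp [Finset.card_eq_zero.1 (Nat.le_zero.1 hx)] at hw
  | succ n ih =>
    intro l _ _ F h
    -- Either the sets can frequently be found above any given bound, and restricting to such sets
    -- makes all of `F x` tend to infinity; or some element is eventually below a fixed bound, can
    -- be made constant on a fibre, and is removed for the induction.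
    by_cases hc : ∀ δ', ∃ᶠ x in l, ∀ w ∈ F x, δ' ≤ w
    · refine ⟨Classical.arbitrary W, tailFilter l (fun δ' => {x | ∀ w ∈ F x, δ' ≤ w})
        fun a b hab x hx w hw => hab.trans (hx w hw), ?_, ?_, ?_, ?_⟩
      · intro A hA
        exact ⟨Classical.arbitrary W, Eventually.mono hA fun x hx _ => hx⟩
      · refine ⟨fun hb => ?_⟩
        have : (∅ : Set X) ∈ tailFilter l (fun δ' => {x | ∀ w ∈ F x, δ' ≤ w})
          fun a b hab x hx w hw => hab.trans (hx w hw) := by rw [hb]; trivial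
        obtain ⟨i, hi⟩ := this
        exact hc i (hi.mono fun x hx h => hx h)
      · refine ⟨fun S hS h => ?_⟩
        choose! f hf using h
        obtain ⟨b, hb⟩ := OmegaOne.exists_bound (hS.image f)
        refine ⟨b, ?_⟩
        have := (eventually_countable_ball hS).2 hf
        filter_upwards [this] with x hx h1 s hs
        exact hx s hs fun w hw => (hb _ (mem_image_of_mem f hs)).le.trans (h1 w hw)
      · intro δ'
        exact ⟨δ', Eventually.of_forall fun x hx w hw => .inr (hx w hw)⟩
    · push Not at hc
      obtain ⟨δ', hδ'⟩ := hc
      have hg : ∀ x, ∃ w, (∃ w ∈ F x, w < δ') → w ∈ F x ∧ w < δ' := fun x => by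
        by_cases h : ∃ w ∈ F x, w < δ'
        · obtain ⟨w, hw⟩ := h
          exact ⟨w, fun _ => hw⟩
        · exact ⟨Classical.arbitrary W, fun h' => absurd h' h⟩
      choose g hg using hg
      obtain ⟨w0, hw0, hne⟩ := exists_neBot_inf_fiber (g := g) (OmegaOne.countable_Iio δ')
        (hδ'.mono fun x hx => (hg x hx).2)
      have := countableInterFilter_inf l (𝓟 {x | g x = w0})
      obtain ⟨δ, l', hl, h1, h2, h3⟩ := ih (l ⊓ 𝓟 {x | g x = w0}) (fun x => (F x).erase w0) (by
        filter_upwards [h.filter_mono inf_le_left, hδ'.filter_mono inf_le_left,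
          mem_inf_of_right (mem_principal_self _)] with x hx hx' hx2
        rw [Finset.card_erase_of_mem (hx2 ▸ (hg x hx').1)]
        omega)
      obtain ⟨b, hb⟩ := exists_gt w0
      refine ⟨max δ b, l', hl.trans inf_le_left, h1, h2, fun δ'' => ?_⟩
      filter_upwards [h3 (max δ'' (max δ b))] with x hx w hw
      by_cases hw0 : w = w0
      · exact .inl (hw0 ▸ hb.trans_le (le_max_right _ _))
      · rcases hx w (Finset.mem_erase.2 ⟨hw0, hw⟩) with h | h
        · exact .inl (h.trans_le (le_max_left _ _))
        · exact .inr ((le_max_left _ _).trans h)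

end Filters

/-! ### Trees with levels indexed by a well-order of type `ω₁` -/

/-- An Aronszajn tree together with its level function and its restriction maps. -/
structure LevelTree (T : Type u) (W : Type u) [PartialOrder T] [LinearOrder W] where
  lv : T → W
  res : T → W → T
  le_res {t : T} {β : W} : β ≤ lv t → t ≤ res t β
  lv_res {t : T} {β : W} : β ≤ lv t → lv (res t β) = β
  res_eq {t s : T} : t ≤ s → res t (lv s) = s
  lv_anti {t s : T} : t ≤ s → lv s ≤ lv t
  countable_level (β : W) : {t | lv t = β}.Countable
  exists_lv (β : W) : ∃ t, lv t = β
  exists_le {t : T} {β : W} : lv t ≤ β → ∃ s ≤ t, lv s = β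
  countable_chain (c : Set T) : IsChain (· ≤ ·) c → c.Countable

namespace LevelTree
variable {T W : Type u} [PartialOrder T] [LinearOrder W] (A : LevelTree T W)

theorem res_res {t : T} {β γ : W} (h : γ ≤ β) (h' : β ≤ A.lv t) :
    A.res (A.res t β) γ = A.res t γ := by
  have h1 : γ ≤ A.lv (A.res t β) := by rwa [A.lv_res h']
  have := A.res_eq ((A.le_res h').trans (A.le_res h1))
  rw [A.lv_res h1] at this
  exact this.symm

theorem res_self (t : T) : A.res t (A.lv t) = t := A.res_eq le_rfl

/-- Both nodes are restrictions of `t`, so the one of lower level is the restriction of the other.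
-/
theorem le_total_of_le (A : LevelTree T W) {t s s' : T} (h : t ≤ s) (h' : t ≤ s') :
    s ≤ s' ∨ s' ≤ s := by
  have key : ∀ {s s'}, t ≤ s → t ≤ s' → A.lv s ≤ A.lv s' → s' ≤ s := by
    intro s s' h h' hl
    have h3 := A.le_res hl
    rwa [← A.res_eq h', A.res_res hl (A.lv_anti h'), A.res_eq h, A.res_eq h'] at h3
  rcases le_total (A.lv s) (A.lv s') with hl | hl
  · exact .inr (key h h' hl)
  · exact .inl (key h' h hl)

/-- In a family of finite subsets of an Aronszajn tree whose levels tend to infinity, there are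
two sets without comparable elements. -/
theorem exists_incomparable [OmegaOne W] {X : Type*} {l : Filter X} [NeBot l]
    [CountableInterFilter l] (D : X → Finset T) (hD : ∀ δ, ∀ᶠ x in l, ∀ t ∈ D x, δ ≤ A.lv t) :
    ∃ᶠ x in l, ∃ᶠ y in l, ∀ t ∈ D y, ∀ t' ∈ D x, ¬ t ≤ t' := by
  obtain ⟨n, -, hn⟩ := exists_neBot_inf_fiber (l := l) (g := fun x => (D x).card)
    (to_countable univ) (Eventually.of_forall fun _ => mem_univ _)
  by_contra hc
  simp only [not_frequently, not_forall, not_not, exists_prop] at hc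
  -- The ultrafilter need not be countably complete; it is only used to choose one of finitely many
  -- pairs of indices.
  set U := Ultrafilter.of (l ⊓ 𝓟 {x | (D x).card = n})
  have hU : (U : Filter X) ≤ l ⊓ 𝓟 {x | (D x).card = n} := Ultrafilter.of_le _
  have hcard : ∀ᶠ x in (U : Filter X), (D x).card = n :=
    (hU.trans inf_le_right) (mem_principal_self _)
  have he' : ∀ x, ∃ e : Fin n → T, (D x).card = n →
      (∀ t ∈ D x, ∃ i, e i = t) ∧ ∀ i, e i ∈ D x := fun x => by
    by_cases h : (D x).card = n
    · refine ⟨fun i => ((D x).equivFin.symm (Fin.cast h.symm i)).1, fun _ => ⟨fun t ht =>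
        ⟨Fin.cast h ((D x).equivFin ⟨t, ht⟩), by simp⟩, fun i => Subtype.property _⟩⟩
    · exact ⟨fun _ => (A.exists_lv (Classical.arbitrary W)).choose, fun h' => absurd h' h⟩
  choose e he using he'
  have h1 : ∀ x, (D x).card = n → (∀ᶠ y in l, ∃ t ∈ D y, ∃ t' ∈ D x, t ≤ t') →
      ∃ ij : Fin n × Fin n, ∀ᶠ y in (U : Filter X), e y ij.1 ≤ e x ij.2 := fun x hx hcx => by
    have : ∀ᶠ y in (U : Filter X), ∃ ij : Fin n × Fin n, e y ij.1 ≤ e x ij.2 := by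
      have h2 : ∀ᶠ y in (U : Filter X), ∃ t ∈ D y, ∃ t' ∈ D x, t ≤ t' :=
        (hU.trans inf_le_left) hcx
      filter_upwards [h2, hcard] with y ⟨t, ht, t', ht', hle⟩ hy
      obtain ⟨i, rfl⟩ := (he y hy).1 t ht
      obtain ⟨j, rfl⟩ := (he x hx).1 t' ht'
      exact ⟨(i, j), hle⟩
    exact Ultrafilter.eventually_exists_iff.1 this
  have h2 : ∃ ij : Fin n × Fin n, ∀ᶠ x in (U : Filter X), ∀ᶠ y in (U : Filter X),
      e y ij.1 ≤ e x ij.2 :=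
    Ultrafilter.eventually_exists_iff.1
      ((hcard.and ((hU.trans inf_le_left) hc)).mono fun x hx => h1 x hx.1 hx.2)
  obtain ⟨⟨i, j⟩, hij⟩ := h2
  -- For two such `x`, almost every `y` has its `i`-th node below both `j`-th nodes, which are
  -- therefore comparable. Their levels are unbounded, so the chain is uncountable.
  have hch : IsChain (· ≤ ·) ((fun x => e x j) '' {x | (D x).card = n ∧
      ∀ᶠ y in (U : Filter X), e y i ≤ e x j}) := by
    rintro _ ⟨x, ⟨-, hx⟩, rfl⟩ _ ⟨x', ⟨-, hx'⟩, rfl⟩ -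
    obtain ⟨y, hy, hy'⟩ := (hx.and hx').exists
    exact A.le_total_of_le hy hy'
  obtain ⟨b, hb⟩ := OmegaOne.exists_bound ((A.countable_chain _ hch).image A.lv)
  have hb' : ∀ᶠ x in (U : Filter X), ∀ t ∈ D x, b ≤ A.lv t := (hU.trans inf_le_left) (hD b)
  obtain ⟨x, ⟨hx, hxn⟩, hx'⟩ := ((hb'.and hcard).and hij).exists
  exact absurd (hb _ ⟨_, ⟨x, ⟨hxn, hx'⟩, rfl⟩, rfl⟩) (not_lt.2 (hx _ ((he x hxn).2 j)))

end LevelTree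

/-! ### Passing from an Aronszajn tree to its level structure -/

section OfAronszajn
variable {T : Type u} [PartialOrder T] [DownwardTree T]

open DownwardTree

theorem DownwardTree.typein_eq_lev {t s : T} (h : t < s) :
    haveI := wo t
    Ordinal.typein (fun a b : Ioi t => a > b) ⟨s, h⟩ = lev s := by
  have := wo t
  have := wo s
  rw [← Ordinal.type_subrel, lev, Ordinal.type_eq]
  exact ⟨{ toFun := fun a => ⟨a.1.1, a.2⟩
           invFun := fun a => ⟨⟨a.1, h.trans a.2⟩, a.2⟩
           left_inv := fun _ => rfl
           right_inv := fun _ => rfl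
           map_rel_iff' := Iff.rfl }⟩

theorem DownwardTree.lev_lt_lev {t s : T} (h : t < s) : lev s < lev t := by
  have := wo t
  rw [← typein_eq_lev h]
  exact Ordinal.typein_lt_type _ _

theorem DownwardTree.exists_ge_lev_eq {t : T} {α : Ordinal.{u}} (h : α ≤ lev t) :
    ∃ s, t ≤ s ∧ lev s = α := by
  have := wo t
  rcases h.eq_or_lt with rfl | h
  · exact ⟨t, le_rfl, rfl⟩
  · obtain ⟨⟨s, hs⟩, h'⟩ := Ordinal.typein_surj (fun a b : Ioi t => a > b) h
    exact ⟨s, hs.le, (typein_eq_lev hs).symm.trans h'⟩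

theorem DownwardTree.eq_of_lev_eq {t s s' : T} (h : t ≤ s) (h' : t ≤ s') (he : lev s = lev s') :
    s = s' := by
  have := wo t
  rcases h.eq_or_lt with rfl | h
  · rcases h'.eq_or_lt with rfl | h'
    · rfl
    · exact absurd he (lev_lt_lev h').ne'
  · rcases h'.eq_or_lt with rfl | h'
    · exact absurd he (lev_lt_lev h).ne
    · rw [← typein_eq_lev h, ← typein_eq_lev h', Ordinal.typein_inj] at he
      exact congrArg Subtype.val he

/-- The level structure of an Aronszajn tree. -/
noncomputable def IsAronszajn.levelTree (hT : IsAronszajn T) :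
    LevelTree T (ω₁ : Ordinal.{u}).ToType := by
  classical
  let f : Iio (ω₁ : Ordinal.{u}) ≃o (ω₁ : Ordinal.{u}).ToType := Ordinal.ToType.mk
  let lv : T → (ω₁ : Ordinal.{u}).ToType := fun t => f ⟨lev t, hT.lev_lt t⟩
  have hlv : ∀ t β, lv t = β ↔ lev t = (f.symm β).1 := fun t β => by
    exact f.toEquiv.eq_symm_apply.symm.trans Subtype.ext_iff
  have hle : ∀ t β, β ≤ lv t ↔ (f.symm β).1 ≤ lev t := fun t β => f.symm_apply_le.symm
  have hle' : ∀ t β, lv t ≤ β ↔ lev t ≤ (f.symm β).1 := fun t β => f.le_symm_apply.symm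
  have hex : ∀ t β, ∃ s, β ≤ lv t → t ≤ s ∧ lv s = β := fun t β => by
    by_cases h : β ≤ lv t
    · obtain ⟨s, hs⟩ := exists_ge_lev_eq ((hle t β).1 h)
      exact ⟨s, fun _ => ⟨hs.1, (hlv s β).2 hs.2⟩⟩
    · exact ⟨t, fun h' => absurd h' h⟩
  have hanti : ∀ {t s : T}, t ≤ s → lv s ≤ lv t := fun {t s} h => by
    rcases h.eq_or_lt with rfl | h
    · exact le_rfl
    · exact f.le_iff_le.2 (lev_lt_lev h).le
  refine { lv := lv
           res := fun t β => (hex t β).choose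
           le_res := fun {t β} h => ((hex t β).choose_spec h).1
           lv_res := fun {t β} h => ((hex t β).choose_spec h).2
           res_eq := ?_
           lv_anti := hanti
           countable_level := ?_
           exists_lv := ?_
           exists_le := ?_
           countable_chain := hT.chain_countable }
  · intro t s h
    have h' := (hex t (lv s)).choose_spec (hanti h)
    refine eq_of_lev_eq h'.1 h ?_
    have := (hlv _ _).1 h'.2
    rw [this]
    simp [lv]
  · intro β
    have := hT.level_countable (f.symm β).1 (f.symm β).2
    simpa only [hlv] using this
  · intro β
    obtain ⟨t, ht⟩ := hT.level_nonempty (f.symm β).1 (f.symm β).2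
    exact ⟨t, (hlv t β).2 ht⟩
  · intro t β h
    obtain ⟨s, hs, h'⟩ := hT.extend t _ ((hle' t β).1 h) (f.symm β).2
    exact ⟨s, hs, (hlv s β).2 h'⟩

end OfAronszajn

set_option linter.unusedSectionVars false

/-! ### The tree computed from a function `c`

To every `c : W × ℕ × ℕ → ℕ` we associate a tree on `W × ℕ` together with a map assigning rational
values to pairs of nodes of `T` and of the new tree on the same level. -/

namespace GenericTree

/-- Finite information on a node of level `α`: a node above it and the values at some nodes of `T`
of level `α`. -/
structure State (T W : Type u) where
  node : W × ℕ
  promises : Finset (T × ℚ)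

/-- The predecessors of the nodes of a fixed level and their values. -/
structure LevelData (T W : Type u) where
  pred : ℕ → W → ℕ
  val : T → ℕ → ℚ

variable {T W : Type u}

/-! ### States, requests, bookkeeping and the recursive step -/

section Defs
variable [LinearOrder W]

/-- The node `x` is below `y`. -/
def Below (D : W → LevelData T W) (x y : W × ℕ) : Prop :=
  y.1 ≤ x.1 ∧ (D x.1).pred x.2 y.1 = y.2

/-- The state `σ'` contains more information than `σ`. -/
structure Extends (D : W → LevelData T W) (σ' σ : State T W) : Prop where
  below : Below D σ'.node σ.node
  sub : σ.promises ⊆ σ'.promises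

variable [PartialOrder T] (A : LevelTree T W)

/-- The value at the node `x` and the node above `t` on the same level. -/
def value (D : W → LevelData T W) (t : T) (x : W × ℕ) : ℚ := (D x.1).val (A.res t x.1) x.2

variable [OrderBot W]

/-- The state `σ` is consistent for nodes of level `α`. -/
structure Valid (D : W → LevelData T W) (α : W) (σ : State T W) : Prop where
  lt : σ.node.1 < α
  bot : σ.node.1 = ⊥ → σ.node.2 = 0
  lv : ∀ tq ∈ σ.promises, A.lv tq.1 = α
  val : ∀ tq ∈ σ.promises, value A D tq.1 σ.node < tq.2
  func : ∀ t q q', (t, q) ∈ σ.promises → (t, q') ∈ σ.promises → q = q'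

/-- The state without information. -/
def rootState : State T W := ⟨(⊥, 0), ∅⟩

theorem exists_code [OmegaOne W] (α : W) : ∃ f : ℕ → State T W, ∀ σ : State T W, σ.node.1 < α →
    (∀ tq ∈ σ.promises, A.lv tq.1 = α) → ∃ k, f k = σ := by
  have : Nonempty (State T W) := ⟨rootState⟩
  have h1 : Countable (Iio α) := (OmegaOne.countable_Iio α).to_subtype
  have h2 : Countable {t | A.lv t = α} := (A.countable_level α).to_subtype
  classical
  let F : (Iio α × ℕ) × Finset ({t | A.lv t = α} × ℚ) → State T W := fun x =>
    ⟨(x.1.1.1, x.1.2), x.2.image fun tq => (tq.1.1, tq.2)⟩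
  have h3 : (range F).Countable := countable_range F
  obtain ⟨f, hf⟩ := countable_iff_exists_subset_range.1 h3
  refine ⟨f, fun σ h h' => hf ?_⟩
  refine ⟨((⟨σ.node.1, h⟩, σ.node.2), σ.promises.attach.image
    fun tq => (⟨tq.1.1, h' tq.1 tq.2⟩, tq.1.2)), ?_⟩
  have : (σ.promises.attach.image fun tq =>
      ((⟨tq.1.1, h' tq.1 tq.2⟩, tq.1.2) : {t | A.lv t = α} × ℚ)).image
      (fun tq => (tq.1.1, tq.2)) = σ.promises := by
    rw [Finset.image_image]
    exact Finset.attach_image_val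
  simp only [F, this]

theorem exists_task [OmegaOne W] (α : W) : ∃ f : ℕ → W × T, ∀ β t, β < α → A.lv t = α →
    ∃ k, f k = (β, t) := by
  have : Nonempty (W × T) := ⟨(α, (A.exists_lv α).choose)⟩
  obtain ⟨f, hf⟩ := countable_iff_exists_subset_range.1
    ((OmegaOne.countable_Iio α).prod (A.countable_level α))
  exact ⟨f, fun β t h h' => hf ⟨h, h'⟩⟩

variable [OmegaOne W]

/-- An enumeration of the states of nodes of level `α`. -/
noncomputable def code (α : W) : ℕ → State T W := (exists_code A α).choose

theorem exists_code_eq {α : W} {σ : State T W} (h : σ.node.1 < α)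
    (h' : ∀ tq ∈ σ.promises, A.lv tq.1 = α) : ∃ k, code A α k = σ :=
  (exists_code A α).choose_spec σ h h'

/-- An enumeration of the pairs of a level below `α` and a node of `T` of level `α`. -/
noncomputable def task (α : W) : ℕ → W × T := (exists_task A α).choose

theorem exists_task_eq {α β : W} {t : T} (h : β < α) (h' : A.lv t = α) :
    ∃ k, task A α k = (β, t) := (exists_task A α).choose_spec β t h h'

variable (D : W → LevelData T W) (α : W)

open Classical in
/-- The initial information on the node `(α, n)`. -/
noncomputable def initState (n : ℕ) : State T W :=
  if Valid A D α (code A α n.unpair.1) then code A α n.unpair.1 else rootState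

open Classical in
/-- Replace the state by the state with code `j` if this is allowed. -/
noncomputable def request (j : ℕ) (σ : State T W) : State T W :=
  if Valid A D α (code A α j) ∧ Extends D (code A α j) σ then code A α j else σ

/-- The state with code `j` extends `σ` and fulfils the `k`-th task. -/
structure Fulfils (k : ℕ) (σ : State T W) (j : ℕ) : Prop where
  valid : Valid A D α (code A α j)
  ext : Extends D (code A α j) σ
  le : (task A α k).1 ≤ (code A α j).node.1
  mem : ∃ q, ((task A α k).2, q) ∈ (code A α j).promises

open Classical in
/-- The value of `f` at the first number with property `p`, or `d` if there is none. -/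
noncomputable def firstOr {X : Type*} (p : ℕ → Prop) (f : ℕ → X) (d : X) : X :=
  if h : ∃ j, p j then f (Nat.find h) else d

theorem firstOr_spec {X : Type*} {p : ℕ → Prop} (f : ℕ → X) (d : X) (h : ∃ j, p j) :
    ∃ j, p j ∧ firstOr p f d = f j ∧ ∀ i < j, ¬ p i := by
  classical
  exact ⟨Nat.find h, Nat.find_spec h, dif_pos h, fun _ => Nat.find_min h⟩

theorem firstOr_of_not {X : Type*} {p : ℕ → Prop} (f : ℕ → X) (d : X) (h : ¬ ∃ j, p j) :
    firstOr p f d = d := dif_neg h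

/-- A search ends no later than at a known solution `j`, so only what happens up to `j` matters.
This makes the unbounded searches continuous in `c`. -/
theorem firstOr_congr {X : Type*} {p p' : ℕ → Prop} {f f' : ℕ → X} {d d' : X} {j : ℕ} (hj : p j)
    (h : ∀ i ≤ j, (p i ↔ p' i) ∧ f i = f' i) : firstOr p f d = firstOr p' f' d' := by
  obtain ⟨k, hk, hk', hk2⟩ := firstOr_spec f d ⟨j, hj⟩
  obtain ⟨l, hl, hl', hl2⟩ := firstOr_spec f' d' ⟨j, (h j le_rfl).1.1 hj⟩
  have h1 : k ≤ j := not_lt.1 fun h' => hk2 j h' hj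
  have h2 : l ≤ j := not_lt.1 fun h' => hl2 j h' ((h j le_rfl).1.1 hj)
  obtain rfl : k = l := le_antisymm (not_lt.1 fun h' => hk2 l h' ((h l h2).1.2 hl))
    (not_lt.1 fun h' => hl2 k h' ((h k h1).1.1 hk))
  rw [hk', hl', (h k h1).2]

/-- Fulfil the `k`-th task. -/
noncomputable def bookkeep (k : ℕ) (σ : State T W) : State T W :=
  firstOr (Fulfils A D α k σ) (code A α) σ

/-- The information on the node `(α, n)` after `k` steps. -/
noncomputable def stateAux (r : ℕ → ℕ → ℕ) (n : ℕ) : ℕ → State T W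
  | 0 => initState A D α n
  | k + 1 => bookkeep A D α k (request A D α (r n k) (stateAux r n k))

open Classical in
/-- The level `α` of the tree. -/
noncomputable def levelAux (r : ℕ → ℕ → ℕ) : LevelData T W where
  pred n β :=
    if β < α then
      firstOr (fun k => β ≤ (stateAux A D α r n k).node.1)
        (fun k => (D (stateAux A D α r n k).node.1).pred (stateAux A D α r n k).node.2 β) 0
    else n
  val t n :=
    firstOr (fun k => ∃ q, (t, q) ∈ (stateAux A D α r n k).promises)
      (fun k => if h : ∃ q, (t, q) ∈ (stateAux A D α r n k).promises then h.choose else 0) 0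

open Classical in
/-- The restriction of `D` to the levels below `α`. -/
noncomputable def trunc : W → LevelData T W :=
  fun β => if β < α then D β else ⟨fun n _ => n, fun _ _ => 0⟩

end Defs

/-! ### The recursion on levels and its inductive properties -/

section Tree
variable [LinearOrder W] [OrderBot W] [OmegaOne W] [PartialOrder T] (A : LevelTree T W)

/-- The tree computed from `c`. -/
noncomputable def tree (c : W × ℕ × ℕ → ℕ) : W → LevelData T W :=
  (wellFounded_lt (α := W)).fix fun α ih =>
    open Classical in
    levelAux A (fun β => if h : β < α then ih β h else ⟨fun n _ => n, fun _ _ => 0⟩) α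
      fun n k => c (α, n, k)

variable (c : W × ℕ × ℕ → ℕ)

theorem tree_eq (α : W) :
    tree A c α = levelAux A (trunc (tree A c) α) α fun n k => c (α, n, k) := by
  rw [tree, WellFounded.fix_eq]
  congr

/-- The information on the node `x` after `k` steps. -/
noncomputable def state (x : W × ℕ) (k : ℕ) : State T W :=
  stateAux A (trunc (tree A c) x.1) x.1 (fun n k => c (x.1, n, k)) x.2 k

variable {A c} {α : W}

theorem trunc_of_lt {D : W → LevelData T W} {β : W} (h : β < α) : trunc D α β = D β := if_pos h

/-- The node of a valid state has level below `α`, so levels from `α` on are never consulted. Thus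
the truncated data used by the recursion can be replaced by the finished tree. -/
theorem valid_trunc {D : W → LevelData T W} {σ : State T W} :
    Valid A (trunc D α) α σ ↔ Valid A D α σ := by
  constructor
  · rintro ⟨h1, h2, h3, h4, h5⟩
    refine ⟨h1, h2, h3, fun tq h => ?_, h5⟩
    simpa only [value, trunc_of_lt h1] using h4 tq h
  · rintro ⟨h1, h2, h3, h4, h5⟩
    refine ⟨h1, h2, h3, fun tq h => ?_, h5⟩
    simpa only [value, trunc_of_lt h1] using h4 tq h

theorem below_trunc {D : W → LevelData T W} {x y : W × ℕ} (h : x.1 < α) :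
    Below (trunc D α) x y ↔ Below D x y := by
  rw [Below, Below, trunc_of_lt h]

theorem extends_trunc {D : W → LevelData T W} {σ σ' : State T W} (h : σ'.node.1 < α) :
    Extends (trunc D α) σ' σ ↔ Extends D σ' σ :=
  ⟨fun h' => ⟨(below_trunc h).1 h'.1, h'.2⟩, fun h' => ⟨(below_trunc h).2 h'.1, h'.2⟩⟩

theorem pred_self (α : W) (n : ℕ) : (tree A c α).pred n α = n := by
  rw [tree_eq]
  simp [levelAux]

theorem Below.refl (x : W × ℕ) : Below (tree A c) x x := ⟨le_rfl, pred_self _ _⟩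

theorem Extends.refl (σ : State T W) : Extends (tree A c) σ σ := ⟨.refl _, Finset.Subset.refl _⟩

variable (A c) in
/-- The properties of level `α` proved by induction. -/
structure LevelProps (α : W) : Prop where
  coherent : ∀ n β γ, γ ≤ β → β ≤ α →
    (tree A c β).pred ((tree A c α).pred n β) γ = (tree A c α).pred n γ
  pred_bot : α ≠ ⊥ → ∀ n, (tree A c α).pred n ⊥ = 0
  extension : ∀ (u : W × ℕ) (g : Finset (T × ℚ)), u.1 < α → (u.1 = ⊥ → u.2 = 0) →
    (∀ tq ∈ g, A.lv tq.1 = α) → (∀ tq ∈ g, value A (tree A c) tq.1 u < tq.2) →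
    ∀ N, ∃ m ≥ N, Below (tree A c) (α, m) u ∧
      ∀ tq ∈ g, value A (tree A c) tq.1 (α, m) < tq.2
  strict : ∀ t n β, A.lv t = α → β < α →
    value A (tree A c) t (β, (tree A c α).pred n β) < value A (tree A c) t (α, n)

theorem exists_pos_add_lt {ι : Type*} (s : Finset ι) (f g : ι → ℚ) (h : ∀ i ∈ s, f i < g i) :
    ∃ ε > 0, ∀ i ∈ s, f i + ε < g i := by
  classical
  induction s using Finset.induction_on with
  | empty => exact ⟨1, one_pos, by simp⟩
  | insert a s _ ih =>
    obtain ⟨ε, hε, h'⟩ := ih fun i hi => h i (Finset.mem_insert_of_mem hi)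
    have ha := h a (Finset.mem_insert_self _ _)
    refine ⟨min ε ((g a - f a) / 2), lt_min hε (by linarith), fun i hi => ?_⟩
    rcases Finset.mem_insert.1 hi with rfl | hi
    · have := min_le_right ε ((g i - f i) / 2)
      linarith
    · have := min_le_left ε ((g a - f a) / 2)
      linarith [h' i hi]

theorem value_res {D : W → LevelData T W} {t : T} {β : W} {x : W × ℕ} (h : x.1 ≤ β)
    (h' : β ≤ A.lv t) : value A D (A.res t β) x = value A D t x := by
  rw [value, value, A.res_res h h']

/-- Transitivity is coherence at the level of the lowest node `x`; that level is below `α`, so it is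
available inside the induction. -/
theorem below_trans_aux (ih : ∀ β < α, LevelProps A c β) {x y z : W × ℕ} (hx : x.1 < α)
    (h : Below (tree A c) x y) (h' : Below (tree A c) y z) : Below (tree A c) x z := by
  refine ⟨h'.1.trans h.1, ?_⟩
  rw [← (ih x.1 hx).coherent x.2 y.1 z.1 h'.1 h.1, h.2, h'.2]

theorem extends_trans_aux (ih : ∀ β < α, LevelProps A c β) {x y z : State T W}
    (hx : x.node.1 < α) (h : Extends (tree A c) x y) (h' : Extends (tree A c) y z) :
    Extends (tree A c) x z :=
  ⟨below_trans_aux ih hx h.1 h'.1, h'.2.trans h.2⟩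

theorem valid_rootState (hα : α ≠ ⊥) : Valid A (tree A c) α rootState :=
  ⟨bot_lt_iff_ne_bot.2 hα, fun _ => rfl, by simp [rootState], by simp [rootState],
    by simp [rootState]⟩

theorem state_zero (x : W × ℕ) : state A c x 0 = initState A (tree A c) x.1 x.2 := by
  unfold state stateAux initState
  by_cases h : Valid A (tree A c) x.1 (code A x.1 x.2.unpair.1)
  · rw [if_pos h, if_pos (valid_trunc.2 h)]
  · rw [if_neg h, if_neg (mt valid_trunc.1 h)]

theorem request_trunc (j : ℕ) (σ : State T W) :
    request A (trunc (tree A c) α) α j σ = request A (tree A c) α j σ := by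
  unfold request
  have : Valid A (trunc (tree A c) α) α (code A α j) ∧
      Extends (trunc (tree A c) α) (code A α j) σ ↔
      Valid A (tree A c) α (code A α j) ∧ Extends (tree A c) (code A α j) σ := by
    rw [valid_trunc]
    exact and_congr_right fun h => extends_trunc h.lt
  by_cases h : Valid A (tree A c) α (code A α j) ∧ Extends (tree A c) (code A α j) σ
  · rw [if_pos h, if_pos (this.2 h)]
  · rw [if_neg h, if_neg (mt this.1 h)]

theorem fulfils_trunc {k : ℕ} {σ : State T W} {j : ℕ} :
    Fulfils A (trunc (tree A c) α) α k σ j ↔ Fulfils A (tree A c) α k σ j := by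
  constructor
  · rintro ⟨h1, h2, h3, h4⟩
    exact ⟨valid_trunc.1 h1, (extends_trunc h1.lt).1 h2, h3, h4⟩
  · rintro ⟨h1, h2, h3, h4⟩
    exact ⟨valid_trunc.2 h1, (extends_trunc h1.lt).2 h2, h3, h4⟩

theorem state_succ (x : W × ℕ) (k : ℕ) : state A c x (k + 1) =
    bookkeep A (tree A c) x.1 k (request A (tree A c) x.1 (c (x.1, x.2, k)) (state A c x k)) := by
  rw [state, stateAux, request_trunc, bookkeep, bookkeep]
  rw [show Fulfils A (trunc (tree A c) x.1) x.1 k _ = Fulfils A (tree A c) x.1 k _ from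
    funext fun _ => propext fulfils_trunc]
  rfl

theorem valid_request {j : ℕ} {σ : State T W} (h : Valid A (tree A c) α σ) :
    Valid A (tree A c) α (request A (tree A c) α j σ) := by
  unfold request
  split_ifs with h'
  · exact h'.1
  · exact h

theorem extends_request {j : ℕ} {σ : State T W} :
    Extends (tree A c) (request A (tree A c) α j σ) σ := by
  unfold request
  split_ifs with h'
  · exact h'.2
  · exact .refl _

theorem valid_bookkeep {k : ℕ} {σ : State T W} (h : Valid A (tree A c) α σ) :
    Valid A (tree A c) α (bookkeep A (tree A c) α k σ) := by
  unfold bookkeep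
  by_cases h' : ∃ j, Fulfils A (tree A c) α k σ j
  · obtain ⟨j, hj, he, -⟩ := firstOr_spec (code A α) σ h'
    exact he ▸ hj.valid
  · rwa [firstOr_of_not _ _ h']

theorem extends_bookkeep {k : ℕ} {σ : State T W} :
    Extends (tree A c) (bookkeep A (tree A c) α k σ) σ := by
  unfold bookkeep
  by_cases h' : ∃ j, Fulfils A (tree A c) α k σ j
  · obtain ⟨j, hj, he, -⟩ := firstOr_spec (code A α) σ h'
    exact he ▸ hj.ext
  · rw [firstOr_of_not _ _ h']
    exact .refl _

/-- The bottom level is excluded because not even the empty state is valid there: it would need a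
node of lower level. -/
theorem valid_state {x : W × ℕ} (hx : x.1 ≠ ⊥) (k : ℕ) :
    Valid A (tree A c) x.1 (state A c x k) := by
  induction k with
  | zero =>
    rw [state_zero]
    unfold initState
    split_ifs with h
    · exact h
    · exact valid_rootState hx
  | succ k ih =>
    rw [state_succ]
    exact valid_bookkeep (valid_request ih)

theorem extends_state_succ_request {x : W × ℕ} (k : ℕ) :
    Extends (tree A c) (state A c x (k + 1))
      (request A (tree A c) x.1 (c (x.1, x.2, k)) (state A c x k)) := by
  rw [state_succ]
  exact extends_bookkeep

theorem extends_state_succ_aux (ih : ∀ β < α, LevelProps A c β) (hα : α ≠ ⊥) (n k : ℕ) :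
    Extends (tree A c) (state A c (α, n) (k + 1)) (state A c (α, n) k) :=
  extends_trans_aux ih (valid_state hα _).lt (extends_state_succ_request k) extends_request

theorem extends_state_aux (ih : ∀ β < α, LevelProps A c β) (hα : α ≠ ⊥) (n : ℕ) {k l : ℕ}
    (h : k ≤ l) : Extends (tree A c) (state A c (α, n) l) (state A c (α, n) k) := by
  induction l, h using Nat.le_induction with
  | base => exact .refl _
  | succ l _ h' =>
    exact extends_trans_aux ih (valid_state hα _).lt (extends_state_succ_aux ih hα n l) h'

/-- If the current node is above level `β`, the inductive extension property at `β`, applied to the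
promises restricted to that level, moves it down while all values stay below their bounds.
Afterwards `t` can be promised any number above the value reached. -/
theorem exists_fulfils_aux (ih : ∀ β < α, LevelProps A c β) {k : ℕ}
    (h1 : (task A α k).1 < α) (h2 : A.lv (task A α k).2 = α) {σ : State T W}
    (hσ : Valid A (tree A c) α σ) : ∃ j, Fulfils A (tree A c) α k σ j := by
  classical
  set β := (task A α k).1
  set t := (task A α k).2
  obtain ⟨v, hv1, hv2, hv3, hv4, hv5⟩ : ∃ v : W × ℕ, v.1 < α ∧ (v.1 = ⊥ → v.2 = 0) ∧ β ≤ v.1 ∧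
      Below (tree A c) v σ.node ∧ ∀ tq ∈ σ.promises, value A (tree A c) tq.1 v < tq.2 := by
    rcases le_or_gt β σ.node.1 with h | h
    · exact ⟨σ.node, hσ.lt, hσ.bot, h, .refl _, hσ.val⟩
    · obtain ⟨m, -, hm, hm'⟩ := (ih β h1).extension σ.node
        (σ.promises.image fun tq => (A.res tq.1 β, tq.2)) h hσ.bot
        (fun tq htq => by
          obtain ⟨s, hs, rfl⟩ := Finset.mem_image.1 htq
          exact A.lv_res (by rw [hσ.lv s hs]; exact h1.le))
        (fun tq htq => by
          obtain ⟨s, hs, rfl⟩ := Finset.mem_image.1 htq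
          rw [value_res h.le (by rw [hσ.lv s hs]; exact h1.le)]
          exact hσ.val s hs) 0
      refine ⟨(β, m), h1, fun h' => absurd h' (bot_le.trans_lt h).ne', le_rfl, hm, fun tq htq => ?_⟩
      have := hm' _ (Finset.mem_image_of_mem _ htq)
      rwa [value_res (x := (β, m)) le_rfl (by rw [hσ.lv _ htq]; exact h1.le)] at this
  by_cases ht : ∃ q, (t, q) ∈ σ.promises
  · obtain ⟨j, hj⟩ := exists_code_eq A (α := α) (σ := ⟨v, σ.promises⟩) hv1 hσ.lv
    refine ⟨j, ?_, ?_, ?_, ?_⟩ <;> rw [hj]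
    · exact ⟨hv1, hv2, hσ.lv, hv5, hσ.func⟩
    · exact ⟨hv4, Finset.Subset.refl _⟩
    · exact hv3
    · exact ht
  -- Nothing was promised for `t`, so any number exceeding its current value may be chosen.
  · obtain ⟨j, hj⟩ := exists_code_eq A (α := α)
      (σ := ⟨v, insert (t, value A (tree A c) t v + 1) σ.promises⟩) hv1 (fun tq htq => by
        rcases Finset.mem_insert.1 htq with rfl | h
        · exact h2
        · exact hσ.lv _ h)
    refine ⟨j, ?_, ?_, ?_, ?_⟩ <;> rw [hj]
    · refine ⟨hv1, hv2, fun tq htq => ?_, fun tq htq => ?_, fun s q q' h h' => ?_⟩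
      · rcases Finset.mem_insert.1 htq with rfl | h
        · exact h2
        · exact hσ.lv _ h
      · rcases Finset.mem_insert.1 htq with rfl | h
        · exact lt_add_one _
        · exact hv5 _ h
      · rcases Finset.mem_insert.1 h with h | h <;> rcases Finset.mem_insert.1 h' with h' | h'
        · exact (Prod.ext_iff.1 h).2.trans (Prod.ext_iff.1 h').2.symm
        · exact absurd ⟨q', by rwa [← show s = t from (Prod.ext_iff.1 h).1]⟩ ht
        · exact absurd ⟨q, by rwa [← show s = t from (Prod.ext_iff.1 h').1]⟩ ht
        · exact hσ.func s q q' h h'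
    · exact ⟨hv4, Finset.subset_insert _ _⟩
    · exact hv3
    · exact ⟨_, Finset.mem_insert_self _ _⟩

theorem exists_state_aux (ih : ∀ β < α, LevelProps A c β) {β : W} {t : T} (h1 : β < α)
    (h2 : A.lv t = α) (n : ℕ) :
    ∃ k, β ≤ (state A c (α, n) k).node.1 ∧ ∃ q, (t, q) ∈ (state A c (α, n) k).promises := by
  classical
  obtain ⟨k, hk⟩ := exists_task_eq A h1 h2
  have h := exists_fulfils_aux (k := k) ih (by rwa [hk]) (by rwa [hk])
    (valid_request (j := c (α, n, k)) (valid_state (c := c) (x := (α, n)) (ne_bot_of_gt h1) k))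
  refine ⟨k + 1, ?_⟩
  obtain ⟨j, h', he, -⟩ := firstOr_spec (code A α)
    (request A (tree A c) α (c (α, n, k)) (state A c (α, n) k)) h
  rw [state_succ, bookkeep, he]
  have h3 := h'.le
  have h4 := h'.mem
  rw [hk] at h3 h4
  exact ⟨h3, h4⟩

theorem exists_le_state_aux (ih : ∀ β < α, LevelProps A c β) {β : W} (h1 : β < α) (n : ℕ) :
    ∃ k, β ≤ (state A c (α, n) k).node.1 := by
  obtain ⟨t, ht⟩ := A.exists_lv α
  obtain ⟨k, hk, -⟩ := exists_state_aux ih h1 ht n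
  exact ⟨k, hk⟩

/-- The definition uses the first stage reaching level `β`. Later stages only move below earlier
ones, so by coherence every stage that has reached `β` gives the same predecessor. -/
theorem pred_eq_aux (ih : ∀ β < α, LevelProps A c β) {β : W} (h1 : β < α) {n k : ℕ}
    (hk : β ≤ (state A c (α, n) k).node.1) : (tree A c α).pred n β =
      (tree A c (state A c (α, n) k).node.1).pred (state A c (α, n) k).node.2 β := by
  have hα := ne_bot_of_gt h1
  have hv := fun k => valid_state (A := A) (c := c) (x := (α, n)) hα k
  obtain ⟨l, hl, he, hl'⟩ := firstOr_spec
    (p := fun k => β ≤ (stateAux A (trunc (tree A c) α) α (fun n k => c (α, n, k)) n k).node.1)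
    (fun k => (trunc (tree A c) α (state A c (α, n) k).node.1).pred
      (state A c (α, n) k).node.2 β) 0 ⟨k, hk⟩
  change β ≤ (state A c (α, n) l).node.1 at hl
  have h2 : (tree A c α).pred n β = (tree A c (state A c (α, n) l).node.1).pred
      (state A c (α, n) l).node.2 β := by
    conv_lhs => rw [tree_eq]
    rw [← trunc_of_lt (D := tree A c) (hv l).lt, ← he]
    exact if_pos h1
  have h3 := (extends_state_aux ih hα n (not_lt.1 fun h' => hl' k h' hk)).below
  rw [h2, ← (ih _ (hv k).lt).coherent _ _ _ hl h3.1, h3.2]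

/-- Promises are never dropped and stay single-valued, so the first promise made for `t` agrees with
any later one. -/
theorem val_eq_aux (ih : ∀ β < α, LevelProps A c β) (hα : α ≠ ⊥) {t : T} {n k : ℕ} {q : ℚ}
    (hk : (t, q) ∈ (state A c (α, n) k).promises) : (tree A c α).val t n = q := by
  classical
  obtain ⟨l, hl, he, hl'⟩ := firstOr_spec
    (p := fun k => ∃ q, (t, q) ∈ (stateAux A (trunc (tree A c) α) α
      (fun n k => c (α, n, k)) n k).promises)
    (fun k => if h : ∃ q, (t, q) ∈ (stateAux A (trunc (tree A c) α) α
      (fun n k => c (α, n, k)) n k).promises then h.choose else 0) 0 ⟨k, q, hk⟩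
  have h3 := (extends_state_aux ih hα n (not_lt.1 fun h' => hl' k h' ⟨q, hk⟩)).sub hl.choose_spec
  rw [dif_pos hl] at he
  rw [← (valid_state (A := A) (c := c) (x := (α, n)) hα k).func _ _ _ h3 hk, ← he]
  conv_lhs => rw [tree_eq]
  rfl

/-- Coherence and strict growth are read off a stage that has gone far enough: there the value at
the current node is below the promised one, which is final. The extension property holds because
every valid state is the initial state of infinitely many nodes, so the required bounds can be built
in as promises from the start. -/
theorem levelProps_aux (ih : ∀ β < α, LevelProps A c β) : LevelProps A c α where
  coherent n β γ h h' := by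
    rcases h'.eq_or_lt with rfl | h'
    · rw [pred_self]
    · obtain ⟨k, hk⟩ := exists_le_state_aux ih h' n
      rw [pred_eq_aux ih h' hk, pred_eq_aux ih (h.trans_lt h') (h.trans hk)]
      exact (ih _ (valid_state (x := (α, n)) (ne_bot_of_gt h') k).lt).coherent _ _ _ h hk
  pred_bot hα n := by
    rw [pred_eq_aux ih (k := 0) (bot_lt_iff_ne_bot.2 hα) bot_le]
    have hv := valid_state (A := A) (c := c) (x := (α, n)) hα 0
    by_cases h : (state A c (α, n) 0).node.1 = ⊥
    · have := pred_self (A := A) (c := c) (state A c (α, n) 0).node.1 (state A c (α, n) 0).node.2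
      rw [hv.bot h, h] at this
      rw [hv.bot h, h, this]
    · exact (ih _ hv.lt).pred_bot h _
  extension u g hu hu' hlv hg N := by
    classical
    -- Promises must lie strictly between the present values and the bounds; one `ε` serves all the
    -- finitely many `tq`.
    obtain ⟨ε, hε, h⟩ := exists_pos_add_lt g _ _ hg
    set σ : State T W := ⟨u, g.image fun tq => (tq.1, value A (tree A c) tq.1 u + ε)⟩ with hσ
    have hσlv : ∀ tq ∈ σ.promises, A.lv tq.1 = α := fun tq htq => by
      obtain ⟨s, hs, rfl⟩ := Finset.mem_image.1 htq
      exact hlv s hs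
    have hv : Valid A (tree A c) α σ := by
      refine ⟨hu, hu', hσlv, fun tq htq => ?_, fun t q q' h h' => ?_⟩
      · obtain ⟨s, hs, rfl⟩ := Finset.mem_image.1 htq
        exact lt_add_of_pos_right _ hε
      · obtain ⟨s, hs, h⟩ := Finset.mem_image.1 h
        obtain ⟨s', hs', h'⟩ := Finset.mem_image.1 h'
        rw [Prod.ext_iff] at h h'
        dsimp only at h h'
        rw [← h.2, ← h'.2, h.1, h'.1]
    obtain ⟨j, hj⟩ := exists_code_eq A hu hσlv
    have h0 : state A c (α, Nat.pair j N) 0 = σ := by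
      rw [state_zero, initState]
      simp only [Nat.unpair_pair, hj]
      rw [if_pos hv]
    -- The first component of the index selects the initial state, and the second only makes the
    -- index large.
    refine ⟨Nat.pair j N, Nat.right_le_pair _ _, ⟨hu.le, ?_⟩, fun tq htq => ?_⟩
    · rw [pred_eq_aux ih (k := 0) hu (by rw [h0]), h0]
      exact pred_self _ _
    · refine lt_of_eq_of_lt ?_ (h tq htq)
      rw [value, ← hlv tq htq, A.res_self, hlv tq htq]
      refine val_eq_aux ih (k := 0) (ne_bot_of_gt hu) ?_
      rw [h0]
      exact Finset.mem_image_of_mem (fun tq : T × ℚ => (tq.1, value A (tree A c) tq.1 u + ε)) htq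
  strict t n β ht hβ := by
    obtain ⟨k, hk, q, hq⟩ := exists_state_aux ih hβ ht n
    have hv := valid_state (A := A) (c := c) (x := (α, n)) (ne_bot_of_gt hβ) k
    have h1 : value A (tree A c) t (α, n) = q := by
      rw [value, ← ht, A.res_self, ht]
      exact val_eq_aux ih (ne_bot_of_gt hβ) hq
    rw [h1, pred_eq_aux ih hβ hk]
    refine lt_of_le_of_lt ?_ (hv.val _ hq)
    rcases hk.eq_or_lt with h | h
    · have := pred_self (A := A) (c := c) (state A c (α, n) k).node.1 (state A c (α, n) k).node.2
      rw [← h] at this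
      rw [← h, this]
      exact le_of_eq (congrArg _ (Prod.ext h rfl))
    · have hl : (state A c (α, n) k).node.1 ≤ A.lv t := by rw [ht]; exact hv.lt.le
      have := (ih _ hv.lt).strict (A.res t (state A c (α, n) k).node.1)
        (state A c (α, n) k).node.2 β (A.lv_res hl) h
      rw [value_res h.le hl, value_res le_rfl hl] at this
      exact this.le

variable (A c) in
theorem levelProps (α : W) : LevelProps A c α := by
  induction α using WellFoundedLT.induction with
  | ind α ih => exact levelProps_aux ih

end Tree

end GenericTree

namespace GenericTree

variable {T W : Type u} [LinearOrder W] [OrderBot W] [OmegaOne W] [PartialOrder T]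
  {A : LevelTree T W} {c c' : W × ℕ × ℕ → ℕ} {α : W}

/-! ### Basic properties -/

theorem Below.trans {x y z : W × ℕ} (h : Below (tree A c) x y) (h' : Below (tree A c) y z) :
    Below (tree A c) x z :=
  below_trans_aux (fun β _ => levelProps A c β) (exists_gt x.1).choose_spec h h'

theorem Below.of_le {x y z : W × ℕ} (h : Below (tree A c) x y) (h' : Below (tree A c) x z)
    (hl : z.1 ≤ y.1) : Below (tree A c) y z := by
  refine ⟨hl, ?_⟩
  have := (levelProps A c x.1).coherent x.2 y.1 z.1 hl h.1
  rwa [h.2, h'.2] at this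

theorem Below.eq_of_level_eq {x y z : W × ℕ} (h : Below (tree A c) x y)
    (h' : Below (tree A c) x z) (hl : z.1 = y.1) : y = z :=
  Prod.ext hl.symm (by rw [← h.2, ← h'.2, hl])

theorem Below.antisymm {x y : W × ℕ} (h : Below (tree A c) x y) (h' : Below (tree A c) y x) :
    x = y := Below.eq_of_level_eq (.refl x) h (le_antisymm h.1 h'.1)

theorem Below.lt_of_ne {x y : W × ℕ} (h : Below (tree A c) x y) (hne : x ≠ y) : y.1 < x.1 :=
  lt_of_le_of_ne h.1 fun h' => hne (Below.eq_of_level_eq (.refl x) h h')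

/-- The node of level `β` above `x`. -/
noncomputable def anc (A : LevelTree T W) (c : W × ℕ × ℕ → ℕ) (x : W × ℕ) (β : W) : W × ℕ :=
  (β, (tree A c x.1).pred x.2 β)

theorem below_anc {x : W × ℕ} {β : W} (h : β ≤ x.1) : Below (tree A c) x (anc A c x β) := ⟨h, rfl⟩

theorem Below.anc_eq {x y : W × ℕ} (h : Below (tree A c) x y) : anc A c x y.1 = y :=
  Prod.ext rfl h.2

theorem anc_bot {x : W × ℕ} (hx : x.1 = ⊥ → x.2 = 0) : anc A c x ⊥ = (⊥, 0) := by
  refine Prod.ext rfl ?_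
  by_cases h : x.1 = ⊥
  · obtain ⟨a, n⟩ := x
    dsimp only at h
    subst h
    simpa [anc, pred_self] using hx rfl
  · exact (levelProps A c x.1).pred_bot h _

theorem below_state {x : W × ℕ} (hx : x.1 ≠ ⊥) (k : ℕ) :
    Below (tree A c) x (state A c x k).node := by
  have hv := valid_state (A := A) (c := c) hx k
  refine ⟨hv.lt.le, ?_⟩
  have := pred_eq_aux (α := x.1) (n := x.2) (fun β _ => levelProps A c β) hv.lt le_rfl
  exact this.trans (pred_self _ _)

theorem value_eq {x : W × ℕ} (hx : x.1 ≠ ⊥) {k : ℕ} {t : T} {q : ℚ}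
    (h : (t, q) ∈ (state A c x k).promises) : value A (tree A c) t x = q := by
  have hv := valid_state (A := A) (c := c) hx k
  have h1 : A.lv t = x.1 := hv.lv _ h
  rw [value, ← h1, A.res_self, h1]
  exact val_eq_aux (fun β _ => levelProps A c β) hx h

/-- The request is granted because it is valid and extends the present state, and the bookkeeping of
the same step only adds to it. -/
theorem extends_state_succ {x : W × ℕ} {k : ℕ} {σ : State T W}
    (hσ : Valid A (tree A c) x.1 σ) (he : Extends (tree A c) σ (state A c x k))
    (hc : code A x.1 (c (x.1, x.2, k)) = σ) :
    Extends (tree A c) (state A c x (k + 1)) σ := by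
  have := extends_state_succ_request (A := A) (c := c) (x := x) k
  rwa [request, hc, if_pos ⟨hσ, he⟩] at this

theorem Below.value_lt {x y : W × ℕ} (h : Below (tree A c) x y) (hl : y.1 < x.1) {t : T}
    (ht : x.1 ≤ A.lv t) : value A (tree A c) t y < value A (tree A c) t x := by
  have := (levelProps A c x.1).strict (A.res t x.1) x.2 y.1 (A.lv_res ht) hl
  rw [h.2, value_res hl.le ht, value_res le_rfl ht] at this
  exact this

variable (A) in
/-- There are infinitely many nodes on each level which are below `x` for every `c`. -/
theorem exists_child (x : W × ℕ) (hx : x.1 = ⊥ → x.2 = 0) {β : W} (h : x.1 < β) (N : ℕ) :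
    ∃ m ≥ N, ∀ c, Below (tree A c) (β, m) x := by
  -- A state without promises is valid for every `c`, so the node starting in it is below `x`
  -- irrespective of `c`.
  obtain ⟨j, hj⟩ := exists_code_eq A (σ := ⟨x, ∅⟩) h (by simp)
  refine ⟨Nat.pair j N, Nat.right_le_pair _ _, fun c => ?_⟩
  have hv : Valid A (tree A c) β ⟨x, ∅⟩ := ⟨h, hx, by simp, by simp, by simp⟩
  have h0 : state A c (β, Nat.pair j N) 0 = ⟨x, ∅⟩ := by
    rw [state_zero, initState, if_pos] <;> simp only [Nat.unpair_pair, hj]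
    exact hv
  have := below_state (A := A) (c := c) (x := (β, Nat.pair j N)) (ne_bot_of_gt h) 0
  rwa [h0] at this

/-! ### Dependence on `c` -/

theorem tree_congr (h : ∀ i : W × ℕ × ℕ, i.1 ≤ α → c i = c' i) : tree A c α = tree A c' α := by
  induction α using WellFoundedLT.induction with
  | ind α ih =>
    rw [tree_eq, tree_eq A c']
    have h1 : trunc (tree A c) α = trunc (tree A c') α := by
      funext β
      by_cases hβ : β < α
      · rw [trunc_of_lt hβ, trunc_of_lt hβ]
        exact ih β hβ fun i hi => h i (hi.trans hβ.le)
      · simp [trunc, hβ]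
    have h2 : (fun n k => c (α, n, k)) = fun n k => c' (α, n, k) := by
      funext n k
      exact h _ le_rfl
    rw [h1, h2]

theorem stateAux_congr {D : W → LevelData T W} {r r' : ℕ → ℕ → ℕ} {n k : ℕ}
    (h : ∀ j < k, r n j = r' n j) : stateAux A D α r n k = stateAux A D α r' n k := by
  induction k with
  | zero => rfl
  | succ k ih =>
    rw [stateAux, stateAux, ih fun j hj => h j (hj.trans (Nat.lt_succ_self _)),
      h k (Nat.lt_succ_self _)]

theorem state_congr {x : W × ℕ} {k : ℕ} (h : ∀ i : W × ℕ × ℕ, i.1 < x.1 → c i = c' i)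
    (h' : ∀ j < k, c (x.1, x.2, j) = c' (x.1, x.2, j)) : state A c x k = state A c' x k := by
  have h1 : trunc (tree A c) x.1 = trunc (tree A c') x.1 := by
    funext β
    by_cases hβ : β < x.1
    · rw [trunc_of_lt hβ, trunc_of_lt hβ]
      exact tree_congr fun i hi => h i (hi.trans_lt hβ)
    · simp [trunc, hβ]
  rw [state, state, h1]
  exact stateAux_congr h'

theorem below_congr {x y : W × ℕ} (h : ∀ i : W × ℕ × ℕ, i.1 ≤ x.1 → c i = c' i) :
    Below (tree A c) x y ↔ Below (tree A c') x y := by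
  rw [Below, Below, tree_congr h]

theorem value_congr {t : T} {x : W × ℕ} (h : ∀ i : W × ℕ × ℕ, i.1 ≤ x.1 → c i = c' i) :
    value A (tree A c) t x = value A (tree A c') t x := by
  rw [value, value, tree_congr h]

/-- The functions agreeing with `c` on sufficiently large finite subsets of `Z`. -/
def near {I : Type*} (c : I → ℕ) (Z : Set I) : Filter (I → ℕ) where
  sets := {B | ∃ e : Finset I, ↑e ⊆ Z ∧ ∀ c', (∀ i ∈ e, c' i = c i) → c' ∈ B}
  univ_sets := ⟨∅, by simp, fun _ _ => mem_univ _⟩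
  sets_of_superset := by
    rintro B B' ⟨e, he, h⟩ h'
    exact ⟨e, he, fun c₁ hc => h' (h c₁ hc)⟩
  inter_sets := by
    classical
    rintro B B' ⟨e, he, h⟩ ⟨e', he', h'⟩
    exact ⟨e ∪ e', by simp [he, he'], fun c₁ hc =>
      ⟨h c₁ fun i hi => hc i (Finset.mem_union_left _ hi),
        h' c₁ fun i hi => hc i (Finset.mem_union_right _ hi)⟩⟩

theorem eventually_near {I : Type*} {c : I → ℕ} {Z : Set I} {p : (I → ℕ) → Prop} :
    (∀ᶠ c' in near c Z, p c') ↔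
      ∃ e : Finset I, ↑e ⊆ Z ∧ ∀ c', (∀ i ∈ e, c' i = c i) → p c' := Iff.rfl

theorem near_mono {I : Type*} (c : I → ℕ) {Z Z' : Set I} (h : Z ⊆ Z') : near c Z' ≤ near c Z :=
  fun _ ⟨e, he, h'⟩ => ⟨e, he.trans h, h'⟩

theorem eventually_near_eq {I : Type*} (c : I → ℕ) {Z : Set I} {i : I} (hi : i ∈ Z) :
    ∀ᶠ c' in near c Z, c' i = c i :=
  eventually_near.2 ⟨{i}, by simpa using hi, fun c' h => h i (Finset.mem_singleton_self i)⟩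

/-- The `c`-coordinates of level below `α`. -/
abbrev lower (α : W) : Set (W × ℕ × ℕ) := {i | i.1 < α}

/-- The `c`-coordinates determining the first `k` steps of the construction of `x`. -/
abbrev rowBelow (x : W × ℕ) (k : ℕ) : Set (W × ℕ × ℕ) :=
  lower x.1 ∪ {i | i.1 = x.1 ∧ i.2.1 = x.2 ∧ i.2.2 < k}

variable (A c) in
/-- The level `α` depends continuously on `c`. -/
structure LevelCont (α : W) : Prop where
  pred : ∀ n β, ∀ᶠ c' in near c {i | i.1 ≤ α}, (tree A c' α).pred n β = (tree A c α).pred n β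
  val : ∀ t n, A.lv t = α →
    ∀ᶠ c' in near c {i | i.1 ≤ α}, (tree A c' α).val t n = (tree A c α).val t n

/-- Apart from conditions not involving `c`, validity compares finitely many values at one node of
lower level. -/
theorem eventually_valid_aux (ih : ∀ β < α, LevelCont A c β) (σ : State T W) :
    ∀ᶠ c' in near c (lower α), Valid A (tree A c') α σ ↔ Valid A (tree A c) α σ := by
  by_cases h1 : σ.node.1 < α
  · by_cases h2 : ∀ tq ∈ σ.promises, A.lv tq.1 = α
    · have h : ∀ᶠ c' in near c (lower α), ∀ tq ∈ σ.promises,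
          value A (tree A c') tq.1 σ.node = value A (tree A c) tq.1 σ.node := by
        rw [eventually_all_finset]
        intro tq htq
        refine ((ih _ h1).val (A.res tq.1 σ.node.1) σ.node.2 (A.lv_res ?_)).filter_mono
          (near_mono c fun i hi => lt_of_le_of_lt hi h1)
        rw [h2 tq htq]
        exact h1.le
      refine h.mono fun c' hc' => ?_
      exact ⟨fun h => ⟨h.1, h.2, h.3, fun tq htq => hc' tq htq ▸ h.4 tq htq, h.5⟩,
        fun h => ⟨h.1, h.2, h.3, fun tq htq => (hc' tq htq).symm ▸ h.4 tq htq, h.5⟩⟩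
    · exact Eventually.of_forall fun c' => ⟨fun h => absurd h.lv h2, fun h => absurd h.lv h2⟩
  · exact Eventually.of_forall fun c' => ⟨fun h => absurd h.lt h1, fun h => absurd h.lt h1⟩

theorem eventually_extends_aux (ih : ∀ β < α, LevelCont A c β) (σ' σ : State T W)
    (h : σ'.node.1 < α) :
    ∀ᶠ c' in near c (lower α), Extends (tree A c') σ' σ ↔ Extends (tree A c) σ' σ := by
  refine (((ih _ h).pred σ'.node.2 σ.node.1).filter_mono
    (near_mono c fun i hi => lt_of_le_of_lt hi h)).mono fun c' hc' => ?_
  exact ⟨fun h => ⟨⟨h.1.1, hc' ▸ h.1.2⟩, h.2⟩, fun h => ⟨⟨h.1.1, hc'.symm ▸ h.1.2⟩, h.2⟩⟩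

theorem eventually_valid_and_extends_aux (ih : ∀ β < α, LevelCont A c β) (σ' σ : State T W) :
    ∀ᶠ c' in near c (lower α), (Valid A (tree A c') α σ' ∧ Extends (tree A c') σ' σ ↔
      Valid A (tree A c) α σ' ∧ Extends (tree A c) σ' σ) := by
  by_cases h : σ'.node.1 < α
  · filter_upwards [eventually_valid_aux ih σ', eventually_extends_aux ih σ' σ h] with c' h1 h2
    rw [h1, h2]
  · exact Eventually.of_forall fun c' => ⟨fun h' => absurd h'.1.lt h, fun h' => absurd h'.1.lt h⟩

theorem fulfils_iff {D : W → LevelData T W} {k : ℕ} {σ : State T W} {j : ℕ} :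
    Fulfils A D α k σ j ↔ (Valid A D α (code A α j) ∧ Extends D (code A α j) σ) ∧
      (task A α k).1 ≤ (code A α j).node.1 ∧ ∃ q, ((task A α k).2, q) ∈ (code A α j).promises :=
  ⟨fun h => ⟨⟨h.1, h.2⟩, h.3, h.4⟩, fun h => ⟨h.1.1, h.1.2, h.2.1, h.2.2⟩⟩

/-- Each step consults one entry of the node's own row and finitely many facts about lower levels:
the bookkeeping search inspects codes only up to its first solution, if there is one. -/
theorem eventually_state_aux (n k : ℕ) (ih : ∀ β < α, LevelCont A c β) :
    ∀ᶠ c' in near c (rowBelow (α, n) k), state A c' (α, n) k = state A c (α, n) k := by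
  have hlow : ∀ k, near c (rowBelow (α, n) k) ≤ near c (lower α) := fun k =>
    near_mono c subset_union_left
  induction k with
  | zero =>
    refine ((eventually_valid_aux ih (code A α n.unpair.1)).filter_mono (hlow 0)).mono
      fun c' hc' => ?_
    rw [state_zero, state_zero, initState, initState]
    by_cases h : Valid A (tree A c) α (code A α n.unpair.1)
    · rw [if_pos h, if_pos (hc'.2 h)]
    · rw [if_neg h, if_neg (mt hc'.1 h)]
  | succ k ihk =>
    have hk : ∀ᶠ c' in near c (rowBelow (α, n) (k + 1)),
        state A c' (α, n) k = state A c (α, n) k := by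
      refine ihk.filter_mono (near_mono c (union_subset_union_right _ ?_))
      exact fun i hi => ⟨hi.1, hi.2.1, hi.2.2.trans (Nat.lt_succ_self _)⟩
    have hc : ∀ᶠ c' in near c (rowBelow (α, n) (k + 1)), c' (α, n, k) = c (α, n, k) :=
      eventually_near_eq c (.inr ⟨rfl, rfl, Nat.lt_succ_self _⟩)
    set j := c (α, n, k)
    set σ := state A c (α, n) k
    have hr : ∀ᶠ c' in near c (rowBelow (α, n) (k + 1)),
        request A (tree A c') α j σ = request A (tree A c) α j σ := by
      refine ((eventually_valid_and_extends_aux ih (code A α j) σ).filter_mono (hlow _)).mono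
        fun c' hc' => ?_
      rw [request, request]
      by_cases h : Valid A (tree A c) α (code A α j) ∧ Extends (tree A c) (code A α j) σ
      · rw [if_pos h, if_pos (hc'.2 h)]
      · rw [if_neg h, if_neg (mt hc'.1 h)]
    set σ' := request A (tree A c) α j σ
    have hb : ∀ᶠ c' in near c (rowBelow (α, n) (k + 1)),
        bookkeep A (tree A c') α k σ' = bookkeep A (tree A c) α k σ' := by
      by_cases hf : ∃ l, Fulfils A (tree A c) α k σ' l
      · obtain ⟨l, hl⟩ := hf
        have : ∀ᶠ c' in near c (rowBelow (α, n) (k + 1)), ∀ i ∈ Finset.range (l + 1),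
            (Fulfils A (tree A c') α k σ' i ↔ Fulfils A (tree A c) α k σ' i) := by
          rw [eventually_all_finset]
          intro i _
          refine ((eventually_valid_and_extends_aux ih (code A α i) σ').filter_mono
            (hlow _)).mono fun c' hc' => ?_
          rw [fulfils_iff, fulfils_iff, hc']
        refine this.mono fun c' hc' => (firstOr_congr hl fun i hi => ⟨?_, rfl⟩).symm
        exact (hc' i (Finset.mem_range.2 (Nat.lt_succ_of_le hi))).symm
      -- Solvability of a task does not depend on `c`: a solution for `c'` shows that the task names
      -- a level below `α` and a node of `T` of level `α`, and every such task is solvable for `c`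
      -- too.
      · have hno : ∀ c', ¬ ∃ l, Fulfils A (tree A c') α k σ' l := by
          rintro c' ⟨l, hl⟩
          refine hf (exists_fulfils_aux (fun β _ => levelProps A c β) (hl.le.trans_lt hl.valid.lt)
            ?_ ?_)
          · obtain ⟨q, hq⟩ := hl.mem
            exact hl.valid.lv _ hq
          · have hα : α ≠ ⊥ := ne_bot_of_gt hl.valid.lt
            exact valid_request (valid_state (x := (α, n)) hα k)
        refine Eventually.of_forall fun c' => ?_
        rw [bookkeep, bookkeep, firstOr_of_not _ _ (hno c'), firstOr_of_not _ _ (hno c)]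
    filter_upwards [hk, hc, hr, hb] with c' h1 h2 h3 h4
    rw [state_succ, state_succ, h1, h2, h3, h4]

/-- Every predecessor and every value is settled at some finite stage, and finite stages are
continuous. -/
theorem levelCont_aux (ih : ∀ β < α, LevelCont A c β) : LevelCont A c α where
  pred n β := by
    by_cases h : β < α
    · obtain ⟨k, hk⟩ := exists_le_state_aux (A := A) (c := c) (fun β _ => levelProps A c β) h n
      have hα := ne_bot_of_gt h
      have hv := valid_state (A := A) (c := c) (x := (α, n)) hα k
      have h1 : ∀ᶠ c' in near c {i | i.1 ≤ α}, state A c' (α, n) k = state A c (α, n) k := by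
        refine (eventually_state_aux n k ih).filter_mono (near_mono c ?_)
        rintro i (hi | hi)
        · exact hi.le
        · exact hi.1.le
      have h2 := ((ih _ hv.lt).pred (state A c (α, n) k).node.2 β).filter_mono
        (near_mono c (Z' := {i | i.1 ≤ α}) fun i hi => le_trans hi hv.lt.le)
      filter_upwards [h1, h2] with c' h1 h2
      rw [pred_eq_aux (c := c') (fun β _ => levelProps A c' β) h (by rw [h1]; exact hk),
        pred_eq_aux (c := c) (fun β _ => levelProps A c β) h hk, h1, h2]
    · refine Eventually.of_forall fun c' => ?_
      rw [tree_eq, tree_eq A c]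
      simp [levelAux, h]
  val t n ht := by
    by_cases hα : α = ⊥
    -- There are no valid states at the bottom level, so nothing is promised and all values there
    -- are the default `0`.
    · have hno : ∀ c' k, ¬ ∃ q, (t, q) ∈ (stateAux A (trunc (tree A c') α) α
          (fun n k => c' (α, n, k)) n k).promises := by
        intro c' k
        have : state A c' (α, n) k = rootState := by
          have hno : ∀ σ, ¬ Valid A (tree A c') α σ := fun σ h => not_lt_bot (hα ▸ h.lt)
          induction k with
          | zero => rw [state_zero, initState, if_neg (hno _)]
          | succ k ih =>
            rw [state_succ, bookkeep, firstOr_of_not _ _ fun ⟨l, hl⟩ => hno _ hl.valid, request,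
              if_neg fun h => hno _ h.1, ih]
        rintro ⟨q, hq⟩
        change (t, q) ∈ (state A c' (α, n) k).promises at hq
        rw [this] at hq
        simp [rootState] at hq
      refine Eventually.of_forall fun c' => ?_
      rw [tree_eq, tree_eq A c, levelAux, levelAux]
      dsimp only
      rw [firstOr_of_not _ _ fun ⟨k, hk⟩ => hno c' k hk,
        firstOr_of_not _ _ fun ⟨k, hk⟩ => hno c k hk]
    · obtain ⟨k, -, q, hq⟩ := exists_state_aux (A := A) (c := c) (fun β _ => levelProps A c β)
        (bot_lt_iff_ne_bot.2 hα) ht n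
      have h1 : ∀ᶠ c' in near c {i | i.1 ≤ α}, state A c' (α, n) k = state A c (α, n) k := by
        refine (eventually_state_aux n k ih).filter_mono (near_mono c ?_)
        rintro i (hi | hi)
        · exact hi.le
        · exact hi.1.le
      refine h1.mono fun c' h1 => ?_
      rw [val_eq_aux (c := c') (fun β _ => levelProps A c' β) hα (h1.symm ▸ hq),
        val_eq_aux (c := c) (fun β _ => levelProps A c β) hα hq]

variable (A c) in
theorem levelCont (α : W) : LevelCont A c α := by
  induction α using WellFoundedLT.induction with
  | ind α ih => exact levelCont_aux ih

variable (A c) in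
theorem eventually_state (x : W × ℕ) (k : ℕ) :
    ∀ᶠ c' in near c (rowBelow x k), state A c' x k = state A c x k :=
  eventually_state_aux x.2 k fun β _ => levelCont A c β

variable (A c) in
theorem eventually_anc (x : W × ℕ) (β : W) :
    ∀ᶠ c' in near c univ, anc A c' x β = anc A c x β :=
  (((levelCont A c x.1).pred x.2 β).filter_mono (near_mono c (subset_univ _))).mono
    fun _ h => Prod.ext rfl h

variable (A c) in
theorem eventually_value {t : T} {x : W × ℕ} (h : x.1 ≤ A.lv t) :
    ∀ᶠ c' in near c univ, value A (tree A c') t x = value A (tree A c) t x :=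
  ((levelCont A c x.1).val _ _ (A.lv_res h)).filter_mono (near_mono c (subset_univ _))

theorem below_iff_anc {x y : W × ℕ} (h : y.1 ≤ x.1) :
    Below (tree A c) x y ↔ anc A c x y.1 = y :=
  ⟨Below.anc_eq, fun h' => ⟨h, (Prod.ext_iff.1 h').2⟩⟩

end GenericTree

namespace GenericTree

variable {T W : Type u} [LinearOrder W] [OrderBot W] [OmegaOne W] [PartialOrder T]
  {A : LevelTree T W} {c c' : W × ℕ × ℕ → ℕ} {α : W}

/-! ### Closed finite systems -/

/-- The coordinates used in the first `K x` steps of the construction of the nodes `x ∈ M`. -/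
def support (M : Finset (W × ℕ)) (K : W × ℕ → ℕ) : Set (W × ℕ × ℕ) :=
  {i | (i.1, i.2.1) ∈ M ∧ i.2.2 < K (i.1, i.2.1)}

variable (A c) in
/-- The first `K x` steps of the construction of the nodes `x ∈ M` do not depend on coordinates
used otherwise. -/
structure IsClosedSystem (M : Finset (W × ℕ)) (K : W × ℕ → ℕ) : Prop where
  state_eq : ∀ x ∈ M, ∀ c', EqOn c' c (support M K) → state A c' x (K x) = state A c x (K x)
  node_mem : ∀ x ∈ M, x.1 ≠ ⊥ → (state A c x (K x)).node ∈ M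

/-- Closure proceeds from the highest level downwards. The chosen steps of the nodes on that level
depend on finitely many coordinates, which lie in the node's own row before the chosen step or at
lower levels. The lower ones, and the nodes reached, are added to the task for smaller levels. Step
counts are increased only below the highest level, so the process is a well-founded induction. -/
theorem exists_isClosedSystem_aux (α : W) : ∀ (M₀ : Finset (W × ℕ)) (K₀ : W × ℕ → ℕ),
    (∀ x ∈ M₀, x.1 < α) → ∃ M K, M₀ ⊆ M ∧ (∀ x ∈ M, x.1 < α) ∧ (∀ x ∈ M₀, K₀ x ≤ K x) ∧
      IsClosedSystem A c M K := by
  classical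
  choose e he1 he2 using fun x k => eventually_near.1 (eventually_state A c x k)
  induction α using WellFoundedLT.induction with
  | ind α ih =>
    intro M₀ K₀ hM₀
    rcases M₀.eq_empty_or_nonempty with rfl | hne
    · exact ⟨∅, K₀, by simp, by simp, by simp, by simp, by simp⟩
    obtain ⟨x₀, hx₀, hmax⟩ := M₀.exists_max_image Prod.fst hne
    set α₁ := x₀.1 with hα₁
    set M₁ := M₀.filter fun x => x.1 = α₁ with hM₁
    set E := M₁.biUnion fun x => e x (K₀ x) with hE
    set M₂ := (M₀.filter fun x => x.1 < α₁) ∪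
      ((E.filter fun i => i.1 < α₁).image fun i => (i.1, i.2.1)) ∪
      ((M₁.filter fun x => x.1 ≠ ⊥).image fun x => (state A c x (K₀ x)).node) with hM₂
    obtain ⟨M', K', h1, h2, h3, h4⟩ := ih α₁ (hM₀ _ hx₀) M₂
      -- The `+ 1` makes the new step counts exceed the step number of every coordinate in `E`,
      -- which puts the lower ones into the support.
      (fun x => K₀ x + E.sup fun i => i.2.2 + 1) (by
        intro x hx
        rw [hM₂, Finset.mem_union, Finset.mem_union] at hx
        rcases hx with (hx | hx) | hx
        · exact (Finset.mem_filter.1 hx).2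
        · obtain ⟨i, hi, rfl⟩ := Finset.mem_image.1 hx
          exact (Finset.mem_filter.1 hi).2
        · obtain ⟨y, hy, rfl⟩ := Finset.mem_image.1 hx
          have hy' := Finset.mem_filter.1 hy
          have := (valid_state (A := A) (c := c) hy'.2 (K₀ y)).lt
          rwa [(Finset.mem_filter.1 hy'.1).2] at this)
    have hM' : ∀ x ∈ M', x.1 ≠ α₁ := fun x hx => (h2 x hx).ne
    set K : W × ℕ → ℕ := fun x => if x.1 = α₁ then K₀ x else K' x with hK
    have hK1 : ∀ x ∈ M₁, K x = K₀ x := fun x hx => if_pos (Finset.mem_filter.1 hx).2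
    have hK2 : ∀ x ∈ M', K x = K' x := fun x hx => if_neg (hM' x hx)
    have hsub : support M' K' ⊆ support (M' ∪ M₁) K := fun i hi =>
      ⟨Finset.mem_union_left _ hi.1, by rw [hK2 _ hi.1]; exact hi.2⟩
    refine ⟨M' ∪ M₁, K, ?_, ?_, ?_, ?_, ?_⟩
    · intro x hx
      rcases (hmax x hx).eq_or_lt with h | h
      · exact Finset.mem_union_right _ (Finset.mem_filter.2 ⟨hx, h⟩)
      · exact Finset.mem_union_left _ (h1 (Finset.mem_union_left _ (Finset.mem_union_left _
          (Finset.mem_filter.2 ⟨hx, h⟩))))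
    · intro x hx
      rcases Finset.mem_union.1 hx with hx | hx
      · exact (h2 x hx).trans (hM₀ _ hx₀)
      · exact hM₀ _ (Finset.mem_filter.1 hx).1
    · intro x hx
      rcases (hmax x hx).eq_or_lt with h | h
      · exact (hK1 x (Finset.mem_filter.2 ⟨hx, h⟩)).ge
      · have hx2 : x ∈ M₂ := Finset.mem_union_left _ (Finset.mem_union_left _
          (Finset.mem_filter.2 ⟨hx, h⟩))
        rw [hK2 x (h1 hx2)]
        exact (Nat.le_add_right _ _).trans (h3 x hx2)
    · intro x hx c' hc'
      rcases Finset.mem_union.1 hx with hx | hx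
      · rw [hK2 x hx]
        exact h4.state_eq x hx c' (hc'.mono hsub)
      · rw [hK1 x hx]
        refine he2 x (K₀ x) c' fun i hi => hc' ?_
        rcases he1 x (K₀ x) hi with hi' | hi'
        · have hlt : i.1 < α₁ := (Finset.mem_filter.1 hx).2 ▸ hi'
          have hiE : i ∈ E := Finset.mem_biUnion.2 ⟨x, hx, hi⟩
          have hi2 : (i.1, i.2.1) ∈ M₂ := Finset.mem_union_left _ (Finset.mem_union_right _
            (Finset.mem_image_of_mem (fun i : W × ℕ × ℕ => (i.1, i.2.1))
              (Finset.mem_filter.2 ⟨hiE, hlt⟩)))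
          refine hsub ⟨h1 hi2, ?_⟩
          have := Finset.le_sup (f := fun i : W × ℕ × ℕ => i.2.2 + 1) hiE
          have h6 := h3 _ hi2
          exact (Nat.lt_succ_self _).trans_le ((this.trans (Nat.le_add_left _ _)).trans h6)
        · have : (i.1, i.2.1) = x := Prod.ext hi'.1 hi'.2.1
          refine ⟨?_, ?_⟩
          · rw [this]
            exact Finset.mem_union_right _ hx
          · rw [this, hK1 x hx]
            exact hi'.2.2
    · intro x hx hb
      rcases Finset.mem_union.1 hx with hx | hx
      · rw [hK2 x hx]
        exact Finset.mem_union_left _ (h4.node_mem x hx hb)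
      · rw [hK1 x hx]
        exact Finset.mem_union_left _ (h1 (Finset.mem_union_right _
          (Finset.mem_image_of_mem (fun x => (state A c x (K₀ x)).node)
            (Finset.mem_filter.2 ⟨hx, hb⟩))))

variable (A c) in
theorem exists_isClosedSystem (e : Finset (W × ℕ × ℕ)) (M₀ : Finset (W × ℕ)) :
    ∃ M K, M₀ ⊆ M ∧ ↑e ⊆ support M K ∧ IsClosedSystem A c M K := by
  classical
  set M₁ := M₀ ∪ e.image fun i => (i.1, i.2.1)
  obtain ⟨b, hb⟩ := OmegaOne.exists_bound (M₁.finite_toSet.image Prod.fst).countable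
  obtain ⟨M, K, h1, -, h3, h4⟩ := exists_isClosedSystem_aux (A := A) (c := c) b M₁
    (fun _ => e.sup fun i => i.2.2 + 1) fun x hx => hb _ ⟨x, hx, rfl⟩
  refine ⟨M, K, Finset.subset_union_left.trans h1, fun i hi => ?_, h4⟩
  have hi' : (i.1, i.2.1) ∈ M₁ := Finset.mem_union_right _
    (Finset.mem_image_of_mem (fun i : W × ℕ × ℕ => (i.1, i.2.1)) hi)
  refine ⟨h1 hi', ?_⟩
  have h5 := Finset.le_sup (f := fun i : W × ℕ × ℕ => i.2.2 + 1) hi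
  have h6 := h3 _ hi'
  exact (Nat.lt_succ_self _).trans_le (h5.trans h6)

/-- Follow `f` upwards to the first node of level below `δ`. -/
noncomputable def rootOf {W : Type u} [LinearOrder W] [WellFoundedLT W] (f : W × ℕ → W × ℕ) (δ : W) (x : W × ℕ) : W × ℕ :=
  open Classical in
  if _h : δ ≤ x.1 ∧ (f x).1 < x.1 then rootOf f δ (f x) else x
termination_by (wellFounded_lt (α := W)).wrap x.1
decreasing_by exact _h.2

theorem rootOf_of_le {f : W × ℕ → W × ℕ} {δ : W} {x : W × ℕ} (h : δ ≤ x.1) (h' : (f x).1 < x.1) :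
    rootOf f δ x = rootOf f δ (f x) := by
  rw [rootOf, dif_pos ⟨h, h'⟩]

theorem rootOf_of_lt {f : W × ℕ → W × ℕ} {δ : W} {x : W × ℕ} (h : x.1 < δ) : rootOf f δ x = x := by
  rw [rootOf, dif_neg fun h' => h.not_ge h'.1]

/-! ### Chains of upper nodes inside a closed system -/

section Closed
variable {M : Finset (W × ℕ)} {K : W × ℕ → ℕ} {δ : W}

variable (A c) in
/-- The node above `x` after `K x` steps. -/
noncomputable abbrev upper (K : W × ℕ → ℕ) (x : W × ℕ) : W × ℕ := (state A c x (K x)).node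

theorem upper_lt {x : W × ℕ} (hx : x.1 ≠ ⊥) : (upper A c K x).1 < x.1 := (valid_state hx _).lt

theorem IsClosedSystem.below_upper (hM : IsClosedSystem A c M K) {x : W × ℕ} (hx : x ∈ M)
    (hb : x.1 ≠ ⊥) (hc : EqOn c' c (support M K)) : Below (tree A c') x (upper A c K x) := by
  rw [upper, ← hM.state_eq x hx c' hc]
  exact below_state hb _

/-- Induction along the nodes of a closed system of level at least `δ`. -/
theorem IsClosedSystem.induction (hM : IsClosedSystem A c M K) (hδ : ⊥ < δ) {p : W × ℕ → Prop}
    (h : ∀ x ∈ M, δ ≤ x.1 → (δ ≤ (upper A c K x).1 → p (upper A c K x)) → p x) :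
    ∀ x ∈ M, δ ≤ x.1 → p x := by
  have : ∀ β, ∀ x ∈ M, x.1 = β → δ ≤ x.1 → p x := by
    intro β
    induction β using WellFoundedLT.induction with
    | ind β ih =>
      rintro x hx rfl hl
      have hb : x.1 ≠ ⊥ := (hδ.trans_le hl).ne'
      exact h x hx hl fun hu => ih _ (upper_lt hb) _ (hM.node_mem x hx hb) rfl hu
  exact fun x hx => this _ x hx rfl

theorem IsClosedSystem.rootOf_eq (hδ : ⊥ < δ) {x : W × ℕ} (hl : δ ≤ x.1) :
    rootOf (upper A c K) δ x = rootOf (upper A c K) δ (upper A c K x) :=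
  rootOf_of_le hl (upper_lt (hδ.trans_le hl).ne')

/-- Each link of the chain of upper nodes is decided by the support of the system, so the chain
persists for every `c'` agreeing with `c` there. -/
theorem IsClosedSystem.below_rootOf (hM : IsClosedSystem A c M K) (hδ : ⊥ < δ) {x : W × ℕ}
    (hx : x ∈ M) (hl : δ ≤ x.1) : (rootOf (upper A c K) δ x).1 < δ ∧
      ∀ c', EqOn c' c (support M K) → Below (tree A c') x (rootOf (upper A c K) δ x) := by
  refine hM.induction hδ (p := fun x => (rootOf (upper A c K) δ x).1 < δ ∧
      ∀ c', EqOn c' c (support M K) → Below (tree A c') x (rootOf (upper A c K) δ x)) ?_ x hx hl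
  intro x hx hl ih
  have hb : x.1 ≠ ⊥ := (hδ.trans_le hl).ne'
  rw [IsClosedSystem.rootOf_eq hδ hl]
  rcases lt_or_ge (upper A c K x).1 δ with h | h
  · rw [rootOf_of_lt h]
    exact ⟨h, fun c' hc' => hM.below_upper hx hb hc'⟩
  · exact ⟨(ih h).1, fun c' hc' => (hM.below_upper hx hb hc').trans ((ih h).2 c' hc')⟩

/-- The node `b` is the place at which the chain leaves the levels from `δ` on. Its next step is the
one redirected in the amalgamation, and `x` follows because it is below `b`. -/
theorem IsClosedSystem.exists_last (hM : IsClosedSystem A c M K) (hδ : ⊥ < δ) {x : W × ℕ}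
    (hx : x ∈ M) (hl : δ ≤ x.1) : ∃ b ∈ M, δ ≤ b.1 ∧
      upper A c K b = rootOf (upper A c K) δ x ∧
      ∀ c', EqOn c' c (support M K) → Below (tree A c') x b := by
  refine hM.induction hδ (p := fun x => ∃ b ∈ M, δ ≤ b.1 ∧
      upper A c K b = rootOf (upper A c K) δ x ∧
      ∀ c', EqOn c' c (support M K) → Below (tree A c') x b) ?_ x hx hl
  intro x hx hl ih
  have hb : x.1 ≠ ⊥ := (hδ.trans_le hl).ne'
  rw [IsClosedSystem.rootOf_eq hδ hl]
  rcases lt_or_ge (upper A c K x).1 δ with h | h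
  · rw [rootOf_of_lt h]
    exact ⟨x, hx, hl, rfl, fun c' _ => .refl x⟩
  · obtain ⟨b, h1, h2, h3, h4⟩ := ih h
    exact ⟨b, h1, h2, h3, fun c' hc' => (hM.below_upper hx hb hc').trans (h4 c' hc')⟩

end Closed

/-- An increasing function on the levels of a finite set of nodes with values in `(0, 1)`. -/
theorem exists_rank (M : Finset (W × ℕ)) : ∃ θ : W → ℚ, (∀ x ∈ M, 0 < θ x.1 ∧ θ x.1 < 1) ∧
    ∀ x ∈ M, ∀ y ∈ M, x.1 < y.1 → θ x.1 < θ y.1 := by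
  classical
  set L := M.image Prod.fst
  have hpos : (0 : ℚ) < L.card + 1 := by positivity
  -- The share of the occurring levels that are at most `α`; enlarging the denominator by one keeps
  -- it below `1`.
  refine ⟨fun α => ((L.filter fun β => β ≤ α).card : ℚ) / (L.card + 1), fun x hx => ⟨?_, ?_⟩,
    fun x hx y hy h => ?_⟩
  · refine div_pos ?_ hpos
    have : 0 < (L.filter fun β => β ≤ x.1).card := Finset.card_pos.2 ⟨x.1, Finset.mem_filter.2
      ⟨Finset.mem_image_of_mem _ hx, le_rfl⟩⟩
    exact_mod_cast this
  · rw [div_lt_one hpos]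
    exact_mod_cast Nat.lt_succ_of_le (Finset.card_le_card (Finset.filter_subset _ _))
  · refine div_lt_div_of_pos_right ?_ hpos
    have : (L.filter fun β => β ≤ x.1) ⊂ L.filter fun β => β ≤ y.1 := by
      refine ⟨fun z hz => ?_, fun hsub => ?_⟩
      · rw [Finset.mem_filter] at hz ⊢
        exact ⟨hz.1, hz.2.trans h.le⟩
      · have := hsub (Finset.mem_filter.2 ⟨Finset.mem_image_of_mem _ hy, le_rfl⟩)
        exact h.not_ge (Finset.mem_filter.1 this).2
    exact_mod_cast Finset.card_lt_card this

/-! ### Controlling values and amalgamating two closed systems -/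

section Steering
variable {M M' : Finset (W × ℕ)} {K K' : W × ℕ → ℕ} {δ δ' : W}

/-- Outside of the coordinates used by a closed system, `c` can be modified such that the values
at the nodes of level at least `δ` and finitely many nodes of `T` are small. -/
theorem exists_small_values (hM : IsClosedSystem A c M K) (hδ : ⊥ < δ)
    (hMl : ∀ x ∈ M, x.1 < δ') (Θ : Finset T) (hΘ : ∀ t ∈ Θ, δ' ≤ A.lv t)
    (hinc : ∀ t ∈ Θ, ∀ x ∈ M, δ ≤ x.1 → ∀ tq ∈ (state A c x (K x)).promises, ¬ t ≤ tq.1)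
    {ε : ℚ} (hε : 0 < ε) :
    ∃ c', EqOn c' c {i | ¬ (δ ≤ i.1 ∧ (i.1, i.2.1) ∈ M ∧ K (i.1, i.2.1) ≤ i.2.2)} ∧
      ∀ x ∈ M, δ ≤ x.1 → ∀ t ∈ Θ, value A (tree A c') t x <
        value A (tree A c) t (rootOf (upper A c K) δ x) + ε := by
  classical
  obtain ⟨θ, hθ, hθ'⟩ := exists_rank M
  -- Nodes on one chain share their root, and the rank grows with the level. Hence these targets
  -- strictly increase down the chain, as values must, and stay within `ε` of the value at the root.
  set v : W × ℕ → T → ℚ := fun x t =>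
    value A (tree A c) t (rootOf (upper A c K) δ x) + ε * θ x.1 with hv
  -- The node is left where it is; only the target values at the restrictions of the `t ∈ Θ` are
  -- promised in addition.
  set goal : W × ℕ → State T W := fun x => ⟨upper A c K x,
    (state A c x (K x)).promises ∪ Θ.image fun t => (A.res t x.1, v x t)⟩ with hgoal
  have hgl : ∀ x ∈ M, x.1 ≠ ⊥ → ∀ tq ∈ (goal x).promises, A.lv tq.1 = x.1 := by
    intro x hx hb tq htq
    rcases Finset.mem_union.1 htq with h | h
    · exact (valid_state hb _).lv _ h
    · obtain ⟨t, ht, rfl⟩ := Finset.mem_image.1 h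
      exact A.lv_res ((hMl x hx).le.trans (hΘ t ht))
  have hcode : ∀ x, ∃ j, x ∈ M → x.1 ≠ ⊥ → code A x.1 j = goal x := by
    intro x
    by_cases h : x ∈ M ∧ x.1 ≠ ⊥
    · obtain ⟨j, hj⟩ := exists_code_eq A (σ := goal x) (upper_lt (c := c) (K := K) h.2) (hgl x h.1 h.2)
      exact ⟨j, fun _ _ => hj⟩
    · exact ⟨0, fun h1 h2 => absurd ⟨h1, h2⟩ h⟩
  choose j hj using hcode
  -- The request is placed at step `K x`, the first step of the row not in the support.
  set c' : W × ℕ × ℕ → ℕ := fun i =>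
    if δ ≤ i.1 ∧ (i.1, i.2.1) ∈ M ∧ i.2.2 = K (i.1, i.2.1) then j (i.1, i.2.1) else c i with hc'
  have hcc : EqOn c' c {i | ¬ (δ ≤ i.1 ∧ (i.1, i.2.1) ∈ M ∧ K (i.1, i.2.1) ≤ i.2.2)} :=
    fun i hi => if_neg fun h => hi ⟨h.1, h.2.1, h.2.2.ge⟩
  have hcs : EqOn c' c (support M K) := hcc.mono fun i hi => by
    rintro ⟨-, -, h⟩
    exact hi.2.not_ge h
  refine ⟨c', hcc, ?_⟩
  suffices H : ∀ x ∈ M, δ ≤ x.1 → ∀ t ∈ Θ, value A (tree A c') t x = v x t by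
    intro x hx hl t ht
    rw [H x hx hl t ht]
    have := mul_lt_mul_of_pos_left (hθ x hx).2 hε
    simp only [hv]
    linarith
  refine hM.induction hδ ?_
  intro x hx hl ih t ht
  have hb : x.1 ≠ ⊥ := (hδ.trans_le hl).ne'
  have hlt : ∀ t ∈ Θ, x.1 ≤ A.lv t := fun t ht => (hMl x hx).le.trans (hΘ t ht)
  have hst := hM.state_eq x hx c' hcs
  have hvs := valid_state (A := A) (c := c') hb (K x)
  rw [hst] at hvs
  -- Two elements of `Θ` with the same restriction to the level of `x` get the same target, because
  -- the value at the root only sees their restrictions to an even lower level.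
  have hvr : ∀ t ∈ Θ, ∀ t' ∈ Θ, A.res t x.1 = A.res t' x.1 → v x t = v x t' := by
    intro t ht t' ht' he
    have hr := (hM.below_rootOf hδ hx hl).1.le.trans hl
    simp only [hv]
    rw [← value_res hr (hlt t ht), he, value_res hr (hlt t' ht')]
  have hvalid : Valid A (tree A c') x.1 (goal x) := by
    refine ⟨hvs.lt, hvs.bot, hgl x hx hb, fun tq htq => ?_, fun s q q' h h' => ?_⟩
    · rcases Finset.mem_union.1 htq with h | h
      · exact hvs.val _ h
      · obtain ⟨t, ht, rfl⟩ := Finset.mem_image.1 h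
        change value A (tree A c') (A.res t x.1) (upper A c K x) < v x t
        rw [value_res (upper_lt hb).le (hlt t ht)]
        simp only [hv]
        rw [IsClosedSystem.rootOf_eq hδ hl]
        -- If the upper node is already the root, its level is below `δ`, where `c'` changes
        -- nothing; otherwise its value is its own target by induction, and that target has smaller
        -- rank.
        rcases lt_or_ge (upper A c K x).1 δ with h' | h'
        · rw [rootOf_of_lt h']
          have : value A (tree A c') t (upper A c K x) = value A (tree A c) t (upper A c K x) :=
            value_congr fun i hi => hcc fun hi' => (hi.trans_lt h').not_ge hi'.1
          rw [this]
          have := mul_pos hε (hθ x hx).1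
          linarith
        · rw [ih h' t ht]
          have := mul_lt_mul_of_pos_left (hθ' _ (hM.node_mem x hx hb) x hx (upper_lt hb)) hε
          simp only [hv]
          linarith
    · rcases Finset.mem_union.1 h with h | h <;> rcases Finset.mem_union.1 h' with h' | h'
      · exact hvs.func _ _ _ h h'
      -- An old promise at the node of a new one would put some `t ∈ Θ` below an already promised
      -- node, which `hinc` excludes.
      · obtain ⟨t, ht, he⟩ := Finset.mem_image.1 h'
        refine absurd ?_ (hinc t ht x hx hl _ h)
        rw [← show A.res t x.1 = s from (Prod.ext_iff.1 he).1]
        exact A.le_res (hlt t ht)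
      · obtain ⟨t, ht, he⟩ := Finset.mem_image.1 h
        refine absurd ?_ (hinc t ht x hx hl _ h')
        rw [← show A.res t x.1 = s from (Prod.ext_iff.1 he).1]
        exact A.le_res (hlt t ht)
      · obtain ⟨t, ht, he⟩ := Finset.mem_image.1 h
        obtain ⟨t', ht', he'⟩ := Finset.mem_image.1 h'
        rw [Prod.ext_iff] at he he'
        dsimp only at he he'
        rw [← he.2, ← he'.2]
        exact hvr t ht t' ht' (he.1.trans he'.1.symm)
  have hext : Extends (tree A c') (goal x) (state A c' x (K x)) := by
    rw [hst]
    exact ⟨.refl _, Finset.subset_union_left⟩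
  have h1 := extends_state_succ hvalid hext (by
    rw [← hj x hx hb]
    congr 1
    exact if_pos ⟨hl, hx, rfl⟩)
  have h2 := h1.sub (Finset.mem_union_right _ (Finset.mem_image_of_mem _ ht))
  rw [← value_eq hb h2, value_res le_rfl (hlt t ht)]

/-- The amalgamation of two closed systems: `c` can be modified such that the nodes `a' i` of the
second system are below the nodes `a i` of the first system. -/
theorem exists_amalgamation (hM : IsClosedSystem A c M K) (hM' : IsClosedSystem A c M' K')
    (hδ : ⊥ < δ) (hMl : ∀ x ∈ M, x.1 < δ') (hMl' : ∀ x ∈ M', x.1 < δ ∨ δ' ≤ x.1)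
    (hδδ' : δ ≤ δ')
    (hinc : ∀ x' ∈ M', δ' ≤ x'.1 → ∀ tq' ∈ (state A c x' (K' x')).promises,
      ∀ x ∈ M, δ ≤ x.1 → ∀ tq ∈ (state A c x (K x)).promises, ¬ tq'.1 ≤ tq.1)
    {ι : Type*} (a a' s : ι → W × ℕ) (ha : ∀ i, a i ∈ M) (hal : ∀ i, δ ≤ (a i).1)
    (ha' : ∀ i, a' i ∈ M') (hal' : ∀ i, δ ≤ (a' i).1)
    (hroot : ∀ i, rootOf (upper A c K) δ (a i) = rootOf (upper A c K') δ (a' i))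
    (hs : Function.Injective s) (hsl : ∀ i j, (s i).1 = (s j).1) (hsδ : ∀ i, (s i).1 ≤ δ')
    (has : ∀ i, Below (tree A c) (a' i) (s i)) :
    ∃ c', EqOn c' c (support M K ∪ support M' K') ∧ ∀ i, Below (tree A c') (a' i) (a i) := by
  classical
  choose b hb hbl hbr hba using fun i => hM'.exists_last hδ (ha' i) (hal' i)
  have hbl' : ∀ i, δ' ≤ (b i).1 := fun i => (hMl' _ (hb i)).resolve_left (hbl i).not_gt
  -- A step of a row can carry only one request, so distinct indices need distinct `b i`. The `s i`
  -- lie on one level not exceeding `δ'`, so each is the predecessor of `b i` on that level and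
  -- separates them.
  have hbinj : Function.Injective b := by
    intro i j hij
    have h : ∀ i, Below (tree A c) (b i) (s i) := fun i =>
      (hba i c fun _ _ => rfl).of_le (has i) ((hsδ i).trans (hbl' i))
    have h' := h j
    rw [← hij] at h'
    exact hs ((h i).eq_of_level_eq h' (hsl j i))
  have hbb : ∀ i, (b i).1 ≠ ⊥ := fun i => (hδ.trans_le (hbl i)).ne'
  have hvb := fun i => valid_state (A := A) (c := c) (hbb i) (K' (b i))
  set M'' := M'.filter fun x => δ' ≤ x.1 with hM''
  -- The promises of the second system exceed the values at its upper nodes by at least a common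
  -- margin; for the `b i` these upper nodes are the roots.
  obtain ⟨ε, hε, hε'⟩ := exists_pos_add_lt
    (M''.sigma fun x => (state A c x (K' x)).promises)
    (fun y => value A (tree A c) y.2.1 (upper A c K' y.1)) (fun y => y.2.2) (by
      rintro ⟨x, tq⟩ h
      obtain ⟨h1, h2⟩ := Finset.mem_sigma.1 h
      exact (valid_state ((hδ.trans_le hδδ').trans_le (Finset.mem_filter.1 h1).2).ne' _).val _ h2)
  set Θ := M''.biUnion fun x => (state A c x (K' x)).promises.image Prod.fst with hΘ
  have hmΘ : ∀ x ∈ M'', ∀ tq ∈ (state A c x (K' x)).promises, tq.1 ∈ Θ := fun x hx tq htq =>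
    Finset.mem_biUnion.2 ⟨x, hx, Finset.mem_image_of_mem _ htq⟩
  obtain ⟨c₁, hc₁, hval⟩ := exists_small_values hM hδ hMl Θ (by
      intro t ht
      obtain ⟨x, hx, ht⟩ := Finset.mem_biUnion.1 ht
      obtain ⟨tq, htq, rfl⟩ := Finset.mem_image.1 ht
      have hx' := (Finset.mem_filter.1 hx).2
      rw [(valid_state ((hδ.trans_le hδδ').trans_le hx').ne' _).lv _ htq]
      exact hx') (by
      intro t ht x hx hl tq htq
      obtain ⟨x', hx', ht⟩ := Finset.mem_biUnion.1 ht
      obtain ⟨tq', htq', rfl⟩ := Finset.mem_image.1 ht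
      exact hinc x' (Finset.mem_filter.1 hx').1 (Finset.mem_filter.1 hx').2 tq' htq' x hx hl tq htq)
    hε
  have hc₁M : EqOn c₁ c (support M K) := hc₁.mono fun i hi => by
    rintro ⟨-, -, h⟩
    exact hi.2.not_ge h
  -- The change affects only rows of levels in `[δ, δ')`, and the second system has no nodes there.
  have hc₁M' : EqOn c₁ c (support M' K') := hc₁.mono fun i hi => by
    intro h
    rcases hMl' _ hi.1 with h' | h'
    · exact h'.not_ge h.1
    · exact (hMl _ h.2.1).not_ge h'
  set goal : ι → State T W := fun i => ⟨a i, (state A c (b i) (K' (b i))).promises⟩ with hgoal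
  have hcode : ∀ i, ∃ j, code A (b i).1 j = goal i := fun i =>
    exists_code_eq A ((hMl _ (ha i)).trans_le (hbl' i)) (hvb i).lv
  choose j hj using hcode
  -- At its first step outside the support, `b l` asks to be moved below `a l` with its promises
  -- unchanged.
  set c₂ : W × ℕ × ℕ → ℕ := fun i =>
    if h : ∃ l, (i.1, i.2.1) = b l ∧ i.2.2 = K' (b l) then j h.choose else c₁ i with hc₂
  have hc₂l : ∀ i : W × ℕ × ℕ, i.1 < δ' → c₂ i = c₁ i := fun i hi => by
    refine dif_neg ?_
    rintro ⟨l, hl, -⟩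
    exact hi.not_ge ((hbl' l).trans_eq (Prod.ext_iff.1 hl).1.symm)
  have hc₂M : EqOn c₂ c (support M K) := fun i hi => by
    rw [hc₂l i (hMl _ hi.1), hc₁M hi]
  have hc₂M' : EqOn c₂ c (support M' K') := fun i hi => by
    refine (dif_neg ?_).trans (hc₁M' hi)
    rintro ⟨l, hl, hk⟩
    have := hi.2
    rw [hl] at this
    omega
  have hc₂b : ∀ l, c₂ ((b l).1, (b l).2, K' (b l)) = j l := fun l => by
    have h : ∃ l', (((b l).1, (b l).2) : W × ℕ) = b l' ∧ K' (b l) = K' (b l') := ⟨l, rfl, rfl⟩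
    refine (dif_pos h).trans ?_
    congr 1
    exact (hbinj h.choose_spec.1).symm
  refine ⟨c₂, fun i hi => hi.elim (fun h => hc₂M h) fun h => hc₂M' h, fun i => ?_⟩
  refine (hba i c₂ hc₂M').trans ?_
  have hst := hM'.state_eq _ (hb i) c₂ hc₂M'
  have hvs := valid_state (A := A) (c := c₂) (hbb i) (K' (b i))
  rw [hst] at hvs
  have hbM : b i ∈ M'' := Finset.mem_filter.2 ⟨hb i, hbl' i⟩
  -- The value at `a i` is less than `ε` above the value at its root, which is also the upper node
  -- of `b i`; by the choice of `ε` this is still below every promise.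
  have hvalid : Valid A (tree A c₂) (b i).1 (goal i) := by
    refine ⟨(hMl _ (ha i)).trans_le (hbl' i), fun h => absurd h (hδ.trans_le (hal i)).ne', hvs.lv,
      fun tq htq => ?_, hvs.func⟩
    have h1 : value A (tree A c₂) tq.1 (a i) = value A (tree A c₁) tq.1 (a i) :=
      value_congr fun l hl => hc₂l l (hl.trans_lt (hMl _ (ha i)))
    have h2 := hval _ (ha i) (hal i) _ (hmΘ _ hbM tq htq)
    have h3 := hε' ⟨b i, tq⟩ (Finset.mem_sigma.2 ⟨hbM, htq⟩)
    dsimp only at h3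
    rw [hbr i, ← hroot i] at h3
    exact h1.trans_lt (h2.trans h3)
  have hext : Extends (tree A c₂) (goal i) (state A c₂ (b i) (K' (b i))) := by
    rw [hst]
    refine ⟨?_, Finset.Subset.refl _⟩
    have := (hM.below_rootOf hδ (ha i) (hal i)).2 c₂ hc₂M
    rwa [hroot i, ← hbr i] at this
  have h1 := extends_state_succ hvalid hext (by rw [hc₂b, hj])
  exact (below_state (hbb i) _).trans h1.below

end Steering

/-- The nodes above `y` depend only on the lower levels and the row of `y`. -/
theorem anc_congr {y : W × ℕ} {γ : W} (hγ : γ < y.1) (h : ∀ i : W × ℕ × ℕ, i.1 < y.1 → c i = c' i)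
    (h' : ∀ j, c (y.1, y.2, j) = c' (y.1, y.2, j)) : anc A c y γ = anc A c' y γ := by
  have hy := ne_bot_of_gt hγ
  obtain ⟨k, hk⟩ := exists_le_state_aux (A := A) (c := c) (fun β _ => levelProps A c β) hγ y.2
  have hs : state A c y k = state A c' y k := state_congr h fun j _ => h' j
  have h1 := below_state (A := A) (c := c) hy k
  have h2 := below_state (A := A) (c := c') hy k
  have hv := (valid_state (A := A) (c := c) hy k).lt
  rw [← hs] at h2
  have h3 := (h1.trans (below_anc hk)).anc_eq
  have h4 := (h2.trans (below_anc hk)).anc_eq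
  refine h3.trans (Eq.trans ?_ h4.symm)
  rw [anc, anc, tree_congr fun i hi => h i (lt_of_le_of_lt hi hv)]

/-- Two different nodes of the same limit level can be separated at a lower level by modifying `c`
outside of a given finite set. -/
theorem exists_separation {x y : W × ℕ} (hxy : x ≠ y) (hl : x.1 = y.1) (hb : x.1 ≠ ⊥)
    (hlim : ∀ β < x.1, ∃ γ, β < γ ∧ γ < x.1) (e : Finset (W × ℕ × ℕ)) :
    ∃ c', (∀ i ∈ e, c' i = c i) ∧ ∃ γ < x.1, anc A c' x γ ≠ anc A c' y γ := by
  classical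
  -- Beyond all steps mentioned in `e`, so altering step `K` of the row of `x` leaves `e` untouched.
  set K := e.sup fun i => i.2.2 + 1 with hK
  set σ := state A c x K with hσ
  have hv := valid_state (A := A) (c := c) hb K
  obtain ⟨γ, hγ, hγx⟩ := hlim _ hv.lt
  -- The node `(γ, m)` respects the promises made for `x` so far, and its index exceeds that of the
  -- predecessor of `y` on level `γ`.
  obtain ⟨m, hm, hmb, hmv⟩ := (levelProps A c γ).extension σ.node
    (σ.promises.image fun tq => (A.res tq.1 γ, tq.2)) hγ hv.bot (by
      intro tq htq
      obtain ⟨tq, h, rfl⟩ := Finset.mem_image.1 htq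
      exact A.lv_res (hγx.le.trans_eq (hv.lv _ h).symm)) (by
      intro tq htq
      obtain ⟨tq, h, rfl⟩ := Finset.mem_image.1 htq
      dsimp only
      rw [value_res hγ.le (hγx.le.trans_eq (hv.lv _ h).symm)]
      exact hv.val _ h) ((anc A c y γ).2 + 1)
  obtain ⟨j, hj⟩ := exists_code_eq A (α := x.1) (σ := ⟨(γ, m), σ.promises⟩) hγx hv.lv
  set c' := Function.update c (x.1, x.2, K) j with hc'
  have hlow : ∀ i : W × ℕ × ℕ, i.1 < x.1 → c i = c' i := fun i hi =>
    (Function.update_of_ne (fun h => hi.ne (congrArg Prod.fst h)) _ _).symm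
  have hst : state A c x K = state A c' x K := state_congr hlow fun i hi =>
    (Function.update_of_ne (fun h => hi.ne (congrArg (fun l => l.2.2) h)) _ _).symm
  have hvalid : Valid A (tree A c') x.1 ⟨(γ, m), σ.promises⟩ := by
    refine ⟨hγx, fun h => absurd h (ne_bot_of_gt hγ), hv.lv, fun tq htq => ?_, hv.func⟩
    have := hmv _ (Finset.mem_image_of_mem _ htq)
    dsimp only at this
    rw [value_res (x := (γ, m)) le_rfl (hγx.le.trans_eq (hv.lv _ htq).symm)] at this
    rwa [← value_congr fun i hi => hlow i (lt_of_le_of_lt hi hγx)]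
  have hext : Extends (tree A c') ⟨(γ, m), σ.promises⟩ (state A c' x K) := by
    rw [← hst]
    refine ⟨?_, Finset.Subset.refl _⟩
    rwa [← below_congr fun i hi => hlow i (lt_of_le_of_lt hi hγx)]
  have h1 := extends_state_succ hvalid hext (by rw [hc', Function.update_self, hj])
  have h2 : Below (tree A c') x (γ, m) := (below_state hb _).trans h1.below
  refine ⟨c', fun i hi => Function.update_of_ne ?_ _ _, γ, hγx, ?_⟩
  · rintro rfl
    have := Finset.le_sup (f := fun i : W × ℕ × ℕ => i.2.2 + 1) hi
    simp only [← hK] at this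
    omega
  -- The changed coordinate belongs to the row of `x`, not to that of `y` or to a lower level, so
  -- the predecessor of `y` is the same as before.
  · rw [h2.anc_eq, ← anc_congr (c := c) (hl ▸ hγx) (fun i hi => hlow i (hl ▸ hi)) fun i =>
      (Function.update_of_ne (fun h => hxy (Prod.ext hl ?_)) _ _).symm]
    · intro h
      have := congrArg Prod.snd h
      dsimp only at this
      omega
    · exact (congrArg (fun l => l.2.1) h).symm

end GenericTree

/-! ### Functions to `ℕ` added by Cohen forcing

The Cohen reals are used to add a function `c : I → ℕ`: the bits are indexed by `I × ℕ`, and `c i`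
is the place of the first `true` in the `i`-th row. -/

namespace CohenPoset
variable {I X : Type u} (κ : I × ℕ ≃ X)

/-- The condition `p` does not exclude that `c` is the function that is added. -/
def Allows (p : CohenPoset X) (c : I → ℕ) : Prop :=
  ∀ i j v, (κ (i, j), v) ∈ p.graph → (j < c i → v = false) ∧ (j = c i → v = true)

variable {κ} {p q : CohenPoset X} {c c' : I → ℕ}

theorem Allows.mono (h : q ≤ p) (hc : q.Allows κ c) : p.Allows κ c :=
  fun i j v hv => hc i j v (h hv)

theorem Allows.congr (hc : p.Allows κ c) (h : ∀ l ∈ p.graph, c' (κ.symm l.1).1 = c (κ.symm l.1).1) :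
    p.Allows κ c' := fun i j v hv => by
  have := h _ hv
  simp only [Equiv.symm_apply_apply] at this
  rw [this]
  exact hc i j v hv

variable (κ) in
theorem exists_allows (p : CohenPoset X) : ∃ c, p.Allows κ c := by
  classical
  -- A finite condition cannot make a whole row false; the first place not made false is a permitted
  -- position for the first `true`.
  have h : ∀ i, ∃ j, (κ (i, j), false) ∉ p.graph := by
    intro i
    by_contra! h
    refine Set.not_infinite.2 p.graph.finite_toSet (Set.infinite_of_injective_forall_mem
      (f := fun j => (κ (i, j), false)) ?_ h)
    intro j j' hj
    simpa using hj
  refine ⟨fun i => Nat.find (h i), fun i j v hv => ⟨fun hj => ?_, fun hj => ?_⟩⟩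
  · exact p.functional _ _ _ hv (not_not.1 (Nat.find_min (h i) hj))
  · have := Nat.find_spec (h i)
    rw [← show j = Nat.find (h i) from hj] at this
    cases v
    · exact absurd hv this
    · rfl

/-- The values of `c` at finitely many places can be decided. -/
theorem Allows.exists_le (hc : p.Allows κ c) (e : Finset I) : ∃ q ≤ p, q.Allows κ c ∧
    (∀ c', q.Allows κ c' → ∀ i ∈ e, c' i = c i) ∧
    ∀ l ∈ q.graph, l ∈ p.graph ∨ (κ.symm l.1).1 ∈ e := by
  classical
  -- For `i ∈ e` these bits spell out the value: `false` before place `c i` and `true` at it.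
  set B := (e.sigma fun i => Finset.range (c i + 1)).image
    fun ij => (κ (ij.1, ij.2), decide (ij.2 = c ij.1)) with hB
  have hmB : ∀ i j v, (κ (i, j), v) ∈ B ↔ i ∈ e ∧ j ≤ c i ∧ v = decide (j = c i) := by
    intro i j v
    simp only [hB, Finset.mem_image, Finset.mem_sigma, Finset.mem_range, Prod.mk.injEq,
      EmbeddingLike.apply_eq_iff_eq]
    constructor
    · rintro ⟨⟨i', j'⟩, ⟨h1, h2⟩, ⟨rfl, rfl⟩, rfl⟩
      exact ⟨h1, Nat.lt_succ_iff.1 h2, rfl⟩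
    · rintro ⟨h1, h2, rfl⟩
      exact ⟨⟨i, j⟩, ⟨h1, Nat.lt_succ_iff.2 h2⟩, ⟨rfl, rfl⟩, rfl⟩
  have key : ∀ i j v, (κ (i, j), v) ∈ p.graph ∪ B →
      (j < c i → v = false) ∧ (j = c i → v = true) := by
    intro i j v hv
    rcases Finset.mem_union.1 hv with hv | hv
    · exact hc i j v hv
    · obtain ⟨-, -, rfl⟩ := (hmB i j v).1 hv
      exact ⟨fun h => decide_eq_false h.ne, fun h => decide_eq_true h⟩
  have hB' : ∀ w v v', (w, v) ∈ p.graph ∪ B → (w, v') ∈ B → v = v' := by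
    intro w v v' h h'
    obtain ⟨⟨i, j⟩, rfl⟩ := κ.surjective w
    obtain ⟨-, h2, -⟩ := (hmB i j v').1 h'
    have h3 := key i j v h
    have h4 := key i j v' (Finset.mem_union_right _ h')
    rcases h2.lt_or_eq with h2 | h2
    · rw [h3.1 h2, h4.1 h2]
    · rw [h3.2 h2, h4.2 h2]
  refine ⟨⟨p.graph ∪ B, fun w v v' h h' => ?_⟩, Finset.subset_union_left, key, ?_, ?_⟩
  · rcases Finset.mem_union.1 h' with h2 | h2
    · rcases Finset.mem_union.1 h with h1 | h1
      · exact p.functional _ _ _ h1 h2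
      · exact (hB' w v' v h' h1).symm
    · exact hB' w v v' h h2
  · intro c' hc' i hi
    have h1 : ∀ j ≤ c i, (κ (i, j), decide (j = c i)) ∈ p.graph ∪ B := fun j hj =>
      Finset.mem_union_right _ ((hmB _ _ _).2 ⟨hi, hj, rfl⟩)
    rcases lt_trichotomy (c' i) (c i) with h | h | h
    · have := (hc' i _ _ (h1 _ h.le)).2 rfl
      exact absurd (of_decide_eq_true this) h.ne
    · exact h
    · have := (hc' i _ _ (h1 _ le_rfl)).1 h
      simp at this
  · intro l hl
    refine (Finset.mem_union.1 hl).imp id fun h => ?_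
    obtain ⟨w, v⟩ := l
    obtain ⟨⟨i, j⟩, rfl⟩ := κ.surjective w
    simpa using ((hmB i j v).1 h).1

/-- Two conditions without contradictory bits are compatible. -/
theorem exists_union (h : ∀ w v v', (w, v) ∈ p.graph → (w, v') ∈ q.graph → v = v') :
    ∃ r ≤ p, r ≤ q ∧ ∀ l ∈ r.graph, l ∈ p.graph ∨ l ∈ q.graph := by
  classical
  refine ⟨⟨p.graph ∪ q.graph, fun w v v' h1 h2 => ?_⟩, Finset.subset_union_left,
    Finset.subset_union_right, fun l => Finset.mem_union.1⟩
  rcases Finset.mem_union.1 h1 with h1 | h1 <;> rcases Finset.mem_union.1 h2 with h2 | h2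
  · exact p.functional _ _ _ h1 h2
  · exact h _ _ _ h1 h2
  · exact (h _ _ _ h2 h1).symm
  · exact q.functional _ _ _ h1 h2

end CohenPoset

/-! ### From continuity in `c` to Cohen conditions, and the main compatibility lemma -/

namespace GenericTree
open CohenPoset

/-- An open property is secured by finitely many values of `c`, and finitely many bits fix those
values. -/
theorem exists_le_of_eventually {I X : Type u} {κ : I × ℕ ≃ X} {p : CohenPoset X} {c : I → ℕ}
    (hc : p.Allows κ c) {E : (I → ℕ) → Prop} (hE : ∀ᶠ c' in near c univ, E c') :
    ∃ q ≤ p, q.Allows κ c ∧ ∀ c', q.Allows κ c' → E c' := by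
  obtain ⟨e, -, he⟩ := eventually_near.1 hE
  obtain ⟨q, hq, h1, h2, -⟩ := hc.exists_le e
  exact ⟨q, hq, h1, fun c' hc' => he c' (h2 c' hc')⟩

variable {T W : Type u} [LinearOrder W] [OrderBot W] [OmegaOne W] [PartialOrder T]
  {A : LevelTree T W} {c c' : W × ℕ × ℕ → ℕ}

section
variable {M : Finset (W × ℕ)} {K : W × ℕ → ℕ} {δ : W}

theorem IsClosedSystem.congr (hM : IsClosedSystem A c M K) (h : EqOn c' c (support M K)) :
    IsClosedSystem A c' M K where
  state_eq x hx c'' h' := by rw [hM.state_eq x hx c'' (h'.trans h), hM.state_eq x hx c' h]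
  node_mem x hx hb := by
    rw [hM.state_eq x hx c' h]
    exact hM.node_mem x hx hb

theorem IsClosedSystem.rootOf_congr (hM : IsClosedSystem A c M K) (h : EqOn c' c (support M K))
    (hδ : ⊥ < δ) {x : W × ℕ} (hx : x ∈ M) (hl : δ ≤ x.1) :
    rootOf (upper A c' K) δ x = rootOf (upper A c K) δ x := by
  refine hM.induction hδ (p := fun x => rootOf (upper A c' K) δ x = rootOf (upper A c K) δ x)
    ?_ x hx hl
  intro x hx hl ih
  have hu : upper A c' K x = upper A c K x := by rw [upper, upper, hM.state_eq x hx c' h]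
  rw [IsClosedSystem.rootOf_eq hδ hl, IsClosedSystem.rootOf_eq hδ hl, hu]
  rcases lt_or_ge (upper A c K x).1 δ with h' | h'
  · rw [rootOf_of_lt h', rootOf_of_lt h']
  · exact ih h'

end

theorem eventually_below (x y : W × ℕ) :
    ∀ᶠ c' in near c univ, (Below (tree A c') x y ↔ Below (tree A c) x y) := by
  by_cases h : y.1 ≤ x.1
  · refine (eventually_anc A c x y.1).mono fun c' h' => ?_
    rw [below_iff_anc h, below_iff_anc h, h']
  · exact Eventually.of_forall fun c' => ⟨fun h' => absurd h'.1 h, fun h' => absurd h'.1 h⟩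

variable (A) in
/-- Among uncountably many finite tuples of nodes which are forced to extend a fixed tuple of
different nodes of one level, there are two which can be forced to have a common extension. -/
theorem exists_common_extension (κ : (W × ℕ × ℕ) × ℕ ≃ W) {ι : Type*} [Finite ι]
    (p : W → CohenPoset W) (a : W → ι → W × ℕ) (s : ι → W × ℕ) (hs : Function.Injective s)
    (hsl : ∀ i j, (s i).1 = (s j).1) (ha : ∀ ξ i, (a ξ i).1 = ⊥ → (a ξ i).2 = 0)
    (hp : ∀ ξ c, (p ξ).Allows κ c → ∀ i, Below (tree A c) (a ξ i) (s i)) :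
    ∃ ξ η, ξ ≠ η ∧ ∃ r ≤ p ξ, r ≤ p η ∧ ∃ e : ι → W × ℕ, (∀ i, (e i).1 ≠ ⊥) ∧
      ∀ c, r.Allows κ c → ∀ i, Below (tree A c) (e i) (a ξ i) ∧ Below (tree A c) (e i) (a η i) := by
  classical
  have := Fintype.ofFinite ι
  obtain ⟨β, hβ⟩ := OmegaOne.exists_bound
    (((finite_range s).image Prod.fst).countable.insert ⊥)
  have hsβ : ∀ i, (s i).1 < β := fun i => hβ _ (.inr ⟨_, ⟨i, rfl⟩, rfl⟩)
  have hbβ : ⊥ < β := hβ _ (.inl rfl)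
  -- The tuples are moved down to levels `ρ ξ > ξ`, so that they lie beyond any fixed `δ` for large
  -- `ξ`. The nodes used for this are below the original ones for every `c`.
  have hρ := fun ξ => OmegaOne.exists_bound
    (((finite_range (a ξ)).image Prod.fst).countable.insert ξ)
  choose ρ hρ using hρ
  have hρξ : ∀ ξ, ξ < ρ ξ := fun ξ => hρ ξ _ (.inl rfl)
  have haρ : ∀ ξ i, (a ξ i).1 < ρ ξ := fun ξ i => hρ ξ _ (.inr ⟨_, ⟨i, rfl⟩, rfl⟩)
  choose m hm hma using fun ξ i => exists_child A (a ξ i) (ha ξ i) (haρ ξ i) 0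
  set a' : W → ι → W × ℕ := fun ξ i => (ρ ξ, m ξ i) with ha'
  choose c hc using fun ξ => exists_allows κ (p ξ)
  choose M K hM₀ he hM using fun ξ => exists_isClosedSystem A (c ξ)
    ((p ξ).graph.image fun l => (κ.symm l.1).1) (Finset.univ.image (a' ξ))
  have haM : ∀ ξ i, a' ξ i ∈ M ξ := fun ξ i =>
    hM₀ ξ (Finset.mem_image_of_mem _ (Finset.mem_univ i))
  have hsf : ∀ ξ, (support (M ξ) (K ξ)).Finite := fun ξ => by
    refine (((M ξ).sigma fun x => Finset.range (K ξ x)).image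
      fun xk => (xk.1.1, xk.1.2, xk.2)).finite_toSet.subset fun i hi => ?_
    exact Finset.mem_coe.2 (Finset.mem_image.2 ⟨⟨(i.1, i.2.1), i.2.2⟩,
      Finset.mem_sigma.2 ⟨hi.1, Finset.mem_range.2 hi.2⟩, rfl⟩)
  -- The condition `q ξ` fixes `c` on the whole support of the system and, since the coordinates of
  -- `p ξ` are in the support, mentions no other coordinates.
  choose q hqp hqc hqs hqg using fun ξ => (hc ξ).exists_le (hsf ξ).toFinset
  have hqc' : ∀ ξ c', (q ξ).Allows κ c' → EqOn c' (c ξ) (support (M ξ) (K ξ)) :=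
    fun ξ c' h i hi => hqs ξ c' h i ((hsf ξ).mem_toFinset.2 hi)
  have hqg' : ∀ ξ, ∀ l ∈ (q ξ).graph, (κ.symm l.1).1 ∈ support (M ξ) (K ξ) := by
    intro ξ l hl
    rcases hqg ξ l hl with h | h
    · exact he ξ (Finset.mem_coe.2 (Finset.mem_image_of_mem _ h))
    · exact (hsf ξ).mem_toFinset.1 h
  -- thinning out
  obtain ⟨n, -, hn⟩ := exists_neBot_inf_fiber (l := (atTop : Filter W))
    (g := fun ξ => ((M ξ).image Prod.fst).card) (to_countable univ)
    (Eventually.of_forall fun _ => mem_univ _)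
  have hn' := countableInterFilter_inf (atTop : Filter W)
    (𝓟 {ξ | ((M ξ).image Prod.fst).card = n})
  obtain ⟨δ₀, l, hl, hl1, hl2, hδ₀⟩ := exists_delta n
    ((atTop : Filter W) ⊓ 𝓟 {ξ | ((M ξ).image Prod.fst).card = n})
    (fun ξ => (M ξ).image Prod.fst)
    (Eventually.filter_mono inf_le_right (mem_principal.2 fun ξ (h : _ = n) => h.le))
  have hltop : l ≤ atTop := hl.trans inf_le_left
  -- Taking `δ` at least `β` keeps the level of the fixed tuple `s` below `δ`.
  set δ := max δ₀ β with hδ_def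
  have hδ : ⊥ < δ := hbβ.trans_le (le_max_right _ _)
  have hMl : ∀ δ', ∀ᶠ ξ in l, ∀ x ∈ M ξ, x.1 < δ ∨ δ' ≤ x.1 := fun δ' =>
    (hδ₀ δ').mono fun ξ h x hx => (h _ (Finset.mem_image_of_mem _ hx)).imp
      (fun h => h.trans_le (le_max_left _ _)) id
  have hal : ∀ᶠ ξ in l, δ < ξ := hltop (eventually_gt_atTop δ)
  have hcount : {x : W × ℕ | x.1 < δ}.Countable := by
    refine ((OmegaOne.countable_Iio δ).prod (to_countable (univ : Set ℕ))).mono ?_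
    exact fun x hx => ⟨hx, mem_univ _⟩
  have hcount' : {f : Finset (W × Bool) | ∀ w ∈ f, (κ.symm w.1).1.1 < δ}.Countable := by
    have h1 : {w : W × Bool | (κ.symm w.1).1.1 < δ}.Countable := by
      have h2 : (Iio δ ×ˢ (univ : Set (ℕ × ℕ × ℕ × Bool))).Countable :=
        (OmegaOne.countable_Iio δ).prod (to_countable _)
      refine (h2.image fun x => (κ ((x.1, x.2.1, x.2.2.1), x.2.2.2.1), x.2.2.2.2)).mono ?_
      rintro ⟨w, v⟩ hw
      refine ⟨((κ.symm w).1.1, (κ.symm w).1.2.1, (κ.symm w).1.2.2, (κ.symm w).2, v),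
        ⟨hw, mem_univ _⟩, ?_⟩
      simp
    have h3 := (countable_ofPred_finite_subset h1).preimage
      (f := fun f : Finset (W × Bool) => (f : Set (W × Bool))) Finset.coe_injective
    exact h3.mono fun f hf => And.intro f.finite_toSet hf
  -- The part of `q ξ` of level below `δ` and the roots of the tuple range over countably many
  -- possibilities, so they can be made constant.
  obtain ⟨⟨f, rt⟩, -, hl3⟩ := exists_neBot_inf_fiber (l := l)
    (g := fun ξ => ((q ξ).graph.filter fun w => (κ.symm w.1).1.1 < δ,
      fun i => rootOf (upper A (c ξ) (K ξ)) δ (a' ξ i)))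
    (hcount'.prod (countable_univ_pi fun _ : ι => hcount)) (by
      filter_upwards [hal] with ξ hξ
      refine ⟨fun w hw => (Finset.mem_filter.1 hw).2, fun i _ => ?_⟩
      exact ((hM ξ).below_rootOf hδ (haM ξ i) (hξ.trans (hρξ ξ)).le).1)
  set l' := l ⊓ 𝓟 _ with hl'
  have hl4 : CountableInterFilter l' := countableInterFilter_inf l _
  have hcolor : ∀ᶠ ξ in l', (((q ξ).graph.filter fun w => (κ.symm w.1).1.1 < δ) = f ∧
      ∀ i, rootOf (upper A (c ξ) (K ξ)) δ (a' ξ i) = rt i) := by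
    refine Eventually.filter_mono inf_le_right (mem_principal.2 fun ξ h => ?_)
    exact ⟨(Prod.ext_iff.1 h).1, fun i => congrFun (Prod.ext_iff.1 h).2 i⟩
  set D : W → Finset T := fun ξ => ((M ξ).filter fun x => δ ≤ x.1).biUnion
    fun x => (state A (c ξ) x (K ξ x)).promises.image Prod.fst with hD
  have hmD : ∀ ξ, ∀ x ∈ M ξ, δ ≤ x.1 → ∀ tq ∈ (state A (c ξ) x (K ξ x)).promises, tq.1 ∈ D ξ :=
    fun ξ x hx hl tq htq => Finset.mem_biUnion.2 ⟨x, Finset.mem_filter.2 ⟨hx, hl⟩,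
      Finset.mem_image_of_mem _ htq⟩
  -- The promised nodes of `T` have the levels of the nodes of the system from `δ` on, which tend to
  -- infinity. This is where `T` being Aronszajn is used.
  have hinc := A.exists_incomparable (l := l') D (by
    intro δ'
    filter_upwards [(hMl δ').filter_mono inf_le_left] with ξ hξ t ht
    obtain ⟨x, hx, ht⟩ := Finset.mem_biUnion.1 ht
    obtain ⟨tq, htq, rfl⟩ := Finset.mem_image.1 ht
    obtain ⟨hx, hxl⟩ := Finset.mem_filter.1 hx
    rw [(valid_state (hδ.trans_le hxl).ne' _).lv _ htq]
    exact (hξ x hx).resolve_left hxl.not_gt)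
  obtain ⟨ξ, hξ, hξc, hξl⟩ := (hinc.and_eventually
    (hcolor.and (hal.filter_mono inf_le_left))).exists
  -- This bound lies above the whole first system; the second index is chosen so that its system has
  -- no levels in `[δ, δ')`.
  obtain ⟨δ', hδ'⟩ := OmegaOne.exists_bound
    (((M ξ).finite_toSet.image Prod.fst).countable.insert δ)
  have hδδ' : δ < δ' := hδ' _ (.inl rfl)
  have hMξ : ∀ x ∈ M ξ, x.1 < δ' := fun x hx => hδ' _ (.inr ⟨x, hx, rfl⟩)
  obtain ⟨η, hη, ⟨hηc, hηl⟩, hMη, hξη⟩ := (hξ.and_eventually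
    ((hcolor.and (hal.filter_mono inf_le_left)).and
      (((hMl δ').filter_mono inf_le_left).and
        (((eventually_gt_atTop ξ).filter_mono hltop).filter_mono inf_le_left)))).exists
  -- the common extension
  obtain ⟨r₀, hr1, hr2, hr3⟩ := exists_union (p := q ξ) (q := q η) (by
    intro w v v' h h'
    have h1 := (hqg' _ _ h).1
    have h2 := (hqg' _ _ h').1
    -- Only coordinates of level below `δ` can be shared, and there both conditions have the same
    -- bits.
    have h3 : (κ.symm w).1.1 < δ := (hMη _ h2).resolve_right (hMξ _ h1).not_ge
    have h4 : (w, v) ∈ (q η).graph := by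
      have : (w, v) ∈ (q ξ).graph.filter fun w => (κ.symm w.1).1.1 < δ :=
        Finset.mem_filter.2 ⟨h, h3⟩
      rw [hξc.1, ← hηc.1] at this
      exact (Finset.mem_filter.1 this).1
    exact (q η).functional _ _ _ h4 h')
  obtain ⟨d, hd⟩ := exists_allows κ r₀
  have hdξ := hqc' ξ d (hd.mono hr1)
  have hdη := hqc' η d (hd.mono hr2)
  have hlξ : ∀ i, δ ≤ (a' ξ i).1 := fun i => (hξl.trans (hρξ ξ)).le
  have hlη : ∀ i, δ ≤ (a' η i).1 := fun i => (hηl.trans (hρξ η)).le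
  obtain ⟨d', hd', hbelow⟩ := exists_amalgamation ((hM ξ).congr hdξ) ((hM η).congr hdη) hδ hMξ hMη
    hδδ'.le (by
      intro x' hx' hl' tq' htq' x hx hl tq htq
      rw [(hM η).state_eq x' hx' d hdη] at htq'
      rw [(hM ξ).state_eq x hx d hdξ] at htq
      exact hη _ (hmD η x' hx' (hδδ'.le.trans hl') _ htq') _ (hmD ξ x hx hl _ htq))
    (a' ξ) (a' η) s (haM ξ) hlξ (haM η) hlη (fun i => by
      rw [(hM ξ).rootOf_congr hdξ hδ (haM ξ i) (hlξ i),
        (hM η).rootOf_congr hdη hδ (haM η i) (hlη i), hξc.2, hηc.2])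
    hs hsl (fun i => (hsβ i).le.trans ((le_max_right _ _).trans hδδ'.le))
    (fun i => (hma η i d).trans (hp η d (hd.mono (hr2.trans (hqp η))) i))
  -- The bits of `r₀` concern only the two supports, on which the amalgamation changes nothing.
  have hr₀ : r₀.Allows κ d' := by
    refine hd.congr fun l hl => hd' ?_
    exact (hr3 l hl).imp (hqg' ξ l) (hqg' η l)
  obtain ⟨r, hr, -, hrb⟩ := exists_le_of_eventually hr₀
    (E := fun c' => ∀ i, Below (tree A c') (a' η i) (a' ξ i)) (by
      rw [eventually_all]
      exact fun i => (eventually_below _ _).mono fun c' h => h.2 (hbelow i))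
  refine ⟨ξ, η, hξη.ne, r, hr.trans (hr1.trans (hqp ξ)), hr.trans (hr2.trans (hqp η)), a' η,
    fun i => (hδ.trans_le (hlη i)).ne', fun c' hc' i => ⟨?_, hma η i c'⟩⟩
  exact (hrb c' hc' i).trans (hma ξ i c')

end GenericTree

namespace Forcing
variable {P : Type u} [Preorder P]

/-! ### Functions -/

theorem isFunction.sub_domain {f X Y g X' Y' : PName P} {p : P} (hf : isFunction f X Y p)
    (hg : isFunction g X' Y' p) (h : sub f g p) : sub X X' p := by
  intro z q hq hz
  refine (regular_mem _ _).bind (((regular_isFunction _ _ _).mono hq hf).exists_value hz) ?_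
  rintro r hr ⟨y, -, hy⟩
  exact (((regular_isFunction _ _ _).mono (hr.trans hq) hg).mem_of_pair
    (h _ r (hr.trans hq) hy)).1

theorem isFunction.domain_eq {f X Y X' Y' : PName P} {p : P} (hf : isFunction f X Y p)
    (hf' : isFunction f X' Y' p) : eq X X' p :=
  eq_of_sub (hf.sub_domain hf' fun _ _ _ h => h) (hf'.sub_domain hf fun _ _ _ h => h)

/-- Both functions have the same domain and lie inside the single function `h`, so their values
agree. -/
theorem isFunction.sub_of_sub {f g h X Y Y' Z Z' : PName P} {p : P} (hf : isFunction f X Y p)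
    (hg : isFunction g X Y' p) (hh : isFunction h Z Z' p) (h1 : sub f h p) (h2 : sub g h p) :
    sub f g p := by
  intro z q hq hz
  have hfq := (regular_isFunction _ _ _).mono hq hf
  refine (regular_mem _ _).bind (hfq.mem_iff hz) ?_
  rintro r hr ⟨a, b, ha, hb, he⟩
  have hgr := (regular_isFunction _ _ _).mono (hr.trans hq) hg
  refine (regular_mem _ _).bind (hgr.exists_value ha) ?_
  rintro s hs ⟨b', -, hb'⟩
  have hsp := hs.trans (hr.trans hq)
  have he' := mono_eq _ _ hs he
  have h3 : mem (pair a b) h s :=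
    h1 _ s hsp (mem_congr_left he' ((regular_mem _ _).mono (hs.trans hr) hz))
  have h4 := ((regular_isFunction _ _ _).mono hsp hh).eq_of_mem h3 (h2 _ s hsp hb')
  exact mem_congr_left (eq_symm (eq_trans he' (pair_congr (eq_refl _ _) h4))) hb'

/-- Density is applied once for each element of the finite set, going to stronger and stronger
conditions. -/
theorem exists_le_forall_finset {N V : Type*} [Nonempty V] {φ : N → V → Form P}
    (hφ : ∀ x v, Mono (φ x v)) (Φ : Finset N) {p : P}
    (h : ∀ x ∈ Φ, Dense (fun r => ∃ v, φ x v r) p) :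
    ∃ r ≤ p, ∃ g : N → V, ∀ x ∈ Φ, φ x (g x) r := by
  classical
  induction Φ using Finset.induction_on with
  | empty => exact ⟨p, le_rfl, fun _ => Classical.arbitrary V, by simp⟩
  | insert a Φ ha ih =>
    obtain ⟨r, hr, g, hg⟩ := ih fun x hx => h x (Finset.mem_insert_of_mem hx)
    obtain ⟨s, hs, v, hv⟩ := h a (Finset.mem_insert_self _ _) r hr
    refine ⟨s, hs.trans hr, Function.update g a v, fun x hx => ?_⟩
    rcases Finset.mem_insert.1 hx with rfl | hx
    · rwa [Function.update_self]
    · rw [Function.update_of_ne (fun he : x = a => ha (he ▸ hx))]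
      exact hφ _ _ hs (hg x hx)

/-! ### Ordinals -/

/-- The name for the order type of the elements below `α`. -/
noncomputable def ord {W : Type u} [LinearOrder W] [WellFoundedLT W] (α : W) : PName P :=
  setOf fun β : Iio α => ord β.1
termination_by (wellFounded_lt (α := W)).wrap α
decreasing_by exact β.2

/-- Families of conditions indexed by `W` contain compatible members. -/
def CCC (P W : Type u) [Preorder P] : Prop :=
  ∀ p : W → P, ∃ ξ η, ξ ≠ η ∧ ∃ r ≤ p ξ, r ≤ p η

section
variable {W : Type u} [LinearOrder W] [OmegaOne W] {α β : W} {p : P}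

theorem mem_ord {z : PName P} :
    mem z (ord α) p ↔ Dense (fun r => ∃ β < α, eq z (ord β) r) p := by
  rw [ord, mem_setOf]
  refine forall_congr' fun q => forall_congr' fun _ => exists_congr fun r =>
      and_congr_right fun _ => ⟨fun ⟨n, h⟩ => ⟨n.1, n.2, h⟩, fun ⟨n, hn, h⟩ => ⟨⟨n, hn⟩, h⟩⟩

theorem ord_mem_ord (h : β < α) (p : P) : mem (ord β) (ord α) p :=
  mem_ord.2 fun q _ => ⟨q, le_rfl, β, h, eq_refl _ _⟩

theorem not_ord_mem_self (α : W) (p : P) : ¬ mem (ord α) (ord α) p := by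
  induction α using WellFoundedLT.induction generalizing p with
  | ind α ih =>
    intro h
    obtain ⟨q, -, m, hm, he⟩ := mem_ord.1 h p le_rfl
    exact ih m hm q (sub_of_eq he _ q le_rfl (ord_mem_ord hm q))

theorem le_of_sub_ord (h : sub (ord α) (ord β) p) : α ≤ β := by
  by_contra! h'
  exact not_ord_mem_self β p (h _ p le_rfl (ord_mem_ord h' p))

theorem ord_inj (h : eq (ord α) (ord β) p) : α = β :=
  le_antisymm (le_of_sub_ord (sub_of_eq h)) (le_of_sub_ord (sub_of_eq (eq_symm h)))

theorem isTransitive_ord (α : W) (p : P) : isTransitive (ord α) p := by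
  intro y q _ hy z r hr hz
  refine (regular_mem _ _).bind (Dense.mono hr (mem_ord.1 hy)) ?_
  rintro s hs ⟨β, hβ, he⟩
  refine (regular_mem _ _).bind (mem_ord.1 (mem_congr_right he ((regular_mem _ _).mono hs hz))) ?_
  rintro t ht ⟨γ, hγ, he'⟩
  exact mem_congr_left (eq_symm he') (ord_mem_ord (hγ.trans hβ) t)

theorem isCountableOrdinal_ord (α : W) (p : P) : isCountableOrdinal (ord α) p := by
  refine ⟨isTransitive_ord α p, ?_, ?_⟩
  · intro x q _ hx
    refine (regular_isTransitive _).bind (mem_ord.1 hx) ?_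
    rintro r hr ⟨β, hβ, he⟩
    exact (Cong.isTransitive (eq_symm he)).mp (isTransitive_ord β r)
  · have := (OmegaOne.countable_Iio α).to_subtype
    refine isCountable_of (fun β : Iio α => ord β.1) ?_ ?_
    · intro q _ z hz r hr
      obtain ⟨s, hs, β, hβ, he⟩ := mem_ord.1 hz r hr
      exact ⟨s, hs, ⟨β, hβ⟩, he⟩
    · intro q _ i j _ _ he
      exact Subtype.ext (ord_inj he)

/-- The least ordinal that is not an element of a given set. -/
theorem exists_least_ord_notMem {x : PName P} (h : ∃ q ≤ p, ∃ α : W, neg (mem (ord α) x) q) :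
    ∃ q ≤ p, ∃ α : W, neg (mem (ord α) x) q ∧ ∀ γ < α, mem (ord γ) x q := by
  obtain ⟨q, hq, α, h⟩ := h
  induction α using WellFoundedLT.induction generalizing q with
  | ind α ih =>
    by_cases h' : ∃ r ≤ q, ∃ γ < α, neg (mem (ord γ) x) r
    · obtain ⟨r, hr, γ, hγ, hn⟩ := h'
      exact ih γ hγ r (hr.trans hq) hn
    · push Not at h'
      exact ⟨q, hq, α, h, fun γ hγ => (regular_mem _ _).by_contra fun r hr => h' r hr γ hγ⟩

/-- The elements of `x` are densely ordinals `ord γ`; one with `γ ≥ α` would, by transitivity of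
`x`, bring `ord α` into `x`. -/
theorem eq_ord {x : PName P} (hx : isTransitive x p) (h : neg (mem (ord α) x) p)
    (h' : ∀ γ < α, mem (ord γ) x p)
    (hel : ∀ q ≤ p, ∀ z, mem z x q → Dense (fun r => ∃ γ : W, eq z (ord γ) r) q) :
    eq x (ord α) p := by
  refine eq_of_sub (fun z q hq hz => ?_) fun z q hq hz => ?_
  · refine (regular_mem _ _).bind (hel q hq z hz) ?_
    rintro r hr ⟨γ, he⟩
    rcases lt_or_ge γ α with hγ | hγ
    · exact mem_congr_left (eq_symm he) (ord_mem_ord hγ r)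
    · refine absurd ?_ (h r (hr.trans hq))
      have hz' := (regular_mem _ _).mono hr hz
      rcases hγ.eq_or_lt with rfl | hγ
      · exact mem_congr_left he hz'
      · exact hx z r (hr.trans hq) hz' _ r le_rfl
          (mem_congr_right (eq_symm he) (ord_mem_ord hγ r))
  · refine (regular_mem _ _).bind (mem_ord.1 hz) ?_
    rintro r hr ⟨γ, hγ, he⟩
    exact mem_congr_left (eq_symm he) ((regular_mem _ _).mono (hr.trans hq) (h' γ hγ))

theorem dense_eq_ord_of_sub {x : PName P} (hx : isTransitive x p) (h : sub x (ord α) p) :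
    Dense (fun r => ∃ β ≤ α, eq x (ord β) r) p := by
  intro q hq
  obtain ⟨r, hr, β, hn, hm⟩ := exists_least_ord_notMem (W := W) (x := x) (p := q)
    ⟨q, le_rfl, α, fun r hr hm => not_ord_mem_self α r (h _ r (hr.trans hq) hm)⟩
  have he : eq x (ord β) r := by
    refine eq_ord ((regular_isTransitive _).mono (hr.trans hq) hx) hn hm fun s hs z hz t ht => ?_
    obtain ⟨t', ht', γ, -, he⟩ := mem_ord.1 (h z s (hs.trans (hr.trans hq)) hz) t ht
    exact ⟨t', ht', γ, he⟩
  exact ⟨r, hr, β, le_of_sub_ord (p := r) (sub_trans (sub_of_eq (eq_symm he))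
    ((regular_sub _ _).mono (hr.trans hq) h)), he⟩

variable (W) in
-- Induction on names. If `ord α` is forced out of `x`, each element of `x` is densely of one of the
-- two kinds; one containing all ordinals would put `ord α` into the transitive set `x`. So all
-- elements are ordinals and `x` is the least ordinal missing from it.
theorem dense_eq_ord_or (x : PName P) : ∀ p : P, isTransitive x p →
    (all fun y => y ∈ᶠ x →ᶠ isTransitive y) p →
    Dense (fun r => (∃ α : W, eq x (ord α) r) ∨ ∀ α : W, mem (ord α) x r) p := by
  induction x with
  | mk ι x c ih =>
    intro p h1 h2 q hq
    by_cases h : ∃ r ≤ q, ∃ α : W, neg (mem (ord α) (.mk ι x c)) r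
    · obtain ⟨r, hr, α, hn, hm⟩ := exists_least_ord_notMem h
      refine ⟨r, hr, .inl ⟨α, ?_⟩⟩
      have hrp := hr.trans hq
      refine eq_ord ((regular_isTransitive _).mono hrp h1) hn hm ?_
      intro s hs z hz t ht
      obtain ⟨t', ht', i, hi, he⟩ := hz t ht
      have htp := ht'.trans (ht.trans (hs.trans hrp))
      have hmem : mem (x i) (.mk ι x c) t' := mem_congr_left he
        ((regular_mem _ _).mono (ht'.trans ht) hz)
      have htr := h2 (x i) t' htp hmem
      obtain ⟨v, hv, h3⟩ := ih i t' htr (fun y v hv hy =>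
        h2 y v (hv.trans htp) (h1 (x i) t' htp hmem y v hv hy)) t' le_rfl
      rcases h3 with ⟨γ, hγ⟩ | h3
      · exact ⟨v, hv.trans ht', γ, eq_trans (mono_eq _ _ hv he) hγ⟩
      · exact absurd (h1 (x i) v (hv.trans htp) ((regular_mem _ _).mono hv hmem) _ v le_rfl (h3 α))
          (hn v (hv.trans (ht'.trans (ht.trans hs))))
    · push Not at h
      exact ⟨q, le_rfl, .inr fun α => (regular_mem _ _).by_contra fun r hr => h r hr α⟩

theorem CCC.exists_compatible (hP : CCC P W) {Y : Type*} [Uncountable Y] (p : Y → P) :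
    ∃ ξ η, ξ ≠ η ∧ ∃ r ≤ p ξ, r ≤ p η := by
  obtain ⟨f, hf⟩ := OmegaOne.exists_injective (W := W) Y
  obtain ⟨ξ, η, hne, r, h1, h2⟩ := hP (p ∘ f)
  exact ⟨f ξ, f η, hf.ne hne, r, h1, h2⟩

/-- Otherwise the countable set `a` would contain all `ord α`, and its injection into `ω` would be
an injection of `W` into `ω` in the extension. The chain condition refutes this. -/
theorem CCC.dense_eq_ord (hP : CCC P W) {a : PName P} (ha : isCountableOrdinal a p) :
    Dense (fun r => ∃ α : W, eq a (ord α) r) p := by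
  intro q hq
  obtain ⟨r, hr, h | h⟩ := dense_eq_ord_or W a p ha.1 ha.2.1 q hq
  · exact ⟨r, hr, h⟩
  exfalso
  obtain ⟨s, hs, w, h1⟩ := ha.2.2 r (hr.trans hq)
  obtain ⟨t, ht, f, hw, hf, hinj⟩ := h1 s le_rfl
  have h2 : ∀ α : W, ∃ v ≤ t, ∃ n : ℕ, mem (pair (ord α) (nat n)) f v := fun α => by
    obtain ⟨v, hv, y, hy, hyf⟩ := hf.exists_value
      ((regular_mem _ _).mono (ht.trans hs) (h α)) t le_rfl
    obtain ⟨v', hv', n, hn⟩ := mem_omega.1 (mem_congr_right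
      (mono_eq _ _ hv (isOmega_iff.1 hw)) hy) v le_rfl
    exact ⟨v', hv'.trans hv, n, mem_congr_left (pair_congr (eq_refl _ _) hn)
      ((regular_mem _ _).mono hv' hyf)⟩
  choose v hv n hn using h2
  -- Uncountably many `α` are assigned the same number; compatible conditions for two of them
  -- contradict injectivity.
  have h3 : ∃ k, Uncountable {α | n α = k} := by
    by_contra! h3
    have : (⋃ k, {α | n α = k}).Countable := countable_iUnion fun k => h3 k
    refine not_countable (α := W) (countable_univ_iff.1 (this.mono fun α _ => ?_))
    exact mem_iUnion.2 ⟨n α, rfl⟩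
  obtain ⟨k, hk⟩ := h3
  obtain ⟨ξ, η, hne, r', h4, h5⟩ := hP.exists_compatible fun α : {α | n α = k} => v α.1
  refine hne (Subtype.ext (ord_inj (p := r') ?_))
  have h6 := (regular_mem _ _).mono h4 (hn ξ.1)
  have h7 := (regular_mem _ _).mono h5 (hn η.1)
  rw [show n ξ.1 = k from ξ.2] at h6
  rw [show n η.1 = k from η.2] at h7
  exact hinj _ _ _ r' (h4.trans (hv _)) (pairMem_iff.2 h6) r' le_rfl (pairMem_iff.2 h7)

/-- A set is countable if its elements belong to a family of distinct names of which only
countably many can be forced to be elements. -/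
theorem isCountable_of_forall {X : PName P} {J : Type u} (x : J → PName P)
    (hX : ∀ q ≤ p, ∀ z, mem z X q → Dense (fun r => ∃ j, eq z (x j) r) q)
    (hx : ∀ q ≤ p, ∀ i j, mem (x i) X q → mem (x j) X q → eq (x i) (x j) q → i = j)
    (h : ∀ (f : W → J) (q : W → P), Function.Injective f → (∀ ξ, q ξ ≤ p) →
      (∀ ξ, mem (x (f ξ)) X (q ξ)) → False) : isCountable X p := by
  have hc : Countable {j | ∃ q ≤ p, mem (x j) X q} := by
    by_contra hc
    rw [not_countable_iff] at hc
    obtain ⟨f, hf⟩ := OmegaOne.exists_injective (W := W) {j | ∃ q ≤ p, mem (x j) X q}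
    choose q hq hm using fun ξ => (f ξ).2
    exact h (fun ξ => (f ξ).1) q (Subtype.val_injective.comp hf) hq hm
  refine isCountable_of (fun j : {j | ∃ q ≤ p, mem (x j) X q} => x j.1) ?_ ?_
  · intro q hq z hz r hr
    obtain ⟨s, hs, j, hj⟩ := hX q hq z hz r hr
    exact ⟨s, hs, ⟨j, s, hs.trans (hr.trans hq),
      mem_congr_left hj ((regular_mem _ _).mono (hs.trans hr) hz)⟩, hj⟩
  · exact fun q hq i j hi hj he => Subtype.ext (hx q hq _ _ hi hj he)

end

end Forcing

namespace GenericTree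
open CohenPoset Forcing

/-! ### Statements on the added function -/

section Decided
variable {I X : Type u} (κ : I × ℕ ≃ X) {p : CohenPoset X} {c : I → ℕ}

/-- The condition `p` forces that the added function has property `E`. -/
def Decided (E : (I → ℕ) → Prop) : Form (CohenPoset X) := fun p => ∀ c, p.Allows κ c → E c

variable {κ}

theorem mono_decided (E : (I → ℕ) → Prop) : Mono (Decided κ E) :=
  fun _ _ h hp c hc => hp c (hc.mono h)

theorem exists_decided_eq {Z : Type*} {g : (I → ℕ) → Z}
    (hc : p.Allows κ c) (hg : ∀ᶠ c' in near c univ, g c' = g c) :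
    ∃ q ≤ p, q.Allows κ c ∧ Decided κ (fun c' => g c' = g c) q :=
  exists_le_of_eventually hc hg

theorem dense_decided_eq {Z : Type*} {g : (I → ℕ) → Z}
    (hg : ∀ c, ∀ᶠ c' in near c univ, g c' = g c) :
    Dense (fun r => ∃ z, Decided κ (fun c => g c = z) r) p := by
  intro q _
  obtain ⟨c, hc⟩ := exists_allows κ q
  obtain ⟨r, hr, -, h⟩ := exists_decided_eq hc (hg c)
  exact ⟨r, hr, _, h⟩

theorem decided_eq_unique {Z : Type*} {g : (I → ℕ) → Z} {z z' : Z}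
    (h : Decided κ (fun c => g c = z) p) (h' : Decided κ (fun c => g c = z') p) : z = z' := by
  obtain ⟨c, hc⟩ := exists_allows κ p
  exact (h c hc).symm.trans (h' c hc)

end Decided

variable {T W : Type u} [LinearOrder W] [OrderBot W] [OmegaOne W] [SuccOrder W] [PartialOrder T]
  (A : LevelTree T W) (κ : (W × ℕ × ℕ) × ℕ ≃ W)

/-! ### Names for the nodes -/

variable (W) in
/-- The nodes of the tree: there is only one root. -/
abbrev Node : Type u := {x : W × ℕ // x.1 = ⊥ → x.2 = 0}

/-- The name for the sequence of a node `x`: its value at `β` is given by the node of level `β + 1`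
above `x`. -/
noncomputable def seq (x : W × ℕ) : PName (CohenPoset W) :=
  ofForm (ι := Iio x.1 × ULift.{u} ℕ) (fun i => pair (ord i.1.1) (nat i.2.down)) fun i =>
    Decided κ fun c => (anc A c x (Order.succ i.1.1)).2 = i.2.down

variable {A κ} {p : CohenPoset W} {c : W × ℕ × ℕ → ℕ}

theorem mem_seq {x : W × ℕ} {z : PName (CohenPoset W)} : mem z (seq A κ x) p ↔
    Dense (fun r => ∃ β < x.1, ∃ n : ℕ, Decided κ (fun c => (anc A c x (Order.succ β)).2 = n) r ∧
      eq z (pair (ord β) (nat n)) r) p := by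
  rw [seq, mem_ofForm fun _ => mono_decided _]
  refine forall_congr' fun q => forall_congr' fun _ => exists_congr fun r =>
    and_congr_right fun _ => ⟨?_, ?_⟩
  · rintro ⟨i, h1, h2⟩
    exact ⟨i.1.1, i.1.2, i.2.down, h1, h2⟩
  · rintro ⟨β, hβ, n, h1, h2⟩
    exact ⟨⟨⟨β, hβ⟩, ⟨n⟩⟩, h1, h2⟩

theorem pair_mem_seq {x : W × ℕ} {β : W} (hβ : β < x.1) {n : ℕ}
    (h : Decided κ (fun c => (anc A c x (Order.succ β)).2 = n) p) :
    mem (pair (ord β) (nat n)) (seq A κ x) p :=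
  mem_seq.2 fun q hq => ⟨q, le_rfl, β, hβ, n, mono_decided _ hq h, eq_refl _ _⟩

theorem eventually_anc_snd (x : W × ℕ) (β : W) (c : W × ℕ × ℕ → ℕ) :
    ∀ᶠ c' in near c univ, (anc A c' x β).2 = (anc A c x β).2 :=
  (eventually_anc A c x β).mono fun _ h => by rw [h]

theorem isFunction_seq (x : W × ℕ) (p : CohenPoset W) :
    isFunction (seq A κ x) (ord x.1) omega p := by
  refine isFunction_ofForm (fun _ => mono_decided _) ?_ ?_ ?_
  · exact fun q _ i _ => ⟨ord_mem_ord i.1.2 q, nat_mem_omega _ _⟩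
  · intro q _ a ha
    refine Dense.bind (mem_ord.1 ha) ?_
    rintro r hr ⟨β, hβ, he⟩ s hs
    obtain ⟨t, ht, n, hn⟩ := dense_decided_eq (κ := κ) (p := s)
      (eventually_anc_snd (A := A) x (Order.succ β)) s le_rfl
    exact ⟨t, ht, ⟨⟨β, hβ⟩, ⟨n⟩⟩, hn, mono_eq _ _ (ht.trans hs) he⟩
  · rintro q _ ⟨⟨β, hβ⟩, ⟨m⟩⟩ ⟨⟨γ, hγ⟩, ⟨n⟩⟩ hi hj he
    obtain rfl : β = γ := ord_inj he
    rw [decided_eq_unique hi hj]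
    exact eq_refl _ _

theorem isSequence_seq (x : W × ℕ) (p : CohenPoset W) : isSequence (seq A κ x) (ord x.1) p :=
  ⟨isCountableOrdinal_ord _ _, ex_intro omega
    ((regular_isOmega _).mono.and (regular_isFunction _ _ _).mono)
    ⟨isOmega_iff.2 (eq_refl _ _), isFunction_seq x p⟩⟩

theorem anc_anc {x : W × ℕ} {β γ : W} (h : γ ≤ β) (h' : β ≤ x.1) :
    anc A c (anc A c x β) γ = anc A c x γ :=
  (((below_anc h').trans (below_anc h)).anc_eq).symm

theorem Below.anc_anc_eq {x y : W × ℕ} (h : Below (tree A c) x y) {γ : W} (hγ : γ ≤ y.1) :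
    anc A c x γ = anc A c y γ := (h.trans (below_anc hγ)).anc_eq

theorem sub_seq_of_below {x x' : W × ℕ} (h : Decided κ (fun c => Below (tree A c) x' x) p) :
    sub (seq A κ x) (seq A κ x') p := by
  intro z q hq hz
  refine (regular_mem _ _).bind (mem_seq.1 hz) ?_
  rintro r hr ⟨β, hβ, n, hn, he⟩
  obtain ⟨c, hc⟩ := exists_allows κ r
  have hrp := hr.trans hq
  have hl := (h c (hc.mono hrp)).1
  refine mem_congr_left (eq_symm he) (pair_mem_seq (hβ.trans_le hl) fun c hc => ?_)
  dsimp only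
  rw [(h c (hc.mono hrp)).anc_anc_eq (Order.succ_le_of_lt hβ)]
  exact hn c hc

/-- Conditions extending `p` and still allowing the given `c` decide the two entries at `β`; the
inclusion then forces the decided numbers to be equal. -/
theorem anc_succ_eq_of_sub {x x' : W × ℕ} (h : sub (seq A κ x) (seq A κ x') p)
    (hc : p.Allows κ c) {β : W} (hβ : β < x.1) : β < x'.1 ∧
      (anc A c x (Order.succ β)).2 = (anc A c x' (Order.succ β)).2 := by
  obtain ⟨q, hq, hqc, h1⟩ := exists_decided_eq hc
    (eventually_anc_snd (A := A) x (Order.succ β) c)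
  have h2 := h _ q hq (pair_mem_seq hβ h1)
  have hβ' : β < x'.1 := by
    obtain ⟨r, -, γ, hγ, he⟩ :=
      mem_ord.1 ((isFunction_seq x' q).mem_of_pair h2).1 q le_rfl
    exact ord_inj he ▸ hγ
  refine ⟨hβ', ?_⟩
  obtain ⟨r, hr, hrc, h3⟩ := exists_decided_eq hqc
    (eventually_anc_snd (A := A) x' (Order.succ β) c)
  exact nat_inj ((isFunction_seq x' r).eq_of_mem ((regular_mem _ _).mono hr h2)
    (pair_mem_seq hβ' h3))

/-- At a successor level the last entry of the sequence is the index of the node itself. At a limit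
level two nodes might have the same predecessors for one particular `c`, but no condition can force
this. -/
theorem decided_below_of_sub {x x' : Node W} (h : sub (seq A κ x.1) (seq A κ x'.1) p) :
    Decided κ (fun c => Below (tree A c) x'.1 x.1) p := by
  intro c hc
  have hl : x.1.1 ≤ x'.1.1 := by
    by_contra! hl
    exact (anc_succ_eq_of_sub h hc hl).1.false
  rw [below_iff_anc hl]
  by_contra hne
  by_cases hb : x.1.1 = ⊥
  · refine hne ?_
    rw [hb, anc_bot x'.2]
    exact Prod.ext hb.symm (x.2 hb).symm
  by_cases hlim : ∀ β < x.1.1, ∃ γ, β < γ ∧ γ < x.1.1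
  · obtain ⟨q, hq, hqc, h1⟩ := exists_decided_eq hc (eventually_anc A c x'.1 x.1.1)
    -- The new function agrees with `c` on every coordinate mentioned by `q`, so `q` allows it,
    -- although it separates the two nodes whose sequences `q` forces to be comparable.
    obtain ⟨c', hc', γ, hγ, hne'⟩ := exists_separation (A := A) (c := c) (x := x.1)
      (y := anc A c x'.1 x.1.1) (Ne.symm hne) rfl hb hlim
      (q.graph.image fun l => (κ.symm l.1).1)
    have hqc' : q.Allows κ c' := hqc.congr fun l hl => hc' _ (Finset.mem_image_of_mem _ hl)
    have h2 := (anc_succ_eq_of_sub h (hqc'.mono hq) hγ).2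
    have h3 : anc A c' x.1 (Order.succ γ) = anc A c' x'.1 (Order.succ γ) := Prod.ext rfl h2
    refine hne' ?_
    have hs := Order.succ_le_of_lt hγ
    rw [← h1 c' hqc', anc_anc hγ.le hl, ← anc_anc (Order.le_succ γ) hs, h3,
      anc_anc (Order.le_succ γ) (hs.trans hl)]
  · push Not at hlim
    obtain ⟨β, hβ, hβ'⟩ := hlim
    have hs : Order.succ β = x.1.1 := by
      refine le_antisymm (Order.succ_le_of_lt hβ) (hβ' _ (Order.lt_succ β))
    have h2 := (anc_succ_eq_of_sub h hc hβ).2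
    rw [hs, (Below.refl x.1).anc_eq] at h2
    exact hne (Prod.ext rfl h2.symm)

theorem sub_seq_iff {x x' : Node W} : sub (seq A κ x.1) (seq A κ x'.1) p ↔
    Decided κ (fun c => Below (tree A c) x'.1 x.1) p :=
  ⟨decided_below_of_sub, sub_seq_of_below⟩

theorem seq_inj {x x' : Node W} (h : eq (seq A κ x.1) (seq A κ x'.1) p) : x = x' := by
  obtain ⟨c, hc⟩ := exists_allows κ p
  exact Subtype.ext ((sub_seq_iff.1 (sub_of_eq (eq_symm h)) c hc).antisymm
    (sub_seq_iff.1 (sub_of_eq h) c hc))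

theorem dense_decided_anc (x : W × ℕ) (β : W) :
    Dense (fun r => ∃ y, Decided κ (fun c => anc A c x β = y) r) p :=
  dense_decided_eq fun c => eventually_anc A c x β

/-! ### The tree -/

variable (A κ) in
/-- The name for the tree. -/
noncomputable def treeName : PName (CohenPoset W) := setOf fun x : Node W => seq A κ x.1

theorem mem_treeName {z : PName (CohenPoset W)} :
    mem z (treeName A κ) p ↔ Dense (fun r => ∃ x : Node W, eq z (seq A κ x.1) r) p := Forcing.mem_setOf

theorem seq_mem_treeName (x : Node W) (p : CohenPoset W) : mem (seq A κ x.1) (treeName A κ) p :=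
  mem_setOf_self (x := fun x : Node W => seq A κ x.1) x p

theorem isNode_seq (x : Node W) (p : CohenPoset W) :
    isNode (treeName A κ) (seq A κ x.1) (ord x.1.1) p :=
  ⟨seq_mem_treeName x p, isSequence_seq x.1 p⟩

theorem isSequence.eq_ord {s a : PName (CohenPoset W)} {x : W × ℕ} (h : isSequence s a p)
    (hs : eq s (seq A κ x) p) : eq a (ord x.1) p := by
  refine (regular_eq _ _).bind h.2 ?_
  rintro q hq ⟨w, -, hf⟩
  exact isFunction.domain_eq
    ((Cong.isFunction (mono_eq _ _ hq hs) (eq_refl _ _) (eq_refl _ _)).mp hf) (isFunction_seq x q)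

theorem dense_of_isNode {s a : PName (CohenPoset W)} (h : isNode (treeName A κ) s a p) :
    Dense (fun r => ∃ x : Node W, eq s (seq A κ x.1) r ∧ eq a (ord x.1.1) r) p := by
  refine Dense.bind (mem_treeName.1 h.1) ?_
  rintro q hq ⟨x, hx⟩ r hr
  exact ⟨r, le_rfl, x, mono_eq _ _ hr hx,
    mono_eq _ _ hr (isSequence.eq_ord ((regular_isSequence _ _).mono hq h.2) hx)⟩

theorem bot_node : ((⊥ : W), 0).1 = (⊥ : W) → ((⊥ : W), 0).2 = 0 := fun _ => rfl

/-- Every node has extensions at all higher levels, for all `c`. -/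
theorem exists_extension (x : Node W) {β : W} (h : x.1.1 ≤ β) :
    ∃ x' : Node W, x'.1.1 = β ∧ ∀ c, Below (tree A c) x'.1 x.1 := by
  rcases h.eq_or_lt with rfl | h
  · exact ⟨x, rfl, fun c => .refl _⟩
  · obtain ⟨m, -, hm⟩ := exists_child A x.1 x.2 h 0
    exact ⟨⟨(β, m), fun hb => absurd hb (ne_bot_of_gt h)⟩, rfl, hm⟩

/-- The domain of `r` is a transitive subset of some `ord α`, hence densely an `ord β`. Once the
predecessor of level `β` is decided, its sequence and `r` are functions on one domain inside the
same sequence, so they are equal. -/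
theorem mem_treeName_of_restrict {s r b : PName (CohenPoset W)} (hs : mem s (treeName A κ) p)
    (hr : isSequence r b p) (h : sub r s p) : mem r (treeName A κ) p := by
  refine (regular_mem _ _).bind (mem_treeName.1 hs) ?_
  rintro q hq ⟨x, hx⟩
  have hrq := (regular_isSequence _ _).mono hq hr
  refine (regular_mem _ _).bind hrq.2 ?_
  rintro q₁ hq₁ ⟨w, hw, hf⟩
  have hsub : sub r (seq A κ x.1) q₁ := sub_trans ((regular_sub _ _).mono (hq₁.trans hq) h)
    (sub_of_eq (mono_eq _ _ hq₁ hx))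
  refine (regular_mem _ _).bind (dense_eq_ord_of_sub
    ((regular_isTransitive _).mono hq₁ hrq.1.1) (hf.sub_domain (isFunction_seq x.1 q₁) hsub)) ?_
  rintro q₂ hq₂ ⟨β, hβ, hb⟩
  refine (regular_mem _ _).bind (dense_decided_anc (A := A) (κ := κ) x.1 β) ?_
  rintro q₃ hq₃ ⟨y, hy⟩
  obtain ⟨c₀, hc₀⟩ := exists_allows κ q₃
  have hyβ : y.1 = β := by rw [← hy c₀ hc₀]; rfl
  let x' : Node W := ⟨y, fun h => by
    rw [← hy c₀ hc₀, show β = ⊥ from hyβ.symm.trans h, anc_bot x.2]⟩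
  have h32 := hq₃.trans hq₂
  have hf' : isFunction r (ord x'.1.1) w q₃ := by
    refine (Cong.isFunction (eq_refl _ _) ?_ (eq_refl _ _)).mp
      ((regular_isFunction _ _ _).mono h32 hf)
    change eq b (ord y.1) q₃
    rw [hyβ]
    exact mono_eq _ _ hq₃ hb
  have hsub' := (regular_sub _ _).mono h32 hsub
  have hsub2 : sub (seq A κ x'.1) (seq A κ x.1) q₃ := sub_seq_of_below fun c hc => by
    rw [← show anc A c x.1 β = x'.1 from hy c hc]
    exact below_anc hβ
  have hfx := isFunction_seq (A := A) (κ := κ) x.1 q₃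
  have hfx' := isFunction_seq (A := A) (κ := κ) x'.1 q₃
  exact mem_congr_left (eq_of_sub (hfx'.sub_of_sub hf' hfx hsub2 hsub')
    (hf'.sub_of_sub hfx' hfx hsub' hsub2)) (seq_mem_treeName x' q₃)

variable (A κ) in
/-- The name for a level of the tree. -/
noncomputable def levelName (α : W) : PName (CohenPoset W) :=
  setOf fun x : {x : Node W // x.1.1 = α} => seq A κ x.1.1

theorem isCountable_levelName (α : W) (p : CohenPoset W) : isCountable (levelName A κ α) p := by
  have : Countable {x : Node W // x.1.1 = α} := by
    refine Function.Injective.countable (f := fun x => x.1.1.2) fun x y h => ?_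
    exact Subtype.ext (Subtype.ext (Prod.ext (x.2.trans y.2.symm) h))
  exact isCountable_of (fun x : {x : Node W // x.1.1 = α} => seq A κ x.1.1)
    (fun q _ z hz => Forcing.mem_setOf.1 hz) fun q _ i j _ _ he => Subtype.ext (seq_inj he)

theorem mem_levelName_iff {α : W} {a : PName (CohenPoset W)} (ha : eq a (ord α) p)
    (s : PName (CohenPoset W)) :
    mem s (levelName A κ α) p ↔ isNode (treeName A κ) s a p := by
  constructor
  · intro h
    refine (regular_isNode _ _ _).bind (Forcing.mem_setOf.1 h) ?_
    rintro q hq ⟨⟨x, rfl⟩, he⟩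
    exact (Cong.isNode (eq_symm he) (eq_symm (mono_eq _ _ hq ha))).mp (isNode_seq x q)
  · intro h
    refine (regular_mem _ _).bind (dense_of_isNode h) ?_
    rintro q hq ⟨x, he, hx⟩
    obtain rfl : x.1.1 = α := ord_inj (eq_trans (eq_symm hx) (mono_eq _ _ hq ha))
    exact mem_congr_left (eq_symm he) (mem_setOf_self (x := fun x' : {x' : Node W //
      x'.1.1 = x.1.1} => seq A κ x'.1.1) ⟨x, rfl⟩ q)

/-- The chain condition enters only through the countable ordinals of the extension: in the clauses
on levels and on extensions they have to be replaced by canonical names. -/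
theorem isOmegaOneTree_treeName (hP : CCC (CohenPoset W) W) (p : CohenPoset W) :
    isOmegaOneTree (treeName A κ) p := by
  refine ⟨?_, ?_, ?_, ?_, ?_, ?_⟩
  · exact ex_intro _ (regular_mem _ _).mono (seq_mem_treeName ⟨(⊥, 0), bot_node⟩ p)
  · intro s q _ hs
    refine (regular_ex _).bind (mem_treeName.1 hs) ?_
    rintro r _ ⟨x, hx⟩
    exact ex_intro (ord x.1.1) (regular_isSequence _ _).mono
      ((Cong.isSequence (eq_symm hx) (eq_refl _ _)).mp (isSequence_seq x.1 r))
  · intro s r b q _ hs q₁ h₁ hr q₂ h₂ h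
    exact mem_treeName_of_restrict ((regular_mem _ _).mono (h₂.trans h₁) hs)
      ((regular_isSequence _ _).mono h₂ hr) h
  · intro a q _ ha
    refine (regular_ex _).bind (hP.dense_eq_ord ha) ?_
    rintro r _ ⟨α, hα⟩
    refine ex_intro (levelName A κ α) ((Mono.all fun _ =>
      (Regular.iff (regular_mem _ _) (regular_isNode _ _ _)).mono).and
      (regular_isCountable _).mono) ⟨fun s => ?_, isCountable_levelName α r⟩
    exact ⟨fun t ht h => (mem_levelName_iff (mono_eq _ _ ht hα) s).1 h,
      fun t ht h => (mem_levelName_iff (mono_eq _ _ ht hα) s).2 h⟩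
  · intro s a b q _ hs q₁ h₁ hb q₂ h₂ hab
    refine (regular_ex _).bind (dense_of_isNode ((regular_isNode _ _ _).mono (h₂.trans h₁) hs)) ?_
    rintro q₃ h₃ ⟨x, hx, hxa⟩
    refine (regular_ex _).bind (Forcing.Dense.mono (h₃.trans h₂) (hP.dense_eq_ord hb)) ?_
    rintro q₄ h₄ ⟨β, hβ⟩
    have hle : x.1.1 ≤ β := le_of_sub_ord (p := q₄) (sub_trans
      (sub_of_eq (eq_symm (mono_eq _ _ h₄ hxa)))
      (sub_trans ((regular_sub _ _).mono (h₄.trans h₃) hab) (sub_of_eq hβ)))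
    obtain ⟨x', rfl, hx'⟩ := exists_extension (A := A) x hle
    refine ex_intro (seq A κ x'.1) ((regular_isNode _ _ _).mono.and (regular_sub _ _).mono) ⟨?_, ?_⟩
    · exact (Cong.isNode (eq_refl _ _) (eq_symm hβ)).mp (isNode_seq x' q₄)
    · exact sub_trans (sub_of_eq (mono_eq _ _ h₄ hx)) (sub_seq_of_below fun c _ => hx' c)
  · intro s a n q _ hs q₁ h₁ hn
    refine (regular_ex _).bind (dense_of_isNode ((regular_isNode _ _ _).mono h₁ hs)) ?_
    rintro q₂ h₂ ⟨x, hx, hxa⟩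
    refine (regular_ex _).bind (Forcing.Dense.mono h₂ (isNat_iff_dense.1 hn)) ?_
    rintro q₃ h₃ ⟨k, hk⟩
    -- Starting at `k + 1` makes `m` larger than the given number, and `m` is the entry of the
    -- successor's sequence at the level of `x`.
    obtain ⟨m, hm, hmx⟩ := exists_child A x.1 x.2 (Order.lt_succ x.1.1) (k + 1)
    let x' : Node W := ⟨(Order.succ x.1.1, m), fun hb => absurd hb
      (ne_bot_of_gt (Order.lt_succ x.1.1))⟩
    have hmono : ∀ m t, Mono (isNat m ∧ᶠ n ∈ᶠ m ∧ᶠ t ∈ᶠ treeName A κ ∧ᶠ s ⊆ᶠ t ∧ᶠ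
        pairMem a m t) := fun m t => (regular_isNat _).mono.and ((regular_mem _ _).mono.and
      ((regular_mem _ _).mono.and ((regular_sub _ _).mono.and (regular_pairMem _ _ _).mono)))
    refine ex_intro (nat m) (regular_ex _).mono (ex_intro (seq A κ x'.1) (hmono _ _)
      ⟨isNat_nat m q₃, ?_, seq_mem_treeName x' q₃, ?_, ?_⟩)
    · exact mem_congr_left (eq_symm hk) (nat_mem_nat hm q₃)
    · exact sub_trans (sub_of_eq (mono_eq _ _ h₃ hx)) (sub_seq_of_below fun c _ => hmx c)
    · refine pairMem_iff.2 (mem_congr_left (pair_congr (eq_symm (mono_eq _ _ h₃ hxa))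
        (eq_refl _ _)) (pair_mem_seq (x := x'.1) (Order.lt_succ x.1.1) fun c _ => ?_))
      exact congrArg Prod.snd (Below.refl (A := A) (c := c) x'.1).anc_eq

end GenericTree

namespace GenericTree
open CohenPoset Forcing

variable {T W : Type u} [LinearOrder W] [OrderBot W] [OmegaOne W] [SuccOrder W] [PartialOrder T]
  {A : LevelTree T W} {κ : (W × ℕ × ℕ) × ℕ ≃ W} {p : CohenPoset W} {c : W × ℕ × ℕ → ℕ}

/-! ### Antichains and chains -/

/-- The case of empty tuples, in which only compatibility of the conditions is left. -/
theorem ccc_cohenPoset (A : LevelTree T W) (κ : (W × ℕ × ℕ) × ℕ ≃ W) :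
    CCC (CohenPoset W) W := fun p => by
  obtain ⟨ξ, η, hne, r, h1, h2, -⟩ := exists_common_extension A κ (ι := Empty) p
    (fun _ i => i.elim) (fun i => i.elim) (fun i => i.elim) (fun i => i.elim)
    (fun _ i => i.elim) (fun _ _ _ i => i.elim)
  exact ⟨ξ, η, hne, r, h1, h2⟩

theorem exists_common_node {ι : Type*} [Finite ι] (q : W → CohenPoset W) (a : W → ι → Node W)
    (s : ι → Node W) (hs : Function.Injective s) (hsl : ∀ i j, (s i).1.1 = (s j).1.1)
    (h : ∀ ξ i, Decided κ (fun c => Below (tree A c) (a ξ i).1 (s i).1) (q ξ)) :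
    ∃ ξ η, ξ ≠ η ∧ ∃ r ≤ q ξ, r ≤ q η ∧ ∃ e : ι → Node W, ∀ i,
      Decided κ (fun c => Below (tree A c) (e i).1 (a ξ i).1) r ∧
      Decided κ (fun c => Below (tree A c) (e i).1 (a η i).1) r := by
  obtain ⟨ξ, η, hne, r, h1, h2, e, he, h3⟩ := exists_common_extension A κ q
    (fun ξ i => (a ξ i).1) (fun i => (s i).1) (Subtype.val_injective.comp hs) hsl
    (fun ξ i => (a ξ i).2) (fun ξ c hc i => h ξ i c hc)
  exact ⟨ξ, η, hne, r, h1, h2, fun i => ⟨e i, fun hb => absurd hb (he i)⟩,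
    fun i => ⟨fun c hc => (h3 c hc i).1, fun c hc => (h3 c hc i).2⟩⟩

variable (W) in
/-- The root of the tree. -/
def root : Node W := ⟨(⊥, 0), bot_node⟩

theorem below_root (x : Node W) : Below (tree A c) x.1 (root W).1 :=
  ⟨bot_le, (Prod.ext_iff.1 (anc_bot x.2)).2⟩

/-- A set of nodes is countable if there is no injective family of nodes indexed by `W` all of which
can be forced to be elements. -/
theorem isCountable_of_sub_treeName {X : PName (CohenPoset W)} (hX : sub X (treeName A κ) p)
    (h : ∀ (f : W → Node W) (q : W → CohenPoset W), Function.Injective f → (∀ ξ, q ξ ≤ p) →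
      (∀ ξ, mem (seq A κ (f ξ).1) X (q ξ)) → False) : isCountable X p :=
  isCountable_of_forall (W := W) (fun x : Node W => seq A κ x.1)
    (fun q hq z hz => mem_treeName.1 (hX z q hq hz)) (fun _ _ _ _ _ _ he => seq_inj he) h

/-- One-element tuples over the root: two elements with a common node below them are comparable, so
an uncountable family contradicts the antichain property. -/
theorem isCountable_of_antichain {X : PName (CohenPoset W)} (hX : sub X (treeName A κ) p)
    (h : (all fun s => all fun t => s ∈ᶠ X →ᶠ t ∈ᶠ X →ᶠ s ⊆ᶠ t →ᶠ s ≐ t) p) :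
    isCountable X p := by
  refine isCountable_of_sub_treeName hX fun f q hf hq hm => ?_
  obtain ⟨ξ, η, hne, r, h1, h2, e, he⟩ := exists_common_node (A := A) (κ := κ) (ι := Unit) q
    (fun ξ _ => f ξ) (fun _ => root W) (fun _ _ _ => rfl) (fun _ _ => rfl)
    (fun ξ _ c _ => below_root (f ξ))
  have key : ∀ ξ η, mem (seq A κ (f ξ).1) X r → mem (seq A κ (f η).1) X r →
      Decided κ (fun c => Below (tree A c) (e ()).1 (f ξ).1) r →
      Decided κ (fun c => Below (tree A c) (e ()).1 (f η).1) r →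
      (f ξ).1.1 ≤ (f η).1.1 → f ξ = f η := by
    intro ξ η h3 h4 h5 h6 hl
    refine seq_inj (h _ _ r (h1.trans (hq _)) h3 r le_rfl h4 r le_rfl ?_)
    exact sub_seq_iff.2 fun c hc => (h6 c hc).of_le (h5 c hc) hl
  have h3 := (regular_mem _ _).mono h1 (hm ξ)
  have h4 := (regular_mem _ _).mono h2 (hm η)
  rcases le_total (f ξ).1.1 (f η).1.1 with hl | hl
  · exact hne (hf (key ξ η h3 h4 (he ()).1 (he ()).2 hl))
  · exact hne (hf (key η ξ h4 h3 (he ()).2 (he ()).1 hl).symm)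

/-- For every element `x` of a chain, there is an immediate successor of `x` that can be forced
to have no elements of the chain below it. -/
theorem exists_avoiding_child {X : PName (CohenPoset W)}
    (h : (all fun s => all fun t => s ∈ᶠ X →ᶠ t ∈ᶠ X →ᶠ s ⊆ᶠ t ∨ᶠ t ⊆ᶠ s) p) (x : Node W) :
    ∃ q ≤ p, ∃ z : Node W, z.1.1 = Order.succ x.1.1 ∧ (∀ c, Below (tree A c) z.1 x.1) ∧
      ∀ r ≤ q, ∀ w : Node W, mem (seq A κ w.1) X r → ∀ c, r.Allows κ c →
        ¬ Below (tree A c) w.1 z.1 := by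
  obtain ⟨m, -, hm⟩ := exists_child A x.1 x.2 (Order.lt_succ x.1.1) 0
  obtain ⟨n, hn, hn'⟩ := exists_child A x.1 x.2 (Order.lt_succ x.1.1) (m + 1)
  have hb : ∀ m, (Order.succ x.1.1, m).1 = ⊥ → (Order.succ x.1.1, m).2 = 0 := fun m hb =>
    absurd hb (ne_bot_of_gt (Order.lt_succ x.1.1))
  -- A chain cannot pass below both of two distinct immediate successors. If some condition puts an
  -- element below the first one, the second is avoided from there on; if none does, the first is
  -- avoided.
  by_cases hex : ∃ r ≤ p, ∃ w : Node W, mem (seq A κ w.1) X r ∧ ∃ c, r.Allows κ c ∧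
    Below (tree A c) w.1 (Order.succ x.1.1, m)
  · obtain ⟨r, hr, w, hw, c, hc, hwb⟩ := hex
    obtain ⟨q, hq, -, hqw⟩ := exists_le_of_eventually hc
      ((eventually_below (A := A) (c := c) w.1 (Order.succ x.1.1, m)).mono fun _ h => h.2 hwb)
    refine ⟨q, hq.trans hr, ⟨(Order.succ x.1.1, n), hb n⟩, rfl, hn', ?_⟩
    intro s hs w' hw' d hd hwb'
    obtain ⟨s', hs', -, hsw⟩ := exists_le_of_eventually hd
      ((eventually_below (A := A) (c := d) w'.1 (Order.succ x.1.1, n)).mono fun _ h => h.2 hwb')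
    have hsq := hs'.trans hs
    have hsp := hsq.trans (hq.trans hr)
    obtain ⟨t, ht, hcomp⟩ := h _ _ s' hsp ((regular_mem _ _).mono (hsq.trans hq) hw) s' le_rfl
      ((regular_mem _ _).mono hs' hw') s' le_rfl
    obtain ⟨d', hd'⟩ := exists_allows κ t
    have h1 := hqw d' (hd'.mono (ht.trans hsq))
    have h2 := hsw d' (hd'.mono ht)
    have h3 : (Order.succ x.1.1, m) = (Order.succ x.1.1, n) := by
      rcases hcomp with hcomp | hcomp
      · exact (((sub_seq_iff.1 hcomp) d' hd').trans h1).eq_of_level_eq h2 rfl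
      · exact h1.eq_of_level_eq (((sub_seq_iff.1 hcomp) d' hd').trans h2) rfl
    have h4 := congrArg Prod.snd h3
    dsimp only at h4
    omega
  · push Not at hex
    exact ⟨p, le_rfl, ⟨(Order.succ x.1.1, m), hb m⟩, rfl, hm,
      fun r hr w hw c hc => hex r hr w hw c hc⟩

/-- Attach to each element an immediate successor which the chain avoids. If two of these successors
get a common node below them, the elements themselves are comparable, and the lower one lies below
the avoided successor of the higher one, a contradiction. -/
theorem isCountable_of_chain {X : PName (CohenPoset W)} (hX : sub X (treeName A κ) p)
    (h : (all fun s => all fun t => s ∈ᶠ X →ᶠ t ∈ᶠ X →ᶠ s ⊆ᶠ t ∨ᶠ t ⊆ᶠ s) p) :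
    isCountable X p := by
  refine isCountable_of_sub_treeName hX fun f q hf hq hm => ?_
  choose q' hq' z hz hzf hno using fun ξ => exists_avoiding_child (A := A) (κ := κ)
    ((Mono.all fun _ => Mono.all fun _ => mono_imp _ _) (hq ξ) h) (f ξ)
  obtain ⟨ξ, η, hne, r, h1, h2, e, he⟩ := exists_common_node (A := A) (κ := κ) (ι := Unit) q'
    (fun ξ _ => z ξ) (fun _ => root W) (fun _ _ _ => rfl) (fun _ _ => rfl)
    (fun ξ _ c _ => below_root (z ξ))
  obtain ⟨c, hc⟩ := exists_allows κ r
  have key : ∀ ξ η, ξ ≠ η → r ≤ q' ξ → r ≤ q' η → Below (tree A c) (e ()).1 (z ξ).1 →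
      Below (tree A c) (e ()).1 (z η).1 → (f ξ).1.1 ≤ (f η).1.1 → False := by
    intro ξ η hne h1 h2 h3 h4 hl
    have h5 := h4.trans (hzf η c)
    have h6 : Below (tree A c) (f η).1 (f ξ).1 := h5.of_le (h3.trans (hzf ξ c)) hl
    have h7 : (f ξ).1.1 < (f η).1.1 :=
      h6.lt_of_ne fun he => hne (hf (Subtype.ext he)).symm
    refine hno ξ r h1 (f η) ((regular_mem _ _).mono (h2.trans (hq' η)) (hm η)) c hc
      (h5.of_le h3 ?_)
    rw [hz]
    exact Order.succ_le_of_lt h7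
  rcases le_total (f ξ).1.1 (f η).1.1 with hl | hl
  · exact key ξ η hne h1 h2 ((he ()).1 c hc) ((he ()).2 c hc) hl
  · exact key η ξ hne.symm h2 h1 ((he ()).2 c hc) ((he ()).1 c hc) hl

theorem isSouslin_treeName (p : CohenPoset W) : isSouslin (treeName A κ) p :=
  ⟨isOmegaOneTree_treeName (ccc_cohenPoset A κ) p,
    fun _ _ _ h _ hq h' => isCountable_of_chain ((regular_sub _ _).mono hq h) h',
    fun _ _ _ h _ hq h' => isCountable_of_antichain ((regular_sub _ _).mono hq h) h'⟩

/-! ### Products -/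

/-- A finite set of nodes can be decided. -/
theorem dense_finite_eq {F : PName (CohenPoset W)} (hF : sub F (treeName A κ) p)
    (hfin : isFinite F p) : Dense (fun r => ∃ Φ : Finset (Node W),
      (∀ x ∈ Φ, mem (seq A κ x.1) F r) ∧
      ∀ q ≤ r, ∀ z, mem z F q → Forcing.Dense (fun r => ∃ x ∈ Φ, eq z (seq A κ x.1) r) q) p := by
  classical
  refine Forcing.Dense.bind hfin ?_
  rintro p₁ hp₁ ⟨n, hn⟩
  refine Forcing.Dense.bind hn ?_
  rintro p₂ hp₂ ⟨f, hnat, hf, hinj⟩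
  refine Forcing.Dense.bind (isNat_iff_dense.1 hnat) ?_
  rintro p₃ hp₃ ⟨k, hk⟩ q hq
  have hqp₂ := hq.trans hp₃
  have hf' : isFunction f F (nat k) q := (Cong.isFunction (eq_refl _ _) (eq_refl _ _)
    (mono_eq _ _ hq hk)).mp ((regular_isFunction _ _ _).mono hqp₂ hf)
  have hinj' := (regular_isInjective _).mono hqp₂ hinj
  -- The injection of `F` into `nat k`, decided on finitely many names at once, bounds the number of
  -- nodes forced into `F`.
  have hcard : ∀ Φ : Finset (Node W), ∀ r ≤ q, (∀ x ∈ Φ, mem (seq A κ x.1) F r) → Φ.card ≤ k := by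
    intro Φ r hr hΦ
    obtain ⟨s, hs, g, hg⟩ := exists_le_forall_finset
      (φ := fun (x : Node W) (v : ℕ) r => v < k ∧ mem (pair (seq A κ x.1) (nat v)) f r)
      (fun x v _ _ h h' => ⟨h'.1, (regular_mem _ _).mono h h'.2⟩) Φ (p := r) (by
        intro x hx
        refine Forcing.Dense.bind (((regular_isFunction _ _ _).mono hr hf').exists_value
          (hΦ x hx)) ?_
        rintro s hs ⟨y, hy, hyf⟩ t ht
        obtain ⟨t', ht', m, hm, he⟩ := mem_nat.1 hy t ht
        exact ⟨t', ht', m, hm, mem_congr_left (pair_congr (eq_refl _ _) he)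
          ((regular_mem _ _).mono (ht'.trans ht) hyf)⟩)
    have := Finset.card_le_card_of_injOn (s := Φ) (t := Finset.range k) g
      (fun x hx => Finset.mem_coe.2 (Finset.mem_range.2 (hg x hx).1)) (by
        intro x hx y hy hxy
        have h1 := (hg x hx).2
        rw [hxy] at h1
        exact seq_inj (hinj' _ _ _ s (hs.trans hr) (pairMem_iff.2 h1) s le_rfl
          (pairMem_iff.2 (hg y hy).2)))
    rwa [Finset.card_range] at this
  -- A set of nodes of the largest possible size that some condition forces into `F`: any further
  -- element at a stronger condition would give a larger set.
  let Q : ℕ → Prop := fun n => ∃ Φ : Finset (Node W), Φ.card = n ∧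
    ∃ r ≤ q, ∀ x ∈ Φ, mem (seq A κ x.1) F r
  have hQ : Q (Nat.findGreatest Q k) :=
    Nat.findGreatest_spec (P := Q) (Nat.zero_le k) ⟨∅, rfl, q, le_rfl, by simp⟩
  obtain ⟨Φ, hΦ, r, hr, hm⟩ := hQ
  refine ⟨r, hr, Φ, hm, fun s hs z hz t ht => ?_⟩
  obtain ⟨t', ht', x, hx⟩ := mem_treeName.1
    (hF z s (hs.trans (hr.trans (hqp₂.trans (hp₂.trans hp₁)))) hz) t ht
  refine ⟨t', ht', x, ?_, hx⟩
  by_contra hxΦ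
  have hle : t' ≤ q := ht'.trans (ht.trans (hs.trans hr))
  have hm' : ∀ y ∈ insert x Φ, mem (seq A κ y.1) F t' := by
    intro y hy
    rcases Finset.mem_insert.1 hy with rfl | hy
    · exact mem_congr_left hx ((regular_mem _ _).mono (ht'.trans ht) hz)
    · exact (regular_mem _ _).mono (ht'.trans (ht.trans hs)) (hm y hy)
  have h1 := Nat.le_findGreatest (P := Q) (hcard _ t' hle hm') ⟨_, rfl, t', hle, hm'⟩
  rw [Finset.card_insert_of_notMem hxΦ] at h1
  omega

/-! ### Elements of the product over a decided finite set of nodes -/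

section Product
variable {Φ : Finset (Node W)} {F : PName (CohenPoset W)}

variable (A κ) in
/-- The name for the element of the product with coordinates `a i`. -/
noncomputable def tuple {Φ : Finset (Node W)} (a : {x // x ∈ Φ} → Node W) :
    PName (CohenPoset W) :=
  ofForm (fun i : {x // x ∈ Φ} => pair (seq A κ i.1.1) (seq A κ (a i).1)) fun _ _ => True

theorem mem_pair_tuple {a : {x // x ∈ Φ} → Node W} {s t : PName (CohenPoset W)} :
    mem (pair s t) (tuple A κ a) p ↔ Forcing.Dense (fun r => ∃ i, eq s (seq A κ i.1.1) r ∧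
      eq t (seq A κ (a i).1) r) p := by
  rw [tuple, mem_pair_ofForm (fun _ _ _ _ h => h)]
  simp only [true_and]

theorem pair_mem_tuple (a : {x // x ∈ Φ} → Node W) (i : {x // x ∈ Φ}) (p : CohenPoset W) :
    mem (pair (seq A κ i.1.1) (seq A κ (a i).1)) (tuple A κ a) p :=
  mem_pair_tuple.2 fun q _ => ⟨q, le_rfl, i, eq_refl _ _, eq_refl _ _⟩

theorem tuple_inj {a a' : {x // x ∈ Φ} → Node W} (h : eq (tuple A κ a) (tuple A κ a') p) :
    a = a' := by
  funext i
  obtain ⟨q, -, j, h1, h2⟩ :=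
    mem_pair_tuple.1 (mem_congr_right h (pair_mem_tuple a i p)) p le_rfl
  rw [seq_inj h2, Subtype.ext (seq_inj h1)]

theorem isFunction_tuple (hF : ∀ x ∈ Φ, mem (seq A κ x.1) F p)
    (hF' : ∀ q ≤ p, ∀ z, mem z F q → Forcing.Dense (fun r => ∃ x ∈ Φ, eq z (seq A κ x.1) r) q)
    (a : {x // x ∈ Φ} → Node W) : isFunction (tuple A κ a) F (treeName A κ) p := by
  refine isFunction_ofForm (fun _ _ _ _ h => h) ?_ ?_ ?_
  · exact fun q hq i _ => ⟨(regular_mem _ _).mono hq (hF i.1 i.2), seq_mem_treeName _ q⟩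
  · intro q hq z hz r hr
    obtain ⟨s, hs, x, hx, he⟩ := hF' q hq z hz r hr
    exact ⟨s, hs, ⟨x, hx⟩, trivial, he⟩
  · intro q _ i j _ _ he
    rw [Subtype.ext (seq_inj he)]
    exact eq_refl _ _

theorem inProduct_tuple_iff (hF : ∀ x ∈ Φ, mem (seq A κ x.1) F p)
    (hF' : ∀ q ≤ p, ∀ z, mem z F q → Forcing.Dense (fun r => ∃ x ∈ Φ, eq z (seq A κ x.1) r) q)
    {a : {x // x ∈ Φ} → Node W} : inProduct (treeName A κ) F (tuple A κ a) p ↔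
      ∀ i, Decided κ (fun c => Below (tree A c) (a i).1 i.1.1) p := by
  constructor
  · intro h i
    exact sub_seq_iff.1 (h.2 _ _ p le_rfl (pairMem_iff.2 (pair_mem_tuple a i p)))
  · refine fun h => ⟨isFunction_tuple hF hF' a, fun s t q hq hst => ?_⟩
    refine (regular_sub _ _).bind (mem_pair_tuple.1 (pairMem_iff.1 hst)) ?_
    rintro r hr ⟨i, h1, h2⟩
    exact sub_trans (sub_of_eq h1) (sub_trans (sub_seq_iff.2 (mono_decided _ (hr.trans hq) (h i)))
      (sub_of_eq (eq_symm h2)))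

theorem productLE_tuple {a e : {x // x ∈ Φ} → Node W}
    (h : ∀ i, Decided κ (fun c => Below (tree A c) (e i).1 (a i).1) p) :
    productLE (tuple A κ e) (tuple A κ a) p := by
  intro s t t' q hq hst r hr hst'
  refine (regular_sub _ _).bind
    (Forcing.Dense.mono hr (mem_pair_tuple.1 (pairMem_iff.1 hst))) ?_
  rintro r₁ hr₁ ⟨i, h1, h2⟩
  refine (regular_sub _ _).bind
    (Forcing.Dense.mono hr₁ (mem_pair_tuple.1 (pairMem_iff.1 hst'))) ?_
  rintro r₂ hr₂ ⟨j, h3, h4⟩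
  obtain rfl : i = j := Subtype.ext (seq_inj (eq_trans (eq_symm (mono_eq _ _ hr₂ h1)) h3))
  exact sub_trans (sub_of_eq (mono_eq _ _ hr₂ h2)) (sub_trans
    (sub_seq_iff.2 (mono_decided _ (hr₂.trans (hr₁.trans (hr.trans hq))) (h i)))
    (sub_of_eq (eq_symm h4)))

theorem dense_eq_tuple (hF : ∀ x ∈ Φ, mem (seq A κ x.1) F p)
    (hF' : ∀ q ≤ p, ∀ z, mem z F q → Forcing.Dense (fun r => ∃ x ∈ Φ, eq z (seq A κ x.1) r) q)
    {g : PName (CohenPoset W)} (hg : isFunction g F (treeName A κ) p) :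
    Forcing.Dense (fun r => ∃ a : {x // x ∈ Φ} → Node W, eq g (tuple A κ a) r) p := by
  have : Nonempty (Node W) := ⟨root W⟩
  intro q hq
  obtain ⟨r, hr, a, ha⟩ := exists_le_forall_finset
    (φ := fun (x v : Node W) => mem (pair (seq A κ x.1) (seq A κ v.1)) g)
    (fun x v => (regular_mem _ _).mono) Φ (p := q) (by
      intro x hx
      refine Forcing.Dense.bind (((regular_isFunction _ _ _).mono hq hg).exists_value
        ((regular_mem _ _).mono hq (hF x hx))) ?_
      rintro s hs ⟨y, hy, hyg⟩
      refine Forcing.Dense.bind (mem_treeName.1 hy) ?_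
      rintro t ht ⟨v, hv⟩ t' ht'
      exact ⟨t', le_rfl, v, mem_congr_left (pair_congr (eq_refl _ _) (mono_eq _ _ ht' hv))
        ((regular_mem _ _).mono (ht'.trans ht) hyg)⟩)
  refine ⟨r, hr, fun i => a i.1, ?_⟩
  have hsub : sub (tuple A κ fun i : {x // x ∈ Φ} => a i.1) g r := by
    intro z s hs hz
    refine forall_mem_ofForm (fun _ _ _ _ h => h) hz (regular_mem _ _) ?_
    intro t ht i _ he
    exact mem_congr_left (eq_symm he) ((regular_mem _ _).mono (ht.trans hs) (ha i.1 i.2))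
  have hrp := hr.trans hq
  have hgr := (regular_isFunction _ _ _).mono hrp hg
  have htr := isFunction_tuple (fun x hx => (regular_mem _ _).mono hrp (hF x hx))
    (fun q hq => hF' q (hq.trans hrp)) fun i : {x // x ∈ Φ} => a i.1
  exact eq_of_sub (hgr.sub_of_sub htr hgr (fun _ _ _ h => h) hsub) hsub

/-- Elements of the product are densely tuples of nodes indexed by `Φ`. The nodes in `Φ` are
distinct and on one level, so two members of an uncountable family get a common extension, which is
again in the product. -/
theorem productCCC_of_finset (hF : ∀ x ∈ Φ, mem (seq A κ x.1) F p)
    (hF' : ∀ q ≤ p, ∀ z, mem z F q → Forcing.Dense (fun r => ∃ x ∈ Φ, eq z (seq A κ x.1) r) q)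
    (hl : ∀ x ∈ Φ, ∀ y ∈ Φ, x.1.1 = y.1.1) : productCCC (treeName A κ) F p := by
  intro X q hq hX q' hq' hanti
  have hqp := hq'.trans hq
  have hFr : ∀ r ≤ p, ∀ x ∈ Φ, mem (seq A κ x.1) F r := fun r hr x hx =>
    (regular_mem _ _).mono hr (hF x hx)
  have hFr' : ∀ r ≤ p, ∀ q ≤ r, ∀ z, mem z F q →
      Forcing.Dense (fun r => ∃ x ∈ Φ, eq z (seq A κ x.1) r) q :=
    fun r hr q hq => hF' q (hq.trans hr)
  refine isCountable_of_forall (W := W) (J := {x // x ∈ Φ} → Node W) (fun a => tuple A κ a)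
    ?_ (fun _ _ _ _ _ _ h => tuple_inj h) ?_
  · intro r hr g hg
    have hrp := hr.trans hqp
    exact dense_eq_tuple (hFr r hrp) (hFr' r hrp) (hX g r (hr.trans hq') hg).1
  · intro f r hf hr hm
    obtain ⟨ξ, η, hne, s, h1, h2, e, he⟩ := exists_common_node (A := A) (κ := κ) r f
      (fun i : {x // x ∈ Φ} => i.1) Subtype.val_injective (fun i j => hl _ i.2 _ j.2) (by
        intro ξ i
        have hrp := (hr ξ).trans hqp
        exact (inProduct_tuple_iff (hFr _ hrp) (hFr' _ hrp)).1
          (hX _ _ ((hr ξ).trans hq') (hm ξ)) i)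
    have hsq : s ≤ q' := h1.trans (hr ξ)
    have hsp := hsq.trans hqp
    have h3 := (regular_mem _ _).mono h1 (hm ξ)
    have h4 := (regular_mem _ _).mono h2 (hm η)
    have h5 := (inProduct_tuple_iff (hFr s hsp) (hFr' s hsp)).1 (hX _ s (hsq.trans hq') h3)
    refine hne (hf (tuple_inj (hanti _ _ s hsq h3 s le_rfl h4 s le_rfl ?_)))
    refine ex_intro (tuple A κ e) ((regular_inProduct _ _ _).mono.and
      ((regular_productLE _ _).mono.and (regular_productLE _ _).mono)) ⟨?_, ?_, ?_⟩
    · exact (inProduct_tuple_iff (hFr s hsp) (hFr' s hsp)).2 fun i c hc =>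
        ((he i).1 c hc).trans (h5 i c hc)
    · exact productLE_tuple fun i => (he i).1
    · exact productLE_tuple fun i => (he i).2

end Product

theorem isFree_treeName (p : CohenPoset W) : isFree (treeName A κ) p := by
  refine ⟨isSouslin_treeName p, fun F q hq hF q₁ hq₁ hfin q₂ hq₂ hlev => ?_⟩
  refine (regular_productCCC _ _).bind hlev ?_
  rintro q₃ hq₃ ⟨a, ha⟩
  have h31 := hq₃.trans hq₂
  refine (regular_productCCC _ _).bind (dense_finite_eq
    ((regular_sub _ _).mono (h31.trans hq₁) hF) (mono_ex _ h31 hfin)) ?_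
  rintro r hr ⟨Φ, h1, h2⟩
  refine productCCC_of_finset h1 h2 fun x hx y hy => ?_
  have h3 : ∀ x ∈ Φ, eq a (ord x.1.1) r := fun x hx =>
    isSequence.eq_ord (ha _ r hr (h1 x hx)).2 (eq_refl _ _)
  exact ord_inj (eq_trans (eq_symm (h3 x hx)) (h3 y hy))

end GenericTree

namespace GenericTree
open CohenPoset Forcing

variable {T W : Type u} [LinearOrder W] [OrderBot W] [OmegaOne W] [SuccOrder W] [PartialOrder T]
  {A : LevelTree T W} {κ : (W × ℕ × ℕ) × ℕ ≃ W}

/-! ### The specializing function -/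

variable (A κ) in
/-- The name for the function which maps `x` to the code of its value. -/
noncomputable def specialName : PName (CohenPoset W × T) :=
  ofForm (ι := Node W × ULift.{u} ℕ) (fun i => pair (lift T (seq A κ i.1.1)) (nat i.2.down))
    fun i pt => i.1.1.1 ≤ A.lv pt.2 ∧
      Decided κ (fun c => Encodable.encode (value A (tree A c) pt.2 i.1.1) = i.2.down) pt.1

/-- Going down in `T` does not change the restriction to the level of `x`, hence not the value
either. -/
theorem mono_specialName (i : Node W × ULift.{u} ℕ) : Mono fun pt : CohenPoset W × T =>
    i.1.1.1 ≤ A.lv pt.2 ∧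
      Decided κ (fun c => Encodable.encode (value A (tree A c) pt.2 i.1.1) = i.2.down) pt.1 := by
  rintro ⟨p, t⟩ ⟨p', t'⟩ ⟨hp, ht⟩ ⟨h1, h2⟩
  refine ⟨h1.trans (A.lv_anti ht), fun c hc => ?_⟩
  have h3 : value A (tree A c) t' i.1.1 = value A (tree A c) t i.1.1 := by
    rw [← value_res h1 (A.lv_anti ht), A.res_eq ht]
  dsimp only
  rw [h3]
  exact h2 c (hc.mono hp)

/-- Along the generic branch of `T` the values strictly increase down the chains of the new tree, so
comparable nodes with the same code coincide. The function is total because a condition in `T` can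
be extended to the level of any given node. -/
theorem isSpecial_treeName (pt : CohenPoset W × T) : isSpecial (lift T (treeName A κ)) pt := by
  have hval : ∀ (x : Node W) (t : T), x.1.1 ≤ A.lv t → ∀ c, ∀ᶠ c' in near c univ,
      Encodable.encode (value A (tree A c') t x.1) = Encodable.encode (value A (tree A c) t x.1) :=
    fun x t h c => (eventually_value A c h).mono fun _ h => by rw [h]
  refine ex_intro omega (regular_ex _).mono (ex_intro (specialName A κ)
    ((regular_isOmega _).mono.and ((regular_isFunction _ _ _).mono.and
      (Mono.all fun _ => Mono.all fun _ => Mono.all fun _ => mono_imp _ _)))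
    ⟨isOmega_iff.2 (eq_refl _ _), ?_, ?_⟩)
  · refine isFunction_ofForm mono_specialName ?_ ?_ ?_
    · rintro ⟨q, t⟩ _ i -
      exact ⟨mem_lift.2 (seq_mem_treeName _ q), nat_mem_omega _ _⟩
    · intro q _ a ha
      refine Forcing.Dense.bind (mem_lift_ofForm
        (x := fun x : Node W => seq A κ x.1) (φ := fun _ _ => True) (fun _ _ _ _ h => h) ha) ?_
      rintro r hr ⟨x, -, hx⟩ ⟨s, t⟩ hs
      -- The value at `x` is meaningful only once the condition in `T` has reached the level of `x`.
      obtain ⟨t', ht', hl⟩ : ∃ t' ≤ t, x.1.1 ≤ A.lv t' := by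
        rcases le_total x.1.1 (A.lv t) with h | h
        · exact ⟨t, le_rfl, h⟩
        · obtain ⟨t', ht', hl⟩ := A.exists_le h
          exact ⟨t', ht', hl.ge⟩
      obtain ⟨s', hs', n, hn⟩ := dense_decided_eq (κ := κ) (hval x t' hl) (p := s) s le_rfl
      have hle : (s', t') ≤ (s, t) := ⟨hs', ht'⟩
      exact ⟨(s', t'), hle, (x, ⟨n⟩), ⟨hl, hn⟩, mono_eq _ _ (hle.trans hs) hx⟩
    · rintro ⟨q, t⟩ _ ⟨x, m⟩ ⟨y, n⟩ ⟨-, hm⟩ ⟨-, hn⟩ he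
      obtain rfl : x = y := seq_inj (eq_lift.1 he)
      rw [show m = n from ULift.ext _ _ (decided_eq_unique hm hn)]
      exact eq_refl _ _
  · intro s t n q _ hs q₁ h₁ ht q₂ h₂ hst
    refine (regular_eq _ _).bind (Forcing.Dense.mono (h₂.trans h₁)
      ((mem_pair_ofForm mono_specialName).1 (pairMem_iff.1 hs))) ?_
    rintro q₃ h₃ ⟨⟨x, k⟩, hx, hxs, hk⟩
    refine (regular_eq _ _).bind (Forcing.Dense.mono (h₃.trans h₂)
      ((mem_pair_ofForm mono_specialName).1 (pairMem_iff.1 ht))) ?_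
    rintro ⟨r, u⟩ h₄ ⟨⟨y, l⟩, hy, hyt, hl⟩
    have hxs' := mono_eq _ _ h₄ hxs
    have hkl : k.down = l.down := nat_inj (eq_trans (eq_symm (mono_eq _ _ h₄ hk)) hl)
    have hsub : sub (seq A κ x.1) (seq A κ y.1) r := sub_of_sub_lift (t := u)
      (sub_trans (sub_of_eq (eq_symm hxs')) (sub_trans
        ((regular_sub _ _).mono (h₄.trans h₃) hst) (sub_of_eq hyt)))
    have hx' := mono_specialName (A := A) (κ := κ) (x, k) h₄ hx
    obtain ⟨c, hc⟩ := exists_allows κ r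
    have hbelow := sub_seq_iff.1 hsub c hc
    have hxy : x = y := by
      by_contra hne
      have hlt := hbelow.value_lt (hbelow.lt_of_ne fun h => hne (Subtype.ext h.symm)) hy.1
      refine hlt.ne (Encodable.encode_injective ((hx'.2 c hc).trans (Eq.trans ?_ (hy.2 c hc).symm)))
      exact hkl
    subst hxy
    exact eq_trans hxs' (eq_symm hyt)

end GenericTree

open GenericTree in
theorem lemma4p8 {T : Type u} [PartialOrder T] [DownwardTree T] (hT : IsAronszajn T)
    (p : CohenAlephOne.{u}) :
    (Forcing.ex fun S : Forcing.PName CohenAlephOne.{u} =>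
      Forcing.and (Forcing.isFree S)
        (Forcing.afterForcing (Q := T) (Forcing.isSpecial (Forcing.lift T S)))) p := by
  let W := (ω₁ : Ordinal.{u}).ToType
  have hW : OmegaOne W := .of_omegaOne
  have hne : Nonempty W := inferInstance
  let _ : OrderBot W := WellFoundedLT.toOrderBot W
  let _ : SuccOrder W := .ofLinearWellFoundedLT W
  -- The countable factors are absorbed by the infinite cardinality of `W`, so the Cohen bits can be
  -- indexed by coordinates of `c` and places.
  have hκ : Nonempty ((W × ℕ × ℕ) × ℕ ≃ W) := by
    rw [← Cardinal.eq]
    simp only [Cardinal.mk_prod, Cardinal.lift_uzero, Cardinal.mk_nat, Cardinal.lift_aleph0,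
      Cardinal.aleph0_mul_aleph0, mul_assoc]
    exact Cardinal.mul_aleph0_eq (Cardinal.aleph0_le_mk W)
  obtain ⟨κ⟩ := hκ
  exact fun q _ => ⟨q, le_rfl, treeName hT.levelTree κ, isFree_treeName q,
    fun t => isSpecial_treeName (q, t)⟩
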